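/- Let $I=[0,1]$. A continuous map $f:I\to I$ with $f(\partial I)\subseteq\partial I$ is called $l$-modal, $l\ge 1$, if its turning points (the points of $(0,1)$ at which $f$ has a local extremum) are finitely many, $c_1<\dots<c_l$, and $f$ is strictly monotone on each of the laps $I_1=[0,c_1),\ I_2=(c_1,c_2),\dots,\ I_{l+1}=(c_l,1]$; put $\mathrm{Crit}_f=\{c_1,\dots,c_l\}$. It is an analytic S-multimodal map if moreover it extends to a real analytic function on a neighbourhood of $I$, $f'(x)\neq 0$ for $x\in I\setminus\mathrm{Crit}_f$, and the Schwarzian derivative $Sf=\frac{f'''}{f'}-\frac32\left(\frac{f''}{f'}\right)^2$ is negative on $I\setminus\mathrm{Crit}_f$. A critical point $c\in\mathrm{Crit}_f$ is Collet–Eckmann (CE) if there are $C>0$ and $\lambda>1$ with $|(f^n)'(f(c))|>C\lambda^n$ for all $n\ge 0$, and recurrent if $c\in\omega(c)$, the set of accumulation points of the sequence $(f^n(c))_{n\ge0}$. The map $f$ is CE if all $c\in\mathrm{Crit}_f$ are CE, and RCE if all recurrent $c\in\mathrm{Crit}_f$ are CE. Two maps $f,g:I\to I$ are topologically conjugate if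 $h\circ f=g\circ h$ for some homeomorphism $h:I\to I$. The itinerary of $x\in I$ is the sequence whose $n$-th symbol is $I_k$ if $f^n(x)\in I_k$ and $c_k$ if $f^n(x)=c_k$, stopped at the first symbol of the form $c_k$; the kneading invariant of $f$ is the tuple of the itineraries of $f(c_1),\dots,f(c_l)$. **Theorem B.** The RCE condition is not a topological invariant for analytic S-multimodal maps: it is not true that any two topologically conjugate analytic S-multimodal maps $f,g$ are either both RCE or both not RCE. More precisely, there are real polynomials $P$ of degree $3$ and $Q$ of degree $7$, both mapping $I$ into itself with $P(0)=Q(0)=0$, whose restrictions to $I$ are analytic S-multimodal maps with exactly two turning points, $c_1<c_2$ and $\tilde c_1<\tilde c_2$ respectively, such that 1. $P-P(c_i)$ vanishes to order exactly $2$ at $c_i$, and $Q-Q(\tilde c_i)$ vanishes to order exactly $4$ at $\tilde c_i$, for $i=1,2$; 2. $P|_I$ and $Q|_I$ have the same kneading invariant and are topologically conjugate; 3. $P|_I$ is CE, hence RCE; 4. $\tilde c_2$ is recurrent for $Q$ but not CE, hence $Q|_I$ is not RCE. -/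

import Mathlib

open Set Filter Topology Polynomial

namespace IntervalDynamics

/-- The compact interval `[0,1]`. Interval maps are represented by functions `ℝ → ℝ` that map it
into itself; only their behaviour on (a neighbourhood of) the interval matters below. -/
abbrev I : Set ℝ := Icc (0 : ℝ) 1

/-- The turning points: interior points of the interval at which `f` has a local extremum. -/
def Crit (f : ℝ → ℝ) : Set ℝ := {x | x ∈ Ioo (0 : ℝ) 1 ∧ IsLocalExtr f x}

/-- The laps `[0,c₁), (c₁,c₂), …, (c_l,1]` cut out by `c₁ < … < c_l`, numbered from left to
right; both indices start at `0` in the code. -/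
def lap {l : ℕ} (c : Fin l → ℝ) (k : Fin (l + 1)) : Set ℝ :=
  {x | x ∈ I ∧ ∀ i : Fin l, (i.castSucc < k → c i < x) ∧ (k ≤ i.castSucc → x < c i)}

/-- `f` is an `l`-modal map of `[0,1]` with turning points `c₁ < … < c_l`. -/
structure IsModal {l : ℕ} (f : ℝ → ℝ) (c : Fin l → ℝ) : Prop where
  continuousOn : ContinuousOn f I
  mapsTo : MapsTo f I I
  mapsTo_boundary : MapsTo f {0, 1} {0, 1}
  strictMono : StrictMono c
  range_eq : range c = Crit f
  monotone_lap : ∀ k, StrictMonoOn f (lap c k) ∨ StrictAntiOn f (lap c k)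

/-- The Schwarzian derivative `f''' / f' - (3/2) (f'' / f')²`. -/
noncomputable def schwarzian (f : ℝ → ℝ) (x : ℝ) : ℝ :=
  iteratedDeriv 3 f x / deriv f x - 3 / 2 * (iteratedDeriv 2 f x / deriv f x) ^ 2

/-- `f` is an analytic `l`-modal map with turning points `c`, whose derivative has no zero
outside the turning points and whose Schwarzian derivative is negative there. -/
structure IsAnalyticSModal {l : ℕ} (f : ℝ → ℝ) (c : Fin l → ℝ) : Prop extends IsModal f c where
  analytic : AnalyticOnNhd ℝ f I
  deriv_ne_zero : ∀ x ∈ I, x ∉ range c → deriv f x ≠ 0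
  schwarzian_neg : ∀ x ∈ I, x ∉ range c → schwarzian f x < 0

/-- Analytic S-multimodal maps of `[0,1]`, with any positive number of turning points. -/
def IsAnalyticSMultimodal (f : ℝ → ℝ) : Prop :=
  ∃ (l : ℕ) (c : Fin l → ℝ), 1 ≤ l ∧ IsAnalyticSModal f c

/-- `x` belongs to its own `ω`-limit set. -/
def IsRecurrent (f : ℝ → ℝ) (x : ℝ) : Prop :=
  x ∈ omegaLimit (atTop : Filter ℕ) (fun n y => f^[n] y) {x}

/-- The Collet–Eckmann condition at the point `c`. -/
def IsCEAt (f : ℝ → ℝ) (c : ℝ) : Prop :=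
  ∃ C lam : ℝ, 0 < C ∧ 1 < lam ∧ ∀ n : ℕ, C * lam ^ n < |deriv (f^[n]) (f c)|

/-- The Collet–Eckmann condition: all critical points are Collet–Eckmann. -/
def IsCE (f : ℝ → ℝ) : Prop := ∀ c ∈ Crit f, IsCEAt f c

/-- The recurrent Collet–Eckmann condition: all recurrent critical points are Collet–Eckmann. -/
def IsRCE (f : ℝ → ℝ) : Prop := ∀ c ∈ Crit f, IsRecurrent f c → IsCEAt f c

/-- Topological conjugacy of interval maps by a homeomorphism of `[0,1]`. -/
def TopConjugate (f g : ℝ → ℝ) : Prop :=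
  ∃ (hf : MapsTo f I I) (hg : MapsTo g I I) (h : I ≃ₜ I),
    Function.Semiconj h (hf.restrict f I I) (hg.restrict g I I)

/-- The alphabet of itineraries: `l + 1` laps and `l` turning points. -/
abbrev Symbol (l : ℕ) : Type := Fin (l + 1) ⊕ Fin l

/-- The symbol `a` describes the position of the point `y`. -/
def HasSymbol {l : ℕ} (c : Fin l → ℝ) (y : ℝ) : Symbol l → Prop
  | Sum.inl k => y ∈ lap c k
  | Sum.inr k => y = c k

open Classical in
/-- The symbol of a point; every point of `[0,1]` has exactly one when `c` is increasing. -/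
noncomputable def symbol {l : ℕ} (c : Fin l → ℝ) (y : ℝ) : Option (Symbol l) :=
  if h : ∃ a, HasSymbol c y a then some h.choose else none

open Classical in
/-- The itinerary of `x`: the symbols of `x, f x, f² x, …` up to and including the first visit to
a turning point, where the sequence stops (it is continued by `none`). -/
noncomputable def itinerary {l : ℕ} (f : ℝ → ℝ) (c : Fin l → ℝ) (x : ℝ) (n : ℕ) :
    Option (Symbol l) :=
  if ∀ m < n, f^[m] x ∉ range c then symbol c (f^[n] x) else none

/-- The kneading invariant: the itineraries of the critical values. -/
noncomputable def kneadingInvariant {l : ℕ} (f : ℝ → ℝ) (c : Fin l → ℝ) :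
    Fin l → ℕ → Option (Symbol l) :=
  fun i => itinerary f c (f (c i))

/-- The degree of a polynomial map at `x`: the order of vanishing of `P - P(x)` at `x`. -/
noncomputable def localDegree (P : ℝ[X]) (x : ℝ) : ℕ :=
  (P - C (P.eval x)).rootMultiplicity x

end IntervalDynamics

namespace IntervalDynamics

/-! ### The kneading sequence -/

/-! Both maps belong to families `F A = 1 + A H` with `H' = (u (u - e)) ^ k`, normalised so that the
turning point `0` goes to the fixed point `1`. The only free critical orbit is that of `v = F e`.
The cubic has `k = 1` (critical order 2), the septic `k = 3` (critical order 4). One kneading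
sequence `K` is realised as the itinerary of `v` in both families. The two maps are then conjugate,
and what separates them is metric.

A long stay near the repelling point `1` must be prepared by a passage close to `0`. If the stay
starts at distance `ε` from `1`, the passage multiplies the derivative by about `ε ^ (1 - 1/ℓ)`,
where `ℓ` is the critical order: the exponent is `1/2` for the cubic and `3/4` for the septic. In
`K` there are stays, starting at times `n`, whose length is about `3n/4`, and none is essentially
longer (`exists_ne_two`). Write `D_n` for the derivative of the `n`-th iterate at `v` and `x_n` for
the orbit of `v`. For the cubic, close to a Chebyshev polynomial, an identity telescopes to `D_n ^ 2
≥ const * 6 ^ n * 9 ^ (-(3/4 + 1/20) n)`, which grows because `6 ^ 5 > 9 ^ 4` (`cubic_mult_growth`).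
For the septic, `D_n ^ 4 ≤ const * 500 ^ n * (1 - x_n) ^ 3`, where at the start of the long stays `1
- x_n ≤ const * 16 ^ (-3n/4)`. As `500 ^ 4 ≤ 16 ^ 9`, `D_n` stays bounded along these times
(`septic_mult_bounded`).

Recurrence comes from copies of ever longer initial words, each preceded by a `1`: the orbit then
returns to `e` (`Core.tendsto_return`). Such returns cost derivative, but they are so rare that the
cubic loses at most the factor `9 ^ (n/20)` in `D_n ^ 2` (`sum_costs_le`).

Realisation: every proper shift of `K` is larger than `K` in the order that reverses at each symbol
`1` (`exists_differs`). The intermediate value theorem gives a parameter for each finite word, and a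
limit gives one for `K` (`exists_kneads`). Conjugacy: points are determined by their itineraries
(`Core.eq_of_itinerary`). Iterates restricted to a lap do not increase cross-ratios, so an interval
of points with one itinerary cannot have branches with extensions of definite size on both sides
infinitely often, while the combinatorics of `K` provides such extensions. Matching itineraries then
gives `exists_conjugacy`. The polynomials are the maps `F A`, rescaled from the invariant interval
`[t, 1]` to the unit interval. -/

/-- The lengths of the words whose limit is the kneading sequence. -/
def len : ℕ → ℕ
  | 0 => 5
  | k + 1 => 301 * len k + (3 * (301 * len k) + 3) / 4 + len k + 6

/-- The position of the `k`-th long stay near the fixed point `1`. -/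
def big (k : ℕ) : ℕ := 301 * len k

/-- The duration of the `k`-th long stay near the fixed point `1`. -/
def run (k : ℕ) : ℕ := (3 * big k + 3) / 4

/-- The position of the `k`-th copy of an initial word. -/
def ret (k : ℕ) : ℕ := big k + run k + 2

/-- The word of stage `k + 1` is `U (022)^q 0 2^M 1 U 0202`, where `U` is the word of stage `k`. -/
def word : ℕ → ℕ → Fin 3
  | 0, n => if n = 0 then 0 else if n = 1 then 1 else 2
  | k + 1, n =>
    if n < len k then word k n
    else if n < big k then (if (n - len k) % 3 = 0 then 0 else 2)
    else if n = big k then 0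
    else if n ≤ big k + run k then 2
    else if n = big k + run k + 1 then 1
    else if n < ret k + len k then word k (n - ret k)
    else if n = ret k + len k ∨ n = ret k + len k + 2 then 0 else 2

/-- The kneading sequence: `0`, `1`, `2` stand for the left, middle and right lap. -/
def K (n : ℕ) : Fin 3 := word n n

/-- The parity of the number of symbols `1` before position `n`. -/
def od : ℕ → Bool
  | 0 => false
  | n + 1 => (od n != decide (K n = 1))

lemma len_succ (k : ℕ) : len (k + 1) = ret k + len k + 4 := by
  simp only [len, ret, big, run]; omega

lemma five_le_len (k : ℕ) : 5 ≤ len k := by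
  induction k with
  | zero => simp [len]
  | succ k ih => rw [len_succ]; omega

/-- The factor 301 serves two purposes: `300 * len k` is divisible by three, so the filler consists
of whole blocks `022`, and the copies are rare enough for `sum_costs_le`. -/
lemma big_eq (k : ℕ) : big k = 301 * len k := rfl

/-- Three quarters of the elapsed time is a proportion at which the passage near `0` destroys the
growth of the derivative for critical order 4 but not for order 2. -/
lemma run_bounds (k : ℕ) : 3 * big k ≤ 4 * run k ∧ 4 * run k ≤ 3 * big k + 3 := by
  simp only [run]; omega

lemma ret_eq (k : ℕ) : ret k = big k + run k + 2 := rfl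

lemma lt_len (k : ℕ) : k < len k := by
  induction k with
  | zero => simp [len]
  | succ k ih => rw [len_succ]; have := ret_eq k; omega

lemma word_eq_of_le {k j n : ℕ} (h : k ≤ j) (hn : n < len k) : word j n = word k n := by
  induction j, h using Nat.le_induction with
  | base => rfl
  | succ j hj ih =>
    have : n < len j := by
      clear ih
      induction j, hj using Nat.le_induction with
      | base => exact hn
      | succ j hj ih => rw [len_succ]; omega
    rw [← ih]; simp [word, this]

lemma word_eq_K {k n : ℕ} (hn : n < len k) : word k n = K n := by
  unfold K
  rcases le_total k n with h | h
  · exact (word_eq_of_le h hn).symm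
  · exact word_eq_of_le h (lt_len n)

lemma K_fill {k n : ℕ} (h1 : len k ≤ n) (h2 : n < big k) :
    K n = if (n - len k) % 3 = 0 then 0 else 2 := by
  have := len_succ k; have := ret_eq k
  rw [← word_eq_K (k := k + 1) (by omega)]
  simp [word, not_lt.2 h1, h2]

lemma K_big (k : ℕ) : K (big k) = 0 := by
  have := len_succ k; have := ret_eq k; have := big_eq k; have := five_le_len k
  rw [← word_eq_K (k := k + 1) (by omega)]
  have h : ¬ big k < len k := by omega
  simp [word, h]

lemma K_run {k n : ℕ} (h1 : big k < n) (h2 : n ≤ big k + run k) : K n = 2 := by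
  have := len_succ k; have := ret_eq k; have := big_eq k; have := five_le_len k
  rw [← word_eq_K (k := k + 1) (by omega)]
  have h : ¬ n < len k := by omega
  have h' : ¬ n < big k := by omega
  have h'' : ¬ n = big k := by omega
  simp [word, h, h', h'', h2]

lemma K_turn (k : ℕ) : K (big k + run k + 1) = 1 := by
  have := len_succ k; have := ret_eq k; have := big_eq k; have := five_le_len k
  rw [← word_eq_K (k := k + 1) (by omega)]
  have h : ¬ big k + run k + 1 < len k := by omega
  have h' : ¬ big k + run k + 1 < big k := by omega
  have h'' : ¬ big k + run k + 1 = big k := by omega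
  have h3 : ¬ big k + run k + 1 ≤ big k + run k := by omega
  simp only [word, h, h', h'', h3, if_false, if_true]

lemma K_ret {k i : ℕ} (hi : i < len k) : K (ret k + i) = K i := by
  have := len_succ k; have := ret_eq k; have := big_eq k; have := five_le_len k
  rw [← word_eq_K (k := k + 1) (by omega), ← word_eq_K hi]
  have h : ¬ ret k + i < len k := by omega
  have h' : ¬ ret k + i < big k := by omega
  have h'' : ¬ ret k + i = big k := by omega
  have h3 : ¬ ret k + i ≤ big k + run k := by omega
  have h4 : ¬ ret k + i = big k + run k + 1 := by omega
  have h5 : ret k + i < ret k + len k := by omega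
  simp only [word, h, h', h'', h3, h4, h5, if_false, if_true, Nat.add_sub_cancel_left]

lemma K_tail {k j : ℕ} (hj : j < 4) :
    K (ret k + len k + j) = if j = 0 ∨ j = 2 then 0 else 2 := by
  have := len_succ k; have := ret_eq k; have := big_eq k; have := five_le_len k
  rw [← word_eq_K (k := k + 1) (by omega)]
  have h : ¬ ret k + len k + j < len k := by omega
  have h' : ¬ ret k + len k + j < big k := by omega
  have h'' : ¬ ret k + len k + j = big k := by omega
  have h3 : ¬ ret k + len k + j ≤ big k + run k := by omega
  have h4 : ¬ ret k + len k + j = big k + run k + 1 := by omega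
  have h5 : ¬ ret k + len k + j < ret k + len k := by omega
  simp only [word, h, h', h'', h3, h4, h5, if_false]
  congr 1
  simp

lemma K_zero : K 0 = 0 := rfl
lemma K_one : K 1 = 1 := by rw [← word_eq_K (k := 0) (by simp [len])]; rfl
lemma K_init {n : ℕ} (h2 : 2 ≤ n) (h5 : n < 5) : K n = 2 := by
  rw [← word_eq_K (k := 0) (by simpa [len] using h5)]
  simp only [word, if_neg (by omega : ¬ n = 0), if_neg (by omega : ¬ n = 1)]

/-- Induction along the stages. -/
lemma stage_induction {p : ℕ → ℕ → Prop} (h0 : ∀ n < 5, p 0 n)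
    (hmono : ∀ k n, n < len k → p k n → p (k + 1) n)
    (hfill : ∀ k n, len k ≤ n → n < big k → p (k + 1) n)
    (hbig : ∀ k, p (k + 1) (big k))
    (hrun : ∀ k n, big k < n → n ≤ big k + run k → p (k + 1) n)
    (hturn : ∀ k, p (k + 1) (big k + run k + 1))
    (hret : ∀ k i, i < len k → p k i → p (k + 1) (ret k + i))
    (htail : ∀ k j, j < 4 → p (k + 1) (ret k + len k + j)) :
    ∀ k n, n < len k → p k n := by
  intro k
  induction k with
  | zero => intro n hn; exact h0 n hn
  | succ k ih =>
    intro n hn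
    have := len_succ k; have e := ret_eq k; have := big_eq k; have := five_le_len k
    by_cases c1 : n < len k
    · exact hmono k n c1 (ih n c1)
    by_cases c2 : n < big k
    · exact hfill k n (by omega) c2
    by_cases c3 : n = big k
    · rw [c3]; exact hbig k
    by_cases c4 : n ≤ big k + run k
    · exact hrun k n (by omega) c4
    by_cases c5 : n = big k + run k + 1
    · rw [c5]; exact hturn k
    by_cases c6 : n < ret k + len k
    · obtain ⟨i, rfl⟩ : ∃ i, n = ret k + i := ⟨n - ret k, by omega⟩
      exact hret k i (by omega) (ih i (by omega))
    · obtain ⟨i, rfl⟩ : ∃ i, n = ret k + len k + i := ⟨n - (ret k + len k), by omega⟩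
      exact htail k i (by omega)

/-! ### Parity of the words and transition rules -/

lemma K_last (k : ℕ) : K (len k - 1) = 2 := by
  cases k with
  | zero => exact K_init (by simp [len]) (by simp [len])
  | succ k =>
    have := K_tail (k := k) (j := 3) (by norm_num)
    rw [len_succ]; simpa using this

lemma od_succ (n : ℕ) : od (n + 1) = (od n != decide (K n = 1)) := rfl

lemma od_add {a j : ℕ} (h : ∀ i < j, K (a + i) ≠ 1) : od (a + j) = od a := by
  induction j with
  | zero => rfl
  | succ j ih =>
    rw [← add_assoc, od_succ, ih fun i hi => h i (by omega)]
    simp [h j (by omega)]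

/-- Filler and tail contain no `1`. Since the word `U` has an odd number of them, the single `1`
before its second copy makes the parity even again, so the copy is read with the parities of the
original. -/
lemma od_len_aux (k : ℕ) (hk : od (len k) = true) :
    (∀ n, len k ≤ n → n ≤ big k + run k + 1 → od n = true) ∧
    (∀ i ≤ len k, od (ret k + i) = od i) ∧
    (∀ j ≤ 4, od (ret k + len k + j) = true) := by
  have := len_succ k; have e := ret_eq k; have := big_eq k; have := five_le_len k
  have h1 : ∀ n, len k ≤ n → n ≤ big k + run k + 1 → od n = true := by
    intro n hn hn'
    obtain ⟨j, rfl⟩ : ∃ j, n = len k + j := ⟨n - len k, by omega⟩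
    rw [od_add, hk]
    intro i hi
    by_cases c2 : len k + i < big k
    · rw [K_fill (by omega) c2]; split_ifs <;> decide
    by_cases c3 : len k + i = big k
    · rw [c3, K_big]; decide
    · rw [K_run (k := k) (by omega) (by omega)]; decide
  have h2 : ∀ i ≤ len k, od (ret k + i) = od i := by
    intro i
    induction i with
    | zero =>
      intro _
      rw [ret_eq, add_zero, od_succ, h1 _ (by omega) (by omega), K_turn]; rfl
    | succ i ih =>
      intro hi
      rw [← add_assoc, od_succ, od_succ, ih (by omega), K_ret (by omega)]
  refine ⟨h1, h2, ?_⟩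
  intro j hj
  rw [od_add, h2 _ le_rfl, hk]
  intro i hi
  rw [K_tail (by omega)]; split_ifs <;> decide

lemma od_len (k : ℕ) : od (len k) = true := by
  induction k with
  | zero =>
    simp [len, od, K_zero, K_one, K_init (n := 2), K_init (n := 3), K_init (n := 4)]
  | succ k ih => rw [len_succ]; exact (od_len_aux k ih).2.2 4 le_rfl

/-- The transition rules of the kneading sequence. -/
structure Rules (K : ℕ → Fin 3) (od : ℕ → Bool) (i : ℕ) : Prop where
  even_zero : od i = false → K i = 0 → K (i + 1) = 1
  even_one : od i = false → K i = 1 → K (i + 1) = 2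
  even_two : od i = false → K i ≠ 2
  odd_zero : od i = true → K i = 0 → K (i + 1) = 2
  odd_one : od i = true → K i = 1 → K (i + 1) = 0

lemma rules_of_odd_two {i : ℕ} (h : od i = true) (h2 : K i = 2) : Rules K od i := by
  constructor <;> simp [h, h2]

lemma rules_of_odd_zero {i : ℕ} (h : od i = true) (h0 : K i = 0) (h2 : K (i + 1) = 2) :
    Rules K od i := by
  constructor <;> simp [h, h0, h2]

lemma rules (i : ℕ) : Rules K od i := by
  refine stage_induction (p := fun _ i => Rules K od i) ?_ ?_ ?_ ?_ ?_ ?_ ?_ ?_ i i (lt_len i)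
  · intro n hn
    have k2 := K_init (n := 2) le_rfl (by norm_num)
    have o2 : od 2 = true := by simp [od, K_zero, K_one]
    rcases n with _ | _ | n
    · constructor <;> simp [od, K_zero, K_one]
    · constructor <;> simp [od, K_zero, K_one, k2]
    · refine rules_of_odd_two ?_ (K_init (by omega) hn)
      have : od (2 + n) = od 2 := od_add fun i hi => by rw [K_init (by omega) (by omega)]; decide
      rw [show n + 1 + 1 = 2 + n by omega, this, o2]
  · intro k n _ h; exact h
  · intro k n h1 h2
    have ho := (od_len_aux k (od_len k)).1 n h1 (by omega)
    have hK := K_fill h1 h2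
    split_ifs at hK with hm
    · refine rules_of_odd_zero ho hK ?_
      have := big_eq k
      rw [K_fill (by omega) (by omega : n + 1 < big k), if_neg (by omega)]
    · exact rules_of_odd_two ho hK
  · intro k
    have := big_eq k; have := five_le_len k; have := run_bounds k
    exact rules_of_odd_zero ((od_len_aux k (od_len k)).1 _ (by omega) (by omega)) (K_big k)
      (K_run (k := k) (by omega) (by omega))
  · intro k n h1 h2
    have := big_eq k
    exact rules_of_odd_two ((od_len_aux k (od_len k)).1 _ (by omega) (by omega)) (K_run h1 h2)
  · intro k
    have := big_eq k; have := five_le_len k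
    have h := (od_len_aux k (od_len k)).1 (big k + run k + 1) (by omega) (by omega)
    have h1 := K_turn k
    have h2 := K_ret (k := k) (i := 0) (by omega)
    rw [add_zero, K_zero, ret_eq] at h2
    constructor <;> simp [h, h1, h2]
  · intro k i hi h
    have ho := (od_len_aux k (od_len k)).2.1 i hi.le
    have h1 := K_ret hi
    by_cases hi' : i + 1 < len k
    · have h2 := K_ret hi'
      rw [← add_assoc] at h2
      obtain ⟨a, b, c, d, e⟩ := h
      constructor <;> simp only [ho, h1, h2] <;> assumption
    -- The successor of the last symbol lies outside the copy, but a `2` at odd parity obeys the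
    -- rules whatever follows it.
    · have e : i = len k - 1 := by omega
      have ht : od i = true := by
        have := od_len k
        rw [show len k = i + 1 by omega, od_succ, e, K_last] at this
        rw [e]
        simpa using this
      exact rules_of_odd_two (ho.trans ht) (by rw [h1, e, K_last])
  · intro k j hj
    have ho := (od_len_aux k (od_len k)).2.2 j hj.le
    have hK := K_tail (k := k) hj
    split_ifs at hK with hm
    · refine rules_of_odd_zero ho hK ?_
      rw [add_assoc, K_tail (by omega), if_neg (by omega)]
    · exact rules_of_odd_two ho hK

/-! ### Admissibility: comparison of the sequence with its shifts -/

/-- The way in which the shifted sequence first differs from the sequence itself. -/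
def Differs (d c : ℕ) : Prop :=
  (∀ i < c, K (d + i) = K i) ∧
    ((c = 0 ∧ K d ≠ 0) ∨ (c = 1 ∧ K d = 0 ∧ K (d + 1) = 2) ∨
      (2 ≤ c ∧ K (d + c) = 0 ∧ K c = 2 ∧ od c = true ∧ od (d + c) = true))

lemma differs_zero {d : ℕ} (h : K d ≠ 0) : Differs d 0 := ⟨by simp, Or.inl ⟨rfl, h⟩⟩

lemma differs_one {d : ℕ} (h : K d = 0) (h' : K (d + 1) = 2) : Differs d 1 :=
  ⟨fun i hi => by rw [Nat.lt_one_iff.1 hi]; exact h, Or.inr (Or.inl ⟨rfl, h, h'⟩)⟩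

lemma K_len_add (k : ℕ) : K (len k) = 0 ∧ K (len k + 1) = 2 ∧ K (len k + 2) = 2 := by
  have := big_eq k; have := five_le_len k
  refine ⟨?_, ?_, ?_⟩ <;> rw [K_fill (k := k) (by omega) (by omega)] <;> simp

/-- Only the second copy of `U` needs an argument. From its first symbol on, the match runs through
`U 02` and breaks at `0` against `2`, at odd parity; this is why the tail is `0202` while the filler
begins `022`. From a later symbol of the copy, the difference is that of the original, which by
induction lies inside `U`. -/
lemma exists_differs_aux (k d : ℕ) (hd : d < len k) (hd1 : 1 ≤ d) :
    ∃ c, d + c < len k ∧ Differs d c := by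
  revert hd1
  refine stage_induction (p := fun k d => 1 ≤ d → ∃ c, d + c < len k ∧ Differs d c)
    ?_ ?_ ?_ ?_ ?_ ?_ ?_ ?_ k d hd
  · intro n hn h1
    refine ⟨0, by simpa [len] using hn, differs_zero ?_⟩
    rcases Nat.lt_or_ge n 2 with h | h
    · rw [show n = 1 by omega, K_one]; decide
    · rw [K_init h hn]; decide
  · intro k n hn h h1
    obtain ⟨c, hc, hD⟩ := h h1
    exact ⟨c, by rw [len_succ]; omega, hD⟩
  · intro k n h1 h2 _
    have := len_succ k; have := ret_eq k; have := big_eq k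
    have hK := K_fill h1 h2
    split_ifs at hK with hm
    · refine ⟨1, by omega, differs_one hK ?_⟩
      rw [K_fill (by omega) (by omega : n + 1 < big k), if_neg (by omega)]
    · exact ⟨0, by omega, differs_zero (by rw [hK]; decide)⟩
  · intro k _
    have := len_succ k; have := ret_eq k; have := big_eq k; have := run_bounds k
    have := five_le_len k
    exact ⟨1, by omega, differs_one (K_big k) (K_run (k := k) (by omega) (by omega))⟩
  · intro k n h1 h2 _
    have := len_succ k; have := ret_eq k
    exact ⟨0, by omega, differs_zero (by rw [K_run h1 h2]; decide)⟩
  · intro k _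
    have := len_succ k; have := ret_eq k
    exact ⟨0, by omega, differs_zero (by rw [K_turn]; decide)⟩
  · intro k i hi h _
    have := len_succ k; have := five_le_len k
    rcases Nat.eq_zero_or_pos i with rfl | hpos
    · obtain ⟨a0, a1, a2⟩ := K_len_add k
      have t0 := K_tail (k := k) (j := 0) (by norm_num)
      have t1 := K_tail (k := k) (j := 1) (by norm_num)
      have t2 := K_tail (k := k) (j := 2) (by norm_num)
      norm_num at t0 t1 t2
      refine ⟨len k + 2, by omega, ?_, Or.inr (Or.inr ⟨by omega, ?_, a2, ?_, ?_⟩)⟩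
      · intro j hj
        rcases Nat.lt_or_ge j (len k) with hj' | hj'
        · exact K_ret hj'
        · rcases (by omega : j = len k ∨ j = len k + 1) with rfl | rfl
          · rw [a0]; exact t0
          · rw [a1]; exact t1
      · exact t2
      · rw [od_add, od_len]
        intro j hj
        rcases (by omega : j = 0 ∨ j = 1) with rfl | rfl
        · rw [add_zero, a0]; decide
        · rw [a1]; decide
      · exact (od_len_aux k (od_len k)).2.2 2 (by norm_num)
    · obtain ⟨c, hc, hD, hD'⟩ := h hpos
      have e : ∀ j < c + 1, K (ret k + i + j) = K (i + j) := fun j hj => by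
        rw [add_assoc]; exact K_ret (by omega)
      refine ⟨c, by omega, fun j hj => (e j (by omega)).trans (hD j hj), ?_⟩
      rcases hD' with ⟨rfl, h⟩ | ⟨rfl, h, h'⟩ | ⟨h2, h3, h4, h5, h6⟩
      · exact Or.inl ⟨rfl, by rwa [K_ret hi]⟩
      · exact Or.inr (Or.inl ⟨rfl, by rwa [K_ret hi], by rwa [e 1 (by omega)]⟩)
      · refine Or.inr (Or.inr ⟨h2, by rwa [e c (by omega)], h4, h5, ?_⟩)
        rw [add_assoc, (od_len_aux k (od_len k)).2.1 _ (by omega), h6]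
  · intro k j hj _
    have := len_succ k
    have hK := K_tail (k := k) hj
    split_ifs at hK with hm
    · refine ⟨1, by omega, differs_one hK ?_⟩
      rw [add_assoc, K_tail (by omega), if_neg (by omega)]
    · exact ⟨0, by omega, differs_zero (by rw [hK]; decide)⟩

/-- Each alternative of `Differs` makes the shift larger in the order twisted by parity: this is the
admissibility of `K` as the itinerary of the least point of an orbit. In the third alternative the
symbols are `0` and `2`, whose laps are a definite distance apart. -/
lemma exists_differs {d : ℕ} (hd : 1 ≤ d) : ∃ c, Differs d c := by
  obtain ⟨c, -, h⟩ := exists_differs_aux d d (lt_len d) hd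
  exact ⟨c, h⟩

/-- The first difference of a shifted sequence is of the prescribed kind. -/
lemma differs_of_first {d c : ℕ} (hd : 1 ≤ d) (h : ∀ i < c, K (d + i) = K i)
    (h' : K (d + c) ≠ K c) : Differs d c := by
  obtain ⟨c', hc'⟩ := exists_differs hd
  have hne : K (d + c') ≠ K c' := by
    rcases hc'.2 with ⟨rfl, h⟩ | ⟨rfl, h, h'⟩ | ⟨h2, h3, h4, h5, h6⟩
    · simpa [K_zero] using h
    · rw [h', K_one]; decide
    · rw [h3, h4]; decide
  have : c = c' := by
    rcases lt_trichotomy c c' with hlt | heq | hlt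
    · exact absurd (hc'.1 c hlt) h'
    · exact heq
    · exact absurd (h c' hlt) hne
  rwa [this]

lemma Differs.ne {d c : ℕ} (hc : Differs d c) : K (d + c) ≠ K c := by
  rcases hc.2 with ⟨rfl, h⟩ | ⟨rfl, h, h'⟩ | ⟨h2, h3, h4, h5, h6⟩
  · simpa [K_zero] using h
  · rw [h', K_one]; decide
  · rw [h3, h4]; decide

/-- The word before the `k`-th long stay has no proper border. -/
lemma big_unbordered {k d : ℕ} (hd : 1 ≤ d) (hd' : d < big k) :
    ∃ c, d + c < big k ∧ Differs d c := by
  have := big_eq k; have := five_le_len k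
  rcases Nat.lt_or_ge d (len k) with h | h
  · obtain ⟨c, hc, hD⟩ := exists_differs_aux k d h hd
    exact ⟨c, by omega, hD⟩
  · have hK := K_fill h hd'
    split_ifs at hK with hm
    · refine ⟨1, by omega, differs_one hK ?_⟩
      rw [K_fill (by omega) (by omega : d + 1 < big k), if_neg (by omega)]
    · exact ⟨0, by omega, differs_zero (by rw [hK]; decide)⟩

/-! ### Length of the stays and cost of the close returns -/

/-- A stay in the right lap that starts at time `n` is shorter than `3 n / 4` up to a constant. -/
lemma exists_ne_two (n : ℕ) : ∃ m, 4 * m ≤ 3 * n + 20 ∧ K (n + m) ≠ 2 := by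
  suffices h : ∀ k n, n < len k → ∃ m, 4 * m ≤ 3 * n + 20 ∧ n + m ≤ len k ∧ K (n + m) ≠ 2 by
    obtain ⟨m, h1, -, h2⟩ := h n n (lt_len n); exact ⟨m, h1, h2⟩
  refine stage_induction (p := fun k n => ∃ m, 4 * m ≤ 3 * n + 20 ∧ n + m ≤ len k ∧ K (n + m) ≠ 2)
    ?_ ?_ ?_ ?_ ?_ ?_ ?_ ?_
  · intro n hn
    refine ⟨5 - n, by omega, by simp [len]; omega, ?_⟩
    rw [show n + (5 - n) = len 0 by simp [len]; omega, (K_len_add 0).1]; decide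
  · rintro k n hn ⟨m, h1, h2, h3⟩
    exact ⟨m, h1, by rw [len_succ]; omega, h3⟩
  · intro k n h1 h2
    have := len_succ k; have := ret_eq k; have := big_eq k
    obtain ⟨j, hj, hj'⟩ : ∃ j < 3, (n + j - len k) % 3 = 0 := by
      refine ⟨(3 - (n - len k) % 3) % 3, by omega, by omega⟩
    refine ⟨j, by omega, by omega, ?_⟩
    rcases Nat.lt_or_ge (n + j) (big k) with h | h
    · rw [K_fill (by omega) h, if_pos hj']; decide
    · rw [show n + j = big k by omega, K_big]; decide
  · intro k
    have := len_succ k; have := ret_eq k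
    exact ⟨0, by omega, by omega, by rw [add_zero, K_big]; decide⟩
  · intro k n h1 h2
    have := len_succ k; have := ret_eq k; have := run_bounds k
    refine ⟨big k + run k + 1 - n, by omega, by omega, ?_⟩
    rw [show n + (big k + run k + 1 - n) = big k + run k + 1 by omega, K_turn]; decide
  · intro k
    have := len_succ k; have := ret_eq k
    exact ⟨0, by omega, by omega, by rw [add_zero, K_turn]; decide⟩
  · rintro k i hi ⟨m, h1, h2, h3⟩
    have := len_succ k
    refine ⟨m, by omega, by omega, ?_⟩
    rcases Nat.lt_or_ge (i + m) (len k) with h | h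
    · rw [add_assoc, K_ret h]; exact h3
    · have t0 := K_tail (k := k) (j := 0) (by norm_num)
      rw [show ret k + i + m = ret k + len k + 0 by omega, t0]; decide
  · intro k j hj
    have := len_succ k; have := five_le_len k; have := ret_eq k; have := big_eq k
    refine ⟨4 - j, by omega, by omega, ?_⟩
    rw [show ret k + len k + j + (4 - j) = len (k + 1) by omega, (K_len_add _).1]; decide

/-- The cost of the close returns: at a close return it exceeds the length of the copy. -/
def cost : ℕ → ℕ → ℕ
  | 0, _ => 0
  | k + 1, n =>
    if n < len k then cost k n
    else if n = ret k then len k + 3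
    else if ret k < n ∧ n < ret k + len k then cost k (n - ret k)
    else 0

lemma cost_eq_of_le {k j n : ℕ} (h : k ≤ j) (hn : n < len k) : cost j n = cost k n := by
  induction j, h using Nat.le_induction with
  | base => rfl
  | succ j hj ih =>
    have : n < len j := by
      clear ih
      induction j, hj using Nat.le_induction with
      | base => exact hn
      | succ j hj ih => rw [len_succ]; omega
    rw [← ih]; simp [cost, this]

/-- The limit of the functions `cost`. -/
def costs (n : ℕ) : ℕ := cost n n

lemma cost_eq_costs {k n : ℕ} (hn : n < len k) : cost k n = costs n := by
  unfold costs
  rcases le_total k n with h | h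
  · exact (cost_eq_of_le h hn).symm
  · exact cost_eq_of_le h (lt_len n)

lemma costs_ret (k : ℕ) : costs (ret k) = len k + 3 := by
  have := len_succ k; have := ret_eq k; have := big_eq k
  rw [← cost_eq_costs (k := k + 1) (by omega)]
  simp only [cost, if_neg (by omega : ¬ ret k < len k), if_true]

lemma costs_ret_add {k i : ℕ} (hi : i < len k) (hi0 : 0 < i) : costs (ret k + i) = costs i := by
  have := len_succ k; have := ret_eq k; have := big_eq k
  rw [← cost_eq_costs (k := k + 1) (by omega), ← cost_eq_costs hi]
  simp only [cost, if_neg (by omega : ¬ ret k + i < len k), if_neg (by omega : ¬ ret k + i = ret k),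
    if_pos (by omega : ret k < ret k + i ∧ ret k + i < ret k + len k), Nat.add_sub_cancel_left]

lemma costs_eq_zero {k n : ℕ} (h1 : len k ≤ n) (h2 : n < ret k ∨ ret k + len k ≤ n)
    (h3 : n < len (k + 1)) : costs n = 0 := by
  have := five_le_len k
  rw [← cost_eq_costs h3]
  simp only [cost, if_neg (by omega : ¬ n < len k), if_neg (by omega : ¬ n = ret k),
    if_neg (by omega : ¬ (ret k < n ∧ n < ret k + len k))]

lemma costs_zero : costs 0 = 0 := rfl

/-- At each time the first difference is early, or its place is bounded by the cost. -/
lemma exists_differs_cost {d : ℕ} (hd : 1 ≤ d) : ∃ c, Differs d c ∧ (c ≤ 1 ∨ c + 1 ≤ costs d) := by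
  suffices h : ∀ k d, d < len k → 1 ≤ d → ∃ c, Differs d c ∧ (c ≤ 1 ∨ c + 1 ≤ costs d) ∧
      d + c < len k by
    obtain ⟨c, h1, h2, -⟩ := h d d (lt_len d) hd; exact ⟨c, h1, h2⟩
  -- There is only one first difference, so the one found inside the word is as early as any other.
  have early : ∀ k d, d < len k → 1 ≤ d → (∃ c ≤ 1, Differs d c) →
      ∃ c, Differs d c ∧ (c ≤ 1 ∨ c + 1 ≤ costs d) ∧ d + c < len k := by
    rintro k d hk h1 ⟨c, hc, hD⟩
    obtain ⟨c', hc', hD'⟩ := exists_differs_aux k d hk h1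
    have : c' ≤ c := by
      by_contra h
      exact hD.ne (hD'.1 c (by omega))
    exact ⟨c', hD', Or.inl (by omega), hc'⟩
  refine stage_induction (p := fun k d => 1 ≤ d → ∃ c, Differs d c ∧ (c ≤ 1 ∨ c + 1 ≤ costs d) ∧
      d + c < len k) ?_ ?_ ?_ ?_ ?_ ?_ ?_ ?_
  · intro n hn h1
    refine early 0 n hn h1 ⟨0, by omega, differs_zero ?_⟩
    rcases Nat.lt_or_ge n 2 with h | h
    · rw [show n = 1 by omega, K_one]; decide
    · rw [K_init h hn]; decide
  · intro k n hn h h1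
    obtain ⟨c, hD, hc, hl⟩ := h h1
    exact ⟨c, hD, hc, by rw [len_succ]; omega⟩
  · intro k n h1 h2 h3
    have := len_succ k; have := ret_eq k; have := big_eq k
    refine early _ n (by omega) h3 ?_
    have hK := K_fill h1 h2
    split_ifs at hK with hm
    · refine ⟨1, le_rfl, differs_one hK ?_⟩
      rw [K_fill (by omega) (by omega : n + 1 < big k), if_neg (by omega)]
    · exact ⟨0, by omega, differs_zero (by rw [hK]; decide)⟩
  · intro k h1
    have := len_succ k; have := ret_eq k; have := run_bounds k
    exact early _ _ (by omega) h1
      ⟨1, le_rfl, differs_one (K_big k) (K_run (k := k) (by omega) (by omega))⟩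
  · intro k n h1 h2 h3
    have := len_succ k; have := ret_eq k
    exact early _ _ (by omega) h3 ⟨0, by omega, differs_zero (by rw [K_run h1 h2]; decide)⟩
  · intro k h1
    have := len_succ k; have := ret_eq k
    exact early _ _ (by omega) h1 ⟨0, by omega, differs_zero (by rw [K_turn]; decide)⟩
  · intro k i hi h h1
    have := len_succ k; have := five_le_len k
    rcases Nat.eq_zero_or_pos i with rfl | hpos
    -- The third symbol of the tail breaks the match at place `len k + 2` at the latest; the cost is
    -- one more than this bound.
    · obtain ⟨c, hc, hD⟩ := exists_differs_aux (k + 1) (ret k + 0) (by omega) h1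
      refine ⟨c, hD, Or.inr ?_, hc⟩
      rw [add_zero, costs_ret]
      have t2 := K_tail (k := k) (j := 2) (by norm_num)
      norm_num at t2
      by_contra hlt
      have := hD.1 (len k + 2) (by omega)
      rw [(K_len_add k).2.2, show ret k + 0 + (len k + 2) = ret k + len k + 2 by omega, t2] at this
      exact absurd this (by decide)
    · obtain ⟨c, hD, hc, hl⟩ := h hpos
      obtain ⟨c', hc', hD'⟩ := exists_differs_aux (k + 1) (ret k + i) (by omega) h1
      refine ⟨c', hD', ?_, hc'⟩
      rw [costs_ret_add hi hpos]
      have : c' ≤ c := by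
        by_contra hlt
        apply hD.ne
        rw [← K_ret hl, ← add_assoc]
        exact hD'.1 c (by omega)
      omega
  · intro k j hj h1
    have := len_succ k
    refine early _ _ (by omega) h1 ?_
    have hK := K_tail (k := k) hj
    split_ifs at hK with hm
    · refine ⟨1, le_rfl, differs_one hK ?_⟩
      rw [add_assoc, K_tail (by omega), if_neg (by omega)]
    · exact ⟨0, by omega, differs_zero (by rw [hK]; decide)⟩

lemma sum_costs_add_eq {a j : ℕ} (h : ∀ i < j, costs (a + i) = 0) :
    ∑ i ∈ Finset.range (a + j), costs i = ∑ i ∈ Finset.range a, costs i := by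
  rw [Finset.sum_range_add, Finset.sum_eq_zero (s := Finset.range j), add_zero]
  intro i hi; exact h i (Finset.mem_range.1 hi)

lemma sum_costs_le_of_le {a b : ℕ} (h : a ≤ b) :
    ∑ i ∈ Finset.range a, costs i ≤ ∑ i ∈ Finset.range b, costs i :=
  Finset.sum_le_sum_of_subset (Finset.range_mono h)

/-- A stage pays `len k + 3` for its own return and repeats the costs of the copied word; filler and
long stay are free. -/
lemma sum_costs_ret {k j : ℕ} (hj : j ≤ len k) (hj0 : 1 ≤ j) :
    ∑ i ∈ Finset.range (ret k + j), costs i =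
      ∑ i ∈ Finset.range (len k), costs i + (len k + 3) + ∑ i ∈ Finset.range j, costs i := by
  have := len_succ k; have := ret_eq k; have := big_eq k
  have h1 : ∑ i ∈ Finset.range (ret k), costs i = ∑ i ∈ Finset.range (len k), costs i := by
    rw [show ret k = len k + (ret k - len k) by omega]
    exact sum_costs_add_eq fun i hi => costs_eq_zero (k := k) (by omega) (by omega) (by omega)
  obtain ⟨j, rfl⟩ : ∃ i, j = i + 1 := ⟨j - 1, by omega⟩
  rw [Finset.sum_range_add, h1, Finset.sum_range_succ', Finset.sum_range_succ' (n := j), costs_zero,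
    add_zero (ret k), costs_ret, Finset.sum_congr rfl fun i hi =>
      costs_ret_add (k := k) (i := i + 1) (by have := Finset.mem_range.1 hi; omega) (by omega)]
  omega

/-- The close returns cost little. -/
lemma sum_costs_le (n : ℕ) : 20 * ∑ i ∈ Finset.range n, costs i ≤ n := by
  suffices h : ∀ k n, n ≤ len k → 20 * ∑ i ∈ Finset.range n, costs i ≤ n from h n n (lt_len n).le
  intro k
  induction k with
  | zero =>
    intro n hn
    rw [Finset.sum_eq_zero]
    · omega
    · intro i hi
      have := Finset.mem_range.1 hi
      rw [← cost_eq_costs (k := 0) (by omega)]; rfl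
  | succ k ih =>
    intro n hn
    have := len_succ k; have := ret_eq k; have := big_eq k; have := five_le_len k
    have hS := ih _ le_rfl
    rcases Nat.lt_or_ge n (len k) with h | h
    · exact ih n h.le
    rcases Nat.lt_or_ge (ret k) n with h' | h'
    -- More than `301 * len k` steps have passed, while the sum has at most doubled and gained `len
    -- k + 3`.
    · have hr := sum_costs_ret (k := k) (j := len k) le_rfl (by omega)
      have : ∑ i ∈ Finset.range n, costs i ≤ ∑ i ∈ Finset.range (ret k + len k), costs i := by
        rcases le_total n (ret k + len k) with h2 | h2
        · exact sum_costs_le_of_le h2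
        · rw [show n = ret k + len k + (n - (ret k + len k)) by omega]
          exact (sum_costs_add_eq fun i hi =>
            costs_eq_zero (k := k) (by omega) (by omega) (by omega)).le
      omega
    · have : ∑ i ∈ Finset.range n, costs i = ∑ i ∈ Finset.range (len k), costs i := by
        rw [show n = len k + (n - len k) by omega]
        exact sum_costs_add_eq fun i hi => costs_eq_zero (k := k) (by omega) (by omega) (by omega)
      omega

lemma K_pred_ret (k : ℕ) : K (ret k - 1) = 1 := K_turn k

end IntervalDynamics

namespace IntervalDynamics

/-! ### The one-parameter families -/

/-- A primitive `H` of `(u (u - e)) ^ k`, for an odd `k`, with `H 0 = H 1 = 0`. -/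
structure Shape where
  H : ℝ → ℝ
  e : ℝ
  k : ℕ
  k_odd : Odd k
  e_pos : 0 < e
  e_lt : e < 1
  hasDeriv : ∀ u, HasDerivAt H ((u * (u - e)) ^ k) u
  H_zero : H 0 = 0
  H_one : H 1 = 0

namespace Shape

variable (S : Shape)

/-- The map `1 + A H`: it has the turning points `0`, with value `1`, and `e`; `1` is fixed. -/
def F (A u : ℝ) : ℝ := 1 + A * S.H u

/-- The derivative of `S.F A`. -/
def F' (A u : ℝ) : ℝ := A * (u * (u - S.e)) ^ S.k

/-- The closed laps. -/
def cl : Fin 3 → Set ℝ := ![Iic 0, Icc 0 S.e, Ici S.e]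

/-- The open laps. -/
def op : Fin 3 → Set ℝ := ![Iio 0, Ioo 0 S.e, Ioi S.e]

@[simp] lemma cl_zero : S.cl 0 = Iic 0 := rfl
@[simp] lemma cl_one : S.cl 1 = Icc 0 S.e := rfl
@[simp] lemma cl_two : S.cl 2 = Ici S.e := rfl
@[simp] lemma op_zero : S.op 0 = Iio 0 := rfl
@[simp] lemma op_one : S.op 1 = Ioo 0 S.e := rfl
@[simp] lemma op_two : S.op 2 = Ioi S.e := rfl

lemma op_subset_cl (s : Fin 3) : S.op s ⊆ S.cl s := by
  fin_cases s
  · exact Iio_subset_Iic_self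
  · exact Ioo_subset_Icc_self
  · exact Ioi_subset_Ici_self

lemma isClosed_cl (s : Fin 3) : IsClosed (S.cl s) := by
  fin_cases s
  · exact isClosed_Iic
  · exact isClosed_Icc
  · exact isClosed_Ici

lemma ordConnected_cl (s : Fin 3) : OrdConnected (S.cl s) := by
  fin_cases s
  · exact ordConnected_Iic
  · exact ordConnected_Icc
  · exact ordConnected_Ici

lemma exists_mem_cl (u : ℝ) : ∃ s, u ∈ S.cl s := by
  rcases le_total u 0 with h | h
  · exact ⟨0, h⟩
  rcases le_total u S.e with h' | h'
  · exact ⟨1, h, h'⟩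
  · exact ⟨2, h'⟩

lemma eq_of_mem_op_of_mem_cl {u : ℝ} {s t : Fin 3} (h : u ∈ S.op s) (h' : u ∈ S.cl t) :
    s = t := by
  have := S.e_pos
  fin_cases s <;> fin_cases t <;> simp at h h' ⊢ <;> linarith

lemma mem_op_of_mem_cl {u : ℝ} {s : Fin 3} (h : u ∈ S.cl s) (h0 : u ≠ 0) (he : u ≠ S.e) :
    u ∈ S.op s := by
  fin_cases s
  · exact lt_of_le_of_ne h h0
  · exact ⟨lt_of_le_of_ne h.1 h0.symm, lt_of_le_of_ne h.2 he⟩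
  · exact lt_of_le_of_ne h he.symm

lemma le_of_mem_cl_of_lt {x y : ℝ} {s t : Fin 3} (hx : x ∈ S.cl s) (hy : y ∈ S.cl t)
    (h : s < t) : x ≤ y := by
  have := S.e_pos
  fin_cases s <;> fin_cases t <;> simp at hx hy h ⊢ <;> linarith

lemma continuous_H : Continuous S.H :=
  continuous_iff_continuousAt.2 fun u => (S.hasDeriv u).continuousAt

lemma deriv_H (u : ℝ) : deriv S.H u = (u * (u - S.e)) ^ S.k := (S.hasDeriv u).deriv

lemma strictMonoOn_H_left : StrictMonoOn S.H (Iic 0) := by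
  refine strictMonoOn_of_deriv_pos (convex_Iic 0) S.continuous_H.continuousOn fun u hu => ?_
  rw [interior_Iic, mem_Iio] at hu
  rw [deriv_H]
  have := S.e_pos
  exact pow_pos (mul_pos_of_neg_of_neg hu (by linarith)) _

lemma strictAntiOn_H : StrictAntiOn S.H (Icc 0 S.e) := by
  refine strictAntiOn_of_deriv_neg (convex_Icc 0 S.e) S.continuous_H.continuousOn fun u hu => ?_
  rw [interior_Icc] at hu
  rw [deriv_H]
  exact S.k_odd.pow_neg (mul_neg_of_pos_of_neg hu.1 (by linarith [hu.2]))

lemma strictMonoOn_H_right : StrictMonoOn S.H (Ici S.e) := by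
  refine strictMonoOn_of_deriv_pos (convex_Ici _) S.continuous_H.continuousOn fun u hu => ?_
  rw [interior_Ici, mem_Ioi] at hu
  rw [deriv_H]
  have := S.e_pos
  exact pow_pos (mul_pos (by linarith) (by linarith)) _

/-- The derivative of `H` is symmetric about `e / 2`, so `H` is odd about that point up to a
constant. Hence `e - 1` mirrors `1`, and the left lap cut at `e - 1` has the same image as the right
lap cut at `1`. -/
lemma H_sub (u : ℝ) : S.H (S.e - u) = S.H S.e - S.H u := by
  have h : ∀ x, HasDerivAt (fun x => S.H (S.e - x) + S.H x) 0 x := fun x => by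
    have h1 : HasDerivAt (fun x => S.e - x) (-1) x := by
      simpa using (hasDerivAt_id x).const_sub S.e
    have h2 := (S.hasDeriv (S.e - x)).comp x h1
    have h3 := h2.add (S.hasDeriv x)
    rwa [show (S.e - x) * (S.e - x - S.e) = x * (x - S.e) by ring,
      show (x * (x - S.e)) ^ S.k * -1 + (x * (x - S.e)) ^ S.k = 0 by ring] at h3
  have := is_const_of_deriv_eq_zero (fun x => (h x).differentiableAt) (fun x => (h x).deriv) u 0
  simp [S.H_zero] at this
  linarith

lemma H_e_neg : S.H S.e < 0 := by
  have := S.strictAntiOn_H (left_mem_Icc.2 S.e_pos.le) (right_mem_Icc.2 S.e_pos.le) S.e_pos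
  rwa [S.H_zero] at this

lemma H_e_sub_one : S.H (S.e - 1) = S.H S.e := by rw [H_sub, H_one, sub_zero]

lemma hasDerivAt_F (A u : ℝ) : HasDerivAt (S.F A) (S.F' A u) u :=
  ((S.hasDeriv u).const_mul A).const_add 1

lemma continuous_F (A : ℝ) : Continuous (S.F A) :=
  continuous_const.add (continuous_const.mul S.continuous_H)

@[simp] lemma F_zero (A : ℝ) : S.F A 0 = 1 := by simp [F, S.H_zero]
@[simp] lemma F_one (A : ℝ) : S.F A 1 = 1 := by simp [F, S.H_one]

lemma F_e_sub_one (A : ℝ) : S.F A (S.e - 1) = S.F A S.e := by simp [F, S.H_e_sub_one]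

variable {S} {A : ℝ}

lemma strictMonoOn_F_left (hA : 0 < A) : StrictMonoOn (S.F A) (Iic 0) := fun _ hx _ hy h =>
  by simpa [F, hA] using S.strictMonoOn_H_left hx hy h

lemma strictAntiOn_F (hA : 0 < A) : StrictAntiOn (S.F A) (Icc 0 S.e) := fun _ hx _ hy h =>
  by simpa [F, hA] using S.strictAntiOn_H hx hy h

lemma strictMonoOn_F_right (hA : 0 < A) : StrictMonoOn (S.F A) (Ici S.e) := fun _ hx _ hy h =>
  by simpa [F, hA] using S.strictMonoOn_H_right hx hy h

lemma strictMonoOn_F (hA : 0 < A) {s : Fin 3} (hs : s ≠ 1) : StrictMonoOn (S.F A) (S.cl s) := by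
  fin_cases s
  · exact strictMonoOn_F_left hA
  · exact absurd rfl hs
  · exact strictMonoOn_F_right hA

lemma injOn_F (hA : 0 < A) (s : Fin 3) : InjOn (S.F A) (S.cl s) := by
  by_cases hs : s = 1
  · subst hs; exact (strictAntiOn_F hA).injOn
  · exact (strictMonoOn_F hA hs).injOn

lemma F_le_one (hA : 0 < A) {u : ℝ} (hu : u ≤ 1) : S.F A u ≤ 1 := by
  rcases le_total u 0 with h | h
  · simpa using (strictMonoOn_F_left (S := S) hA).monotoneOn h (mem_Iic.2 le_rfl) h
  rcases le_total u S.e with h' | h'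
  · simpa using (strictAntiOn_F (S := S) hA).antitoneOn (left_mem_Icc.2 S.e_pos.le) ⟨h, h'⟩ h
  · simpa using (strictMonoOn_F_right (S := S) hA).monotoneOn h' (mem_Ici.2 S.e_lt.le) hu

lemma F_e_le (hA : 0 < A) {u : ℝ} (hu : S.e - 1 ≤ u) : S.F A S.e ≤ S.F A u := by
  rcases le_total u 0 with h | h
  · rw [← F_e_sub_one]
    exact (strictMonoOn_F_left (S := S) hA).monotoneOn (by simpa using S.e_lt.le) h hu
  rcases le_total u S.e with h' | h'
  · exact (strictAntiOn_F (S := S) hA).antitoneOn ⟨h, h'⟩ (right_mem_Icc.2 S.e_pos.le) h'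
  · exact (strictMonoOn_F_right (S := S) hA).monotoneOn (mem_Ici.2 le_rfl) h' h'

end Shape

/-! ### Realization of the kneading sequence -/

/-- A strictly increasing continuous function on `[a, b]` has a continuous monotone inverse,
extended by constants. -/
lemma exists_clamped_inverse {f : ℝ → ℝ} {a b : ℝ} (hab : a ≤ b) (hf : ContinuousOn f (Icc a b))
    (hm : StrictMonoOn f (Icc a b)) :
    ∃ g : ℝ → ℝ, Continuous g ∧ Monotone g ∧ (∀ y, g y ∈ Icc a b) ∧
      ∀ y, f (g y) = max (f a) (min y (f b)) := by
  set p : ℝ → ℝ := fun x => max a (min x b) with hp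
  have hpm : ∀ x, p x ∈ Icc a b := fun x => ⟨le_max_left _ _, max_le hab (min_le_right _ _)⟩
  have hpid : ∀ x ∈ Icc a b, p x = x := fun x hx => by simp [hp, hx.1, hx.2]
  -- Continuing `f` with slope one outside `[a, b]` gives an increasing bijection of the line; its
  -- inverse is then applied to clamped values.
  set q : ℝ → ℝ := fun x => f (p x) + (x - p x) with hq
  have hpc : Continuous p := by fun_prop
  have hqc : Continuous q :=
    (hf.comp_continuous hpc hpm).add (continuous_id.sub hpc)
  have hqm : StrictMono q := by
    intro x y hxy
    have h1 : p x ≤ p y := max_le_max le_rfl (min_le_min hxy.le le_rfl)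
    have h2 : p y - p x ≤ y - x := by
      simp only [hp]
      rcases max_cases a (min x b) with h | h <;> rcases max_cases a (min y b) with h' | h' <;>
      rcases min_cases x b with h3 | h3 <;> rcases min_cases y b with h4 | h4 <;> linarith
    rcases h1.eq_or_lt with h | h
    · simp only [hq, h]; linarith
    · have := hm (hpm x) (hpm y) h
      simp only [hq]; linarith
  have hqs : Function.Surjective q := by
    apply hqc.surjective
    · refine tendsto_atTop_mono' atTop (f₁ := fun x => f b + (x - b)) ?_ ?_
      · filter_upwards [eventually_ge_atTop b] with x hx
        have : p x = b := by simp [hp, hx, hab]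
        simp [hq, this]
      · exact tendsto_atTop_add_const_left _ _ (tendsto_atTop_add_const_right _ _ tendsto_id)
    · refine tendsto_atBot_mono' atBot (f₁ := fun x => f a + (x - a)) ?_ ?_
      · filter_upwards [eventually_le_atBot a] with x hx
        have : p x = a := by simp only [hp]; rw [min_eq_left (hx.trans hab), max_eq_left hx]
        simp [hq, this]
      · exact tendsto_atBot_add_const_left _ _ (tendsto_atBot_add_const_right _ _ tendsto_id)
  set o := hqm.orderIsoOfSurjective q hqs
  have hfab : f a ≤ f b := hm.monotoneOn (left_mem_Icc.2 hab) (right_mem_Icc.2 hab) hab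
  have hqa : q a = f a := by simp only [hq, hpid a (left_mem_Icc.2 hab)]; ring
  have hqb : q b = f b := by simp only [hq, hpid b (right_mem_Icc.2 hab)]; ring
  have ho : ∀ y, q (o.symm y) = y := fun y => o.apply_symm_apply y
  have hmem : ∀ y, o.symm (max (f a) (min y (f b))) ∈ Icc a b := fun y => by
    constructor
    · rw [← hqm.le_iff_le, ho, hqa]; exact le_max_left _ _
    · rw [← hqm.le_iff_le, ho, hqb]; exact max_le hfab (min_le_right _ _)
  refine ⟨fun y => o.symm (max (f a) (min y (f b))), ?_, ?_, hmem, ?_⟩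
  · exact o.symm.continuous.comp (by fun_prop)
  · intro x y hxy
    exact o.symm.monotone (max_le_max le_rfl (min_le_min hxy le_rfl))
  · intro y
    have := ho (max (f a) (min y (f b)))
    simp only [hq] at this
    rw [hpid _ (hmem y)] at this
    linarith

namespace Shape

variable (S : Shape)

/-- The laps cut off at `e - 1` and `1`; they all have the same image. -/
def lapT : Fin 3 → Set ℝ := ![Icc (S.e - 1) 0, Icc 0 S.e, Icc S.e 1]

lemma lapT_subset_cl (s : Fin 3) : S.lapT s ⊆ S.cl s := by
  fin_cases s
  · exact Icc_subset_Iic_self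
  · exact subset_rfl
  · exact Icc_subset_Ici_self

lemma lapT_subset_Icc (s : Fin 3) : S.lapT s ⊆ Icc (S.e - 1) 1 := by
  have := S.e_pos; have := S.e_lt
  fin_cases s <;> apply Icc_subset_Icc <;> linarith

/-- Clamping makes the inverse branches defined and continuous everywhere, so pullbacks depend
continuously on the parameter. That nothing was clamped is checked afterwards, at the chosen
parameter. -/
lemma exists_branch (s : Fin 3) : ∃ g : ℝ → ℝ, Continuous g ∧
    (s ≠ 1 → Monotone g) ∧ (s = 1 → Antitone g) ∧ (∀ y, g y ∈ S.lapT s) ∧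
      ∀ y, S.H (g y) = max (S.H S.e) (min y 0) := by
  have he := S.e_pos; have he' := S.e_lt
  fin_cases s
  · obtain ⟨g, h1, h2, h3, h4⟩ := exists_clamped_inverse (f := S.H) (a := S.e - 1) (b := 0)
      (by linarith) S.continuous_H.continuousOn (S.strictMonoOn_H_left.mono Icc_subset_Iic_self)
    refine ⟨g, h1, fun _ => h2, by simp, h3, fun y => ?_⟩
    rw [h4, S.H_e_sub_one, S.H_zero]
  · obtain ⟨g, h1, h2, h3, h4⟩ := exists_clamped_inverse (f := fun u => S.H (S.e - u)) (a := 0)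
      (b := S.e) (by linarith) (S.continuous_H.comp (by fun_prop)).continuousOn (by
        intro x hx y hy hxy
        exact S.strictAntiOn_H ⟨by linarith [hy.2], by linarith [hy.1]⟩
          ⟨by linarith [hx.2], by linarith [hx.1]⟩ (by linarith))
    refine ⟨fun y => S.e - g y, by fun_prop, by simp, fun _ x y hxy => ?_, fun y => ?_, fun y => ?_⟩
    · have := h2 hxy
      dsimp only; linarith
    · exact ⟨by linarith [(h3 y).2], by linarith [(h3 y).1]⟩
    · rw [h4]; simp [S.H_zero]
  · obtain ⟨g, h1, h2, h3, h4⟩ := exists_clamped_inverse (f := S.H) (a := S.e) (b := 1)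
      (by linarith) S.continuous_H.continuousOn (S.strictMonoOn_H_right.mono Icc_subset_Ici_self)
    refine ⟨g, h1, fun _ => h2, by simp, h3, fun y => ?_⟩
    rw [h4, S.H_one]

/-- The continuous extension of the inverse of `H` on a lap. -/
noncomputable def branch (s : Fin 3) : ℝ → ℝ := (S.exists_branch s).choose

lemma continuous_branch (s : Fin 3) : Continuous (S.branch s) := (S.exists_branch s).choose_spec.1
lemma monotone_branch {s : Fin 3} (hs : s ≠ 1) : Monotone (S.branch s) :=
  (S.exists_branch s).choose_spec.2.1 hs
lemma antitone_branch {s : Fin 3} (hs : s = 1) : Antitone (S.branch s) :=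
  (S.exists_branch s).choose_spec.2.2.1 hs
lemma branch_mem (s : Fin 3) (y : ℝ) : S.branch s y ∈ S.lapT s :=
  (S.exists_branch s).choose_spec.2.2.2.1 y
lemma H_branch (s : Fin 3) (y : ℝ) : S.H (S.branch s y) = max (S.H S.e) (min y 0) :=
  (S.exists_branch s).choose_spec.2.2.2.2 y

/-- The point obtained by pulling back `1` along the symbols `K j, …, K (j + r - 1)`. -/
noncomputable def pull (A : ℝ) : ℕ → ℕ → ℝ
  | _, 0 => 1
  | j, r + 1 => S.branch (K j) ((pull A (j + 1) r - 1) / A)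

lemma pull_mem (A : ℝ) (j r : ℕ) : S.pull A j (r + 1) ∈ S.lapT (K j) := S.branch_mem _ _

lemma pull_mem_cl (A : ℝ) {j r : ℕ} (hr : 0 < r) : S.pull A j r ∈ S.cl (K j) := by
  obtain ⟨r, rfl⟩ := Nat.exists_eq_succ_of_ne_zero hr.ne'
  exact S.lapT_subset_cl _ (S.pull_mem A j r)

lemma pull_mem_Icc (A : ℝ) (j r : ℕ) : S.pull A j r ∈ Icc (S.e - 1) 1 := by
  cases r with
  | zero => exact ⟨by have := S.e_lt; simp only [pull]; linarith, le_rfl⟩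
  | succ r => exact S.lapT_subset_Icc _ (S.pull_mem A j r)

lemma continuousOn_pull (j r : ℕ) : ContinuousOn (fun A => S.pull A j r) (Ioi 0) := by
  induction r generalizing j with
  | zero => exact continuousOn_const
  | succ r ih =>
    refine (S.continuous_branch (K j)).comp_continuousOn ?_
    exact ((ih (j + 1)).sub continuousOn_const).div continuousOn_id fun x hx => (ne_of_gt hx)

/-- Inverse branches preserve order except on the middle lap, so a comparison pulled back along
common symbols is reversed once for each `1`. -/
lemma pull_compare {A : ℝ} (hA : 0 < A) {d c r r' : ℕ} (hK : ∀ i < c, K (d + i) = K i)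
    (hr : c ≤ r) (hr' : c ≤ r')
    (h : if od c then S.pull A (d + c) (r - c) ≤ S.pull A c (r' - c)
      else S.pull A c (r' - c) ≤ S.pull A (d + c) (r - c)) :
    S.pull A 0 r' ≤ S.pull A d r := by
  induction c with
  | zero => simpa [od] using h
  | succ c ih =>
    refine ih (fun i hi => hK i (by omega)) (by omega) (by omega) ?_
    obtain ⟨a, ha⟩ : ∃ a, r - c = a + 1 := ⟨r - (c + 1), by omega⟩
    obtain ⟨b, hb⟩ : ∃ b, r' - c = b + 1 := ⟨r' - (c + 1), by omega⟩
    rw [show r - (c + 1) = a by omega, show r' - (c + 1) = b by omega, od_succ] at h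
    simp only [ha, hb, pull, hK c (by omega)]
    rw [← add_assoc] at h
    have key : ∀ x y : ℝ, x ≤ y → (x - 1) / A ≤ (y - 1) / A := fun x y hxy => by gcongr
    by_cases h1 : K c = 1
    · cases ho : od c <;> simp [ho, h1] at h <;> simp only [if_true, if_false, Bool.false_eq_true] <;>
        exact S.antitone_branch h1 (key _ _ h)
    · cases ho : od c <;> simp [ho, h1] at h <;> simp only [if_true, if_false, Bool.false_eq_true] <;>
        exact S.monotone_branch h1 (key _ _ h)

/-- The parameter `A` realizes the kneading sequence. -/
structure Kneads (A : ℝ) : Prop where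
  pos : 0 < A
  orbit : ∀ j, (S.F A)^[j] (S.F A S.e) ∈ S.op (K j)
  lt : S.e - 1 < S.F A S.e

/-- Over the parameter interval `v` falls from `0` to `e - 1`, while the pulled back point stays in
`[e - 1, 0]`, so the two meet. At such a parameter admissibility keeps all later pullbacks above
`v`, hence no clamping occurred and the pullbacks form the true orbit of `v`. The length `big k` is
taken because that word has no proper border: no comparison runs past its end. -/
lemma exists_finite_kneads (k : ℕ) : ∃ A ∈ Icc (1 / -S.H S.e) ((2 - S.e) / -S.H S.e),
    ∀ j < big k, (S.F A)^[j] (S.F A S.e) ∈ S.cl (K j) := by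
  set n := big k
  have hn : 0 < n := by have := five_le_len k; simp only [n, big_eq]; omega
  have hm : 0 < -S.H S.e := by linarith [S.H_e_neg]
  have he := S.e_lt
  have hpos : ∀ A ∈ Icc (1 / -S.H S.e) ((2 - S.e) / -S.H S.e), 0 < A := fun A hA =>
    lt_of_lt_of_le (by positivity) hA.1
  obtain ⟨A, hA, hz⟩ : ∃ A ∈ Icc (1 / -S.H S.e) ((2 - S.e) / -S.H S.e),
      S.pull A 0 n - S.F A S.e = 0 := by
    have hc : ContinuousOn (fun A => S.pull A 0 n - S.F A S.e)
        (Icc (1 / -S.H S.e) ((2 - S.e) / -S.H S.e)) := by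
      refine ((S.continuousOn_pull 0 n).mono fun A hA => hpos A hA).sub ?_
      unfold F; fun_prop
    have h1 : S.pull (1 / -S.H S.e) 0 n - S.F (1 / -S.H S.e) S.e ≤ 0 := by
      have := S.pull_mem_cl (1 / -S.H S.e) (j := 0) hn
      rw [K_zero, cl_zero, mem_Iic] at this
      have h2 : S.F (1 / -S.H S.e) S.e = 0 := by
        have := S.H_e_neg.ne
        unfold F; field_simp; ring
      rw [h2]; linarith
    have h2 : 0 ≤ S.pull ((2 - S.e) / -S.H S.e) 0 n - S.F ((2 - S.e) / -S.H S.e) S.e := by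
      have := (S.pull_mem_Icc ((2 - S.e) / -S.H S.e) 0 n).1
      have h2 : S.F ((2 - S.e) / -S.H S.e) S.e = S.e - 1 := by
        have := S.H_e_neg.ne
        unfold F; field_simp; ring
      rw [h2]; linarith
    obtain ⟨A, hA, h⟩ := intermediate_value_Icc (by gcongr; linarith) hc ⟨h1, h2⟩
    exact ⟨A, hA, h⟩
  refine ⟨A, hA, ?_⟩
  have hA0 := hpos A hA
  have hv : S.pull A 0 n = S.F A S.e := by linarith
  have hge : ∀ d, 1 ≤ d → d ≤ n → S.F A S.e ≤ S.pull A d (n - d) := by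
    intro d hd hdn
    rcases hdn.eq_or_lt with rfl | hlt
    · rw [← hv, Nat.sub_self]; exact (S.pull_mem_Icc A 0 _).2
    rw [← hv]
    obtain ⟨c, hc, hK, hD⟩ := big_unbordered hd hlt
    refine S.pull_compare hA0 hK (by omega) (by omega) ?_
    have m1 := S.pull_mem_cl A (j := c) (r := n - c) (by omega)
    have m2 := S.pull_mem_cl A (j := d + c) (r := n - d - c) (by omega)
    rcases hD with ⟨rfl, h⟩ | ⟨rfl, h, h'⟩ | ⟨h2, h3, h4, h5, h6⟩
    · simp only [od, Bool.false_eq_true, if_false]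
      exact S.le_of_mem_cl_of_lt m1 m2 (by rw [K_zero, add_zero]; exact Fin.pos_iff_ne_zero.2 h)
    · simp only [od, K_zero]
      exact S.le_of_mem_cl_of_lt m1 m2 (by rw [K_one, h']; decide)
    · rw [h5, if_pos rfl]
      exact S.le_of_mem_cl_of_lt m2 m1 (by rw [h3, h4]; decide)
  have horb : ∀ j ≤ n, (S.F A)^[j] (S.F A S.e) = S.pull A j (n - j) := by
    intro j
    induction j with
    | zero => intro _; simp [hv]
    | succ j ih =>
      intro hj
      rw [Function.iterate_succ_apply', ih (by omega)]
      obtain ⟨r, hr⟩ : ∃ r, n - j = r + 1 := ⟨n - (j + 1), by omega⟩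
      rw [hr, show n - (j + 1) = r by omega]
      have h1 := hge (j + 1) (by omega) hj
      rw [show n - (j + 1) = r by omega] at h1
      have h2 := (S.pull_mem_Icc A (j + 1) r).2
      simp only [pull, F, H_branch]
      rw [min_eq_left (div_nonpos_of_nonpos_of_nonneg (by linarith) hA0.le), max_eq_right]
      · field_simp; ring
      · rw [le_div_iff₀ hA0]; unfold F at h1; linarith
  intro j hj
  rw [horb j hj.le]
  exact S.pull_mem_cl A (by omega)

lemma continuous_iterate_param (j : ℕ) : Continuous fun A => (S.F A)^[j] (S.F A S.e) := by
  induction j with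
  | zero => simp only [Function.iterate_zero, id]; unfold F; fun_prop
  | succ j ih =>
    simp only [Function.iterate_succ_apply']
    unfold F at ih ⊢
    exact continuous_const.add (continuous_id.mul (S.continuous_H.comp ih))

lemma exists_K_ne_two (n : ℕ) : ∃ m ≥ n, K m ≠ 2 := by
  obtain ⟨m, -, h⟩ := exists_ne_two n
  exact ⟨n + m, by omega, h⟩

/-- Every family realizes the kneading sequence. -/
theorem exists_kneads : ∃ A, S.Kneads A := by
  have he := S.e_lt; have he0 := S.e_pos
  have hm : 0 < -S.H S.e := by linarith [S.H_e_neg]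
  choose a ha hK using S.exists_finite_kneads
  obtain ⟨A, hA, φ, hφ, hlim⟩ := isCompact_Icc.tendsto_subseq ha
  have hA0 : 0 < A := lt_of_lt_of_le (by positivity) hA.1
  have hcl : ∀ j, (S.F A)^[j] (S.F A S.e) ∈ S.cl (K j) := by
    intro j
    refine (S.isClosed_cl (K j)).mem_of_tendsto
      (((S.continuous_iterate_param j).tendsto A).comp hlim) ?_
    filter_upwards [eventually_ge_atTop (j + 1)] with i hi
    refine hK (φ i) j ?_
    have := hφ.id_le i; have := lt_len (φ i); have := big_eq (φ i)
    simp only [id] at *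
    omega
  set v := S.F A S.e with hv
  -- After a visit to `0` the orbit rests at `1`, and only the symbol `2` could follow.
  have hne0 : ∀ j, (S.F A)^[j] v ≠ 0 := by
    intro j h
    have h1 : ∀ i, (S.F A)^[i] ((S.F A)^[j + 1] v) = 1 := by
      intro i
      rw [Function.iterate_succ_apply', h, F_zero]
      exact Function.iterate_fixed (S.F_one A) i
    obtain ⟨m, hm, hKm⟩ := exists_K_ne_two (j + 1)
    have h2 := hcl m
    rw [show m = (m - (j + 1)) + (j + 1) by omega, Function.iterate_add_apply, h1] at h2
    rw [show (m - (j + 1)) + (j + 1) = m by omega] at h2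
    have : (1 : ℝ) ∈ S.op 2 := he
    exact hKm (S.eq_of_mem_op_of_mem_cl this h2).symm
  have hv0 : v < 0 := lt_of_le_of_ne (by simpa [K_zero] using hcl 0) (hne0 0)
  -- After a visit to `e` the orbit is periodic, so one point would lie in two closed laps, those of
  -- the first difference of `K` and its shift by the period.
  have hnee : ∀ j, (S.F A)^[j] v ≠ S.e := by
    intro j h
    have h1 : ∀ i, (S.F A)^[j + 1 + i] v = (S.F A)^[i] v := by
      intro i
      rw [add_comm, Function.iterate_add_apply, Function.iterate_succ_apply', h]
    obtain ⟨c, hc, hD⟩ := exists_differs (d := j + 1) (by omega)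
    have m1 := hcl c
    have m2 := hcl (j + 1 + c)
    rw [h1] at m2
    have hv1 : S.F A v ≠ S.e := by
      intro h2
      have h3 := hcl 2
      rw [K_init le_rfl (by norm_num), cl_two, mem_Ici] at h3
      simp only [Function.iterate_succ_apply, Function.iterate_zero, id, h2] at h3
      linarith
    rcases hD with ⟨rfl, h⟩ | ⟨rfl, h, h'⟩ | ⟨h2, h3, h4, h5, h6⟩
    · have : v ∈ S.op 0 := hv0
      exact h (S.eq_of_mem_op_of_mem_cl this m2).symm
    · rw [h', cl_two, mem_Ici] at m2
      rw [K_one, cl_one] at m1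
      exact hv1 (le_antisymm m1.2 m2)
    · rw [h3, cl_zero, mem_Iic] at m2
      rw [h4, cl_two, mem_Ici] at m1
      linarith
  refine ⟨A, hA0, fun j => S.mem_op_of_mem_cl (hcl j) (hne0 j) (hnee j), ?_⟩
  refine lt_of_le_of_ne ?_ ?_
  · have := hA.2
    rw [le_div_iff₀ hm] at this
    unfold F; linarith
  -- If `v = e - 1`, then `v` is a negative fixed point, against the second symbol `1`.
  · intro h
    have h1 := hcl 1
    rw [K_one] at h1
    simp only [Function.iterate_succ_apply, Function.iterate_zero, id] at h1
    have h2 : S.F A v = v := by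
      rw [← hv] at h
      rw [← h, F_e_sub_one, ← hv, ← h]
    rw [h2] at h1
    linarith [h1.1]

end Shape

end IntervalDynamics

namespace IntervalDynamics

/-! ### Expansion of cross-ratios -/

/-- A cross-ratio of four points. -/
noncomputable def crossRatio (a b c d : ℝ) : ℝ := (b - a) * (d - c) / ((d - a) * (c - b))

lemma crossRatio_reverse (a b c d : ℝ) : crossRatio d c b a = crossRatio a b c d := by
  unfold crossRatio
  rw [show (c - d) * (a - b) = (b - a) * (d - c) by ring,
    show (a - d) * (b - c) = (d - a) * (c - b) by ring]

lemma crossRatio_neg (a b c d : ℝ) : crossRatio (-a) (-b) (-c) (-d) = crossRatio a b c d := by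
  unfold crossRatio
  rw [show (-b - -a) * (-d - -c) = (b - a) * (d - c) by ring,
    show (-d - -a) * (-c - -b) = (d - a) * (c - b) by ring]

/-- The mixed second derivative of `log ((f y - f x) / (y - x))` is `f' x * f' y / (f y - f x) ^ 2 -
1 / (y - x) ^ 2`, which is nonpositive by hypothesis; it is integrated over `[a, b] × [c, d]`. -/
lemma crossRatio_le_of_two_point {f f' : ℝ → ℝ} {a b c d : ℝ} (hab : a < b) (hbc : b < c)
    (hcd : c < d) (hf : ∀ x, HasDerivAt f (f' x) x) (hm : StrictMonoOn f (Icc a d))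
    (h2 : ∀ x ∈ Icc a d, ∀ y ∈ Icc a d, x < y → f' x * f' y * (y - x) ^ 2 ≤ (f y - f x) ^ 2) :
    crossRatio (f a) (f b) (f c) (f d) ≤ crossRatio a b c d := by
  have hlt : ∀ x ∈ Icc a b, ∀ y ∈ Icc c d, 0 < y - x ∧ 0 < f y - f x := fun x hx y hy => by
    have : x < y := by linarith [hx.2, hy.1]
    exact ⟨by linarith, sub_pos.2 (hm ⟨hx.1, by linarith [hy.2]⟩ ⟨by linarith [hx.1], hy.2⟩ this)⟩
  have ma : a ∈ Icc a b := ⟨le_rfl, hab.le⟩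
  have mb : b ∈ Icc a b := ⟨hab.le, le_rfl⟩
  have mc : c ∈ Icc c d := ⟨le_rfl, hcd.le⟩
  have md : d ∈ Icc c d := ⟨hcd.le, le_rfl⟩
  have key : ∀ y ∈ Icc c d, f' y / (f y - f b) - 1 / (y - b) ≤ f' y / (f y - f a) - 1 / (y - a) := by
    intro y hy
    have hd : ∀ x ∈ Icc a b, HasDerivAt (fun x => f' y / (f y - f x) - 1 / (y - x))
        (f' y * f' x / (f y - f x) ^ 2 - 1 / (y - x) ^ 2) x := by
      intro x hx
      obtain ⟨p1, p2⟩ := hlt x hx y hy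
      have e1 : HasDerivAt (fun x => f y - f x) (-f' x) x := by
        simpa using (hf x).const_sub (f y)
      have e2 : HasDerivAt (fun x => y - x) (-1) x := by
        simpa using (hasDerivAt_id x).const_sub y
      have e3 := ((hasDerivAt_const x (f' y)).div e1 p2.ne').sub
        ((hasDerivAt_const x (1 : ℝ)).div e2 p1.ne')
      refine e3.congr_deriv ?_
      ring
    have : AntitoneOn (fun x => f' y / (f y - f x) - 1 / (y - x)) (Icc a b) := by
      refine antitoneOn_of_deriv_nonpos (convex_Icc a b)
        (fun x hx => (hd x hx).continuousAt.continuousWithinAt)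
        (fun x hx => (hd x (interior_subset hx)).differentiableAt.differentiableWithinAt) ?_
      intro x hx
      have hx := interior_subset hx
      obtain ⟨p1, p2⟩ := hlt x hx y hy
      rw [(hd x hx).deriv, sub_nonpos, div_le_div_iff₀ (by positivity) (by positivity)]
      have := h2 x ⟨hx.1, by linarith [hy.2]⟩ y ⟨by linarith [hx.1], hy.2⟩ (by linarith)
      linarith
    exact this ma mb hab.le
  have hd : ∀ x ∈ Icc a b, ∀ y ∈ Icc c d, HasDerivAt
      (fun y => Real.log (f y - f x) - Real.log (y - x))
      (f' y / (f y - f x) - 1 / (y - x)) y := by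
    intro x hx y hy
    obtain ⟨p1, p2⟩ := hlt x hx y hy
    have e1 : HasDerivAt (fun y => f y - f x) (f' y) y := (hf y).sub_const (f x)
    have e2 : HasDerivAt (fun y => y - x) 1 y := (hasDerivAt_id y).sub_const x
    exact (e1.log p2.ne').sub (e2.log p1.ne')
  have hant : AntitoneOn (fun y => (Real.log (f y - f b) - Real.log (y - b)) -
      (Real.log (f y - f a) - Real.log (y - a))) (Icc c d) := by
    have hd' := fun y hy => (hd b mb y hy).sub (hd a ma y hy)
    refine antitoneOn_of_deriv_nonpos (convex_Icc c d)
      (fun y hy => (hd' y hy).continuousAt.continuousWithinAt)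
      (fun y hy => (hd' y (interior_subset hy)).differentiableAt.differentiableWithinAt) ?_
    intro y hy
    have hy := interior_subset hy
    have e := (hd' y hy).deriv
    have e' : deriv (fun y => (Real.log (f y - f b) - Real.log (y - b)) -
      (Real.log (f y - f a) - Real.log (y - a))) y = _ := e
    rw [e']
    linarith [key y hy]
  have hfin := hant mc md hcd.le
  simp only at hfin
  obtain ⟨p1, p2⟩ := hlt a ma c mc
  obtain ⟨p3, p4⟩ := hlt b mb c mc
  obtain ⟨p5, p6⟩ := hlt a ma d md
  obtain ⟨p7, p8⟩ := hlt b mb d md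
  -- Since `(d - b) * (c - a) = (d - a) * (c - b) + (b - a) * (d - c)`, the quotients compared here
  -- are one plus the cross-ratios.
  have hprod : (f d - f b) * (d - a) * ((f c - f a) * (c - b)) ≤
      (d - b) * (f d - f a) * ((c - a) * (f c - f b)) := by
    rw [← Real.log_le_log_iff (by positivity) (by positivity)]
    simp only [Real.log_mul, p1.ne', p2.ne', p3.ne', p4.ne', p5.ne', p6.ne', p7.ne', p8.ne', ne_eq,
      not_false_eq_true, mul_eq_zero, or_self]
    linarith
  unfold crossRatio
  rw [div_le_div_iff₀ (by positivity) (by positivity)]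
  nlinarith [hprod]

namespace Shape

variable {S : Shape} {A : ℝ}

/-- An integrated form of negative Schwarzian derivative. When two points of a lap move towards each
other at equal speed, the product of the derivatives does not decrease. By the inequality of
arithmetic and geometric means the images then approach at speed at least `2 g`, where `g` is the
geometric mean at the start; the points meet at `σ = (y - x) / 2`. -/
lemma two_point (hA : 0 < A) {s : Fin 3} {x y : ℝ} (hx : x ∈ S.cl s) (hy : y ∈ S.cl s)
    (hxy : x < y) : S.F' A x * S.F' A y * (y - x) ^ 2 ≤ (S.F A y - S.F A x) ^ 2 := by
  have hxy0 : 0 ≤ x * y ∧ 0 ≤ (x - S.e) * (y - S.e) := by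
    have := S.e_pos
    fin_cases s <;> simp at hx hy
    · exact ⟨mul_nonneg_of_nonpos_of_nonpos hx hy,
        mul_nonneg_of_nonpos_of_nonpos (by linarith) (by linarith)⟩
    · exact ⟨mul_nonneg hx.1 hy.1,
        mul_nonneg_of_nonpos_of_nonpos (by linarith) (by linarith)⟩
    · exact ⟨mul_nonneg (by linarith) (by linarith), mul_nonneg (by linarith) (by linarith)⟩
  obtain ⟨ε, hε, hpos⟩ : ∃ ε : ℝ, ε ^ 2 = 1 ∧ ∀ u ∈ S.cl s, 0 ≤ ε * S.F' A u := by
    have := S.e_pos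
    fin_cases s
    · exact ⟨1, by norm_num, fun u hu => by
        rw [one_mul]
        exact mul_nonneg hA.le (pow_nonneg (mul_nonneg_of_nonpos_of_nonpos hu
          (by simp at hu; linarith)) _)⟩
    · refine ⟨-1, by norm_num, fun u hu => ?_⟩
      have := S.k_odd.pow_nonpos (mul_nonpos_of_nonneg_of_nonpos hu.1 (by linarith [hu.2] : u - S.e ≤ 0))
      have := mul_nonpos_of_nonneg_of_nonpos hA.le this
      unfold F'; linarith
    · exact ⟨1, by norm_num, fun u hu => by
        rw [one_mul]
        exact mul_nonneg hA.le (pow_nonneg (mul_nonneg (by simp at hu; linarith)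
          (by simp at hu; linarith)) _)⟩
  have hprod : ∀ σ, 0 ≤ σ → σ ≤ y - x →
      S.F' A x * S.F' A y ≤ S.F' A (x + σ) * S.F' A (y - σ) := by
    intro σ h0 h1
    unfold F'
    have hq : 0 ≤ σ * (y - x - σ) := mul_nonneg h0 (by linarith)
    have h3 : (x * (x - S.e)) * (y * (y - S.e)) ≤
        ((x + σ) * (x + σ - S.e)) * ((y - σ) * (y - σ - S.e)) := by
      have : (x * y) * ((x - S.e) * (y - S.e)) ≤
          (x * y + σ * (y - x - σ)) * ((x - S.e) * (y - S.e) + σ * (y - x - σ)) :=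
        mul_le_mul (by linarith) (by linarith) hxy0.2 (by linarith [hxy0.1])
      nlinarith [this]
    have h4 : 0 ≤ (x * (x - S.e)) * (y * (y - S.e)) := by
      have := mul_nonneg hxy0.1 hxy0.2
      nlinarith [this]
    have h5 := pow_le_pow_left₀ h4 h3 S.k
    rw [mul_pow (x * (x - S.e)), mul_pow ((x + σ) * (x + σ - S.e))] at h5
    have h6 := mul_le_mul_of_nonneg_left h5 (mul_nonneg hA.le hA.le)
    linarith
  have hg0 : 0 ≤ S.F' A x * S.F' A y := by
    have := mul_nonneg (hpos x hx) (hpos y hy)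
    nlinarith
  set g := √(S.F' A x * S.F' A y) with hg
  have hgg : g ^ 2 = S.F' A x * S.F' A y := Real.sq_sqrt hg0
  have hmono : MonotoneOn (fun σ => ε * S.F A (x + σ) - ε * S.F A (y - σ) - 2 * g * σ)
      (Icc 0 ((y - x) / 2)) := by
    have hd : ∀ σ, HasDerivAt (fun σ => ε * S.F A (x + σ) - ε * S.F A (y - σ) - 2 * g * σ)
        (ε * S.F' A (x + σ) + ε * S.F' A (y - σ) - 2 * g) σ := by
      intro σ
      have e1 : HasDerivAt (fun σ => x + σ) 1 σ := by simpa using (hasDerivAt_id σ).const_add x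
      have e2 : HasDerivAt (fun σ => y - σ) (-1) σ := by simpa using (hasDerivAt_id σ).const_sub y
      have e3 := ((S.hasDerivAt_F A (x + σ)).comp σ e1).const_mul ε
      have e4 := ((S.hasDerivAt_F A (y - σ)).comp σ e2).const_mul ε
      have e5 := (hasDerivAt_id σ).const_mul (2 * g)
      refine ((e3.sub e4).sub e5).congr_deriv ?_
      ring
    refine monotoneOn_of_deriv_nonneg (convex_Icc _ _)
      (fun σ _ => (hd σ).continuousAt.continuousWithinAt)
      (fun σ _ => (hd σ).differentiableAt.differentiableWithinAt) ?_
    intro σ hσ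
    rw [interior_Icc] at hσ
    rw [(hd σ).deriv]
    have m1 : x + σ ∈ S.cl s := (S.ordConnected_cl s).out hx hy ⟨by linarith [hσ.1], by linarith [hσ.2, hσ.1]⟩
    have m2 : y - σ ∈ S.cl s := (S.ordConnected_cl s).out hx hy ⟨by linarith [hσ.1, hσ.2], by linarith [hσ.1]⟩
    have q1 := hpos _ m1
    have q2 := hpos _ m2
    have q3 := hprod σ hσ.1.le (by linarith [hσ.2, hσ.1])
    rw [← hgg] at q3
    set p := ε * S.F' A (x + σ)
    set q := ε * S.F' A (y - σ)
    have q4 : g ^ 2 ≤ p * q := by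
      calc g ^ 2 ≤ S.F' A (x + σ) * S.F' A (y - σ) := q3
        _ = ε ^ 2 * (S.F' A (x + σ) * S.F' A (y - σ)) := by rw [hε, one_mul]
        _ = p * q := by simp only [p, q]; ring
    have : 2 * g ≤ p + q := by
      refine (sq_le_sq₀ (mul_nonneg two_pos.le (Real.sqrt_nonneg _)) (by positivity)).1 ?_
      nlinarith [sq_nonneg (p - q)]
    linarith
  have h := hmono (left_mem_Icc.2 (by linarith)) (right_mem_Icc.2 (by linarith)) (by linarith)
  simp only [add_zero, sub_zero, mul_zero] at h
  rw [show x + (y - x) / 2 = y - (y - x) / 2 by ring, sub_self] at h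
  have h1 : g * (y - x) ≤ ε * (S.F A y - S.F A x) := by linarith
  have h2 : 0 ≤ g * (y - x) := mul_nonneg (Real.sqrt_nonneg _) (by linarith)
  calc S.F' A x * S.F' A y * (y - x) ^ 2 = (g * (y - x)) ^ 2 := by rw [mul_pow, hgg]
    _ ≤ (ε * (S.F A y - S.F A x)) ^ 2 := pow_le_pow_left₀ h2 h1 2
    _ = _ := by rw [mul_pow, hε, one_mul]

lemma crossRatio_F_le (hA : 0 < A) {s : Fin 3} {a b c d : ℝ} (ha : a ∈ S.cl s) (hd : d ∈ S.cl s)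
    (hab : a < b) (hbc : b < c) (hcd : c < d) :
    crossRatio (S.F A a) (S.F A b) (S.F A c) (S.F A d) ≤ crossRatio a b c d := by
  have hsub : Icc a d ⊆ S.cl s := fun x hx => (S.ordConnected_cl s).out ha hd hx
  by_cases hs : s = 1
  · subst hs
    have := crossRatio_le_of_two_point (f := fun x => -S.F A x) (f' := fun x => -S.F' A x) hab hbc hcd
      (fun x => (S.hasDerivAt_F A x).neg)
      (fun x hx y hy h => neg_lt_neg (strictAntiOn_F hA (hsub hx) (hsub hy) h))
      (fun x hx y hy h => by
        have := two_point hA (hsub hx) (hsub hy) h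
        calc -S.F' A x * -S.F' A y * (y - x) ^ 2 = S.F' A x * S.F' A y * (y - x) ^ 2 := by ring
          _ ≤ _ := this
          _ = _ := by ring)
    rwa [crossRatio_neg] at this
  · exact crossRatio_le_of_two_point hab hbc hcd (S.hasDerivAt_F A)
      ((strictMonoOn_F hA hs).mono hsub)
      (fun x hx y hy h => two_point hA (hsub hx) (hsub hy) h)

lemma crossRatio_F_le' (hA : 0 < A) {s : Fin 3} {a b c d : ℝ} (ha : a ∈ S.cl s) (hd : d ∈ S.cl s)
    (h : (a < b ∧ b < c ∧ c < d) ∨ (d < c ∧ c < b ∧ b < a)) :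
    crossRatio (S.F A a) (S.F A b) (S.F A c) (S.F A d) ≤ crossRatio a b c d := by
  rcases h with ⟨h1, h2, h3⟩ | ⟨h1, h2, h3⟩
  · exact crossRatio_F_le hA ha hd h1 h2 h3
  · rw [← crossRatio_reverse (S.F A a), ← crossRatio_reverse a]
    exact crossRatio_F_le hA hd ha h1 h2 h3

/-! ### Laps and iterates -/

lemma iterate_lap_aux (hA : 0 < A) {s : ℕ → Fin 3} {n : ℕ} {p q : ℝ} (hpq : p ≤ q)
    (hp : ∀ i < n, (S.F A)^[i] p ∈ S.cl (s i)) (hq : ∀ i < n, (S.F A)^[i] q ∈ S.cl (s i)) :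
    (∀ i < n, ∀ u ∈ Icc p q, (S.F A)^[i] u ∈ S.cl (s i)) ∧
      (StrictMonoOn ((S.F A)^[n]) (Icc p q) ∨ StrictAntiOn ((S.F A)^[n]) (Icc p q)) := by
  induction n with
  | zero => exact ⟨by simp, Or.inl (fun x _ y _ h => by simpa using h)⟩
  | succ n ih =>
    obtain ⟨h1, h2⟩ := ih (fun i hi => hp i (by omega)) (fun i hi => hq i (by omega))
    have mp := left_mem_Icc.2 hpq
    have mq := right_mem_Icc.2 hpq
    have h3 : ∀ u ∈ Icc p q, (S.F A)^[n] u ∈ S.cl (s n) := by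
      intro u hu
      rcases h2 with h2 | h2
      · exact (S.ordConnected_cl _).out (hp n (by omega)) (hq n (by omega))
          ⟨h2.monotoneOn mp hu hu.1, h2.monotoneOn hu mq hu.2⟩
      · exact (S.ordConnected_cl _).out (hq n (by omega)) (hp n (by omega))
          ⟨h2.antitoneOn hu mq hu.2, h2.antitoneOn mp hu hu.1⟩
    refine ⟨fun i hi u hu => ?_, ?_⟩
    · rcases Nat.lt_succ_iff_lt_or_eq.1 hi with h | rfl
      · exact h1 i h u hu
      · exact h3 u hu
    · rw [Function.iterate_succ']
      by_cases hs : s n = 1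
      · rw [hs] at h3
        rcases h2 with h2 | h2
        · exact Or.inr fun x hx y hy h => strictAntiOn_F hA (h3 x hx) (h3 y hy) (h2 hx hy h)
        · exact Or.inl fun x hx y hy h => strictAntiOn_F hA (h3 y hy) (h3 x hx) (h2 hx hy h)
      · have hm := strictMonoOn_F (S := S) hA hs
        rcases h2 with h2 | h2
        · exact Or.inl fun x hx y hy h => hm (h3 x hx) (h3 y hy) (h2 hx hy h)
        · exact Or.inr fun x hx y hy h => hm (h3 y hy) (h3 x hx) (h2 hx hy h)

lemma iterate_lap (hA : 0 < A) {s : ℕ → Fin 3} {n : ℕ} {p q : ℝ}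
    (hp : ∀ i < n, (S.F A)^[i] p ∈ S.cl (s i)) (hq : ∀ i < n, (S.F A)^[i] q ∈ S.cl (s i)) :
    (∀ i < n, ∀ u ∈ uIcc p q, (S.F A)^[i] u ∈ S.cl (s i)) := by
  rcases le_total p q with h | h
  · rw [uIcc_of_le h]; exact (iterate_lap_aux hA h hp hq).1
  · rw [uIcc_of_ge h]; exact (iterate_lap_aux hA h hq hp).1

lemma iterate_injective (hA : 0 < A) {s : ℕ → Fin 3} {n : ℕ} {p q : ℝ}
    (hp : ∀ i < n, (S.F A)^[i] p ∈ S.cl (s i)) (hq : ∀ i < n, (S.F A)^[i] q ∈ S.cl (s i))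
    (h : (S.F A)^[n] p = (S.F A)^[n] q) : p = q := by
  induction n with
  | zero => simpa using h
  | succ n ih =>
    refine ih (fun i hi => hp i (by omega)) (fun i hi => hq i (by omega)) ?_
    rw [Function.iterate_succ_apply', Function.iterate_succ_apply'] at h
    exact injOn_F hA (s n) (hp n (by omega)) (hq n (by omega)) h

lemma crossRatio_iterate_le (hA : 0 < A) {s : ℕ → Fin 3} {n : ℕ} {a b c d : ℝ}
    (ha : ∀ i < n, (S.F A)^[i] a ∈ S.cl (s i)) (hd : ∀ i < n, (S.F A)^[i] d ∈ S.cl (s i))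
    (hab : a < b) (hbc : b < c) (hcd : c < d) :
    crossRatio ((S.F A)^[n] a) ((S.F A)^[n] b) ((S.F A)^[n] c) ((S.F A)^[n] d) ≤
      crossRatio a b c d := by
  induction n with
  | zero => exact le_rfl
  | succ n ih =>
    refine le_trans ?_ (ih (fun i hi => ha i (by omega)) (fun i hi => hd i (by omega)))
    simp only [Function.iterate_succ_apply']
    refine crossRatio_F_le' hA (ha n (by omega)) (hd n (by omega)) ?_
    have ma : a ∈ Icc a d := ⟨le_rfl, by linarith⟩
    have mb : b ∈ Icc a d := ⟨by linarith, by linarith⟩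
    have mc : c ∈ Icc a d := ⟨by linarith, by linarith⟩
    have md : d ∈ Icc a d := ⟨by linarith, le_rfl⟩
    rcases (iterate_lap_aux (n := n) hA (by linarith : a ≤ d) (fun i hi => ha i (by omega))
      (fun i hi => hd i (by omega))).2 with h | h
    · exact Or.inl ⟨h ma mb hab, h mb mc hbc, h mc md hcd⟩
    · exact Or.inr ⟨h mc md hcd, h mb mc hbc, h ma mb hab⟩

/-- If the images of `a` and `d` keep a distance from the images of `b` and `c`, then `a` keeps a
distance from `b`. -/
lemma length_bound (hA : 0 < A) {s : ℕ → Fin 3} {n : ℕ} {a b c d δ D : ℝ}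
    (ha : ∀ i < n, (S.F A)^[i] a ∈ S.cl (s i)) (hd : ∀ i < n, (S.F A)^[i] d ∈ S.cl (s i))
    (hab : a ≤ b) (hbc : b < c) (hcd : c ≤ d) (hδ : 0 < δ)
    (hL : δ ≤ |(S.F A)^[n] b - (S.F A)^[n] a|) (hR : δ ≤ |(S.F A)^[n] d - (S.F A)^[n] c|)
    (hT : |(S.F A)^[n] d - (S.F A)^[n] a| ≤ D) (hJ : |(S.F A)^[n] c - (S.F A)^[n] b| ≤ D) :
    (c - b) * δ ^ 2 ≤ (b - a) * D ^ 2 := by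
  have hab' : a < b := lt_of_le_of_ne hab fun h => by simp [h] at hL; linarith
  have hcd' : c < d := lt_of_le_of_ne hcd fun h => by simp [h] at hR; linarith
  have h := crossRatio_iterate_le hA ha hd hab' hbc hcd'
  have ma : a ∈ Icc a d := ⟨le_rfl, by linarith⟩
  have mb : b ∈ Icc a d := ⟨by linarith, by linarith⟩
  have mc : c ∈ Icc a d := ⟨by linarith, by linarith⟩
  have md : d ∈ Icc a d := ⟨by linarith, le_rfl⟩
  have habs : crossRatio ((S.F A)^[n] a) ((S.F A)^[n] b) ((S.F A)^[n] c) ((S.F A)^[n] d) =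
      |(S.F A)^[n] b - (S.F A)^[n] a| * |(S.F A)^[n] d - (S.F A)^[n] c| /
        (|(S.F A)^[n] d - (S.F A)^[n] a| * |(S.F A)^[n] c - (S.F A)^[n] b|) := by
    unfold crossRatio
    rcases (iterate_lap_aux hA (by linarith : a ≤ d) ha hd).2 with h | h
    · rw [abs_of_pos (sub_pos.2 (h ma mb hab')), abs_of_pos (sub_pos.2 (h mc md hcd')),
        abs_of_pos (sub_pos.2 (h ma md (by linarith))), abs_of_pos (sub_pos.2 (h mb mc hbc))]
    · rw [abs_of_neg (sub_neg.2 (h ma mb hab')), abs_of_neg (sub_neg.2 (h mc md hcd')),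
        abs_of_neg (sub_neg.2 (h ma md (by linarith))), abs_of_neg (sub_neg.2 (h mb mc hbc)),
        neg_mul_neg, neg_mul_neg]
  have hinj : ∀ x ∈ Icc a d, ∀ y ∈ Icc a d, x < y → 0 < |(S.F A)^[n] y - (S.F A)^[n] x| := by
    intro x hx y hy hxy
    rw [abs_pos, sub_ne_zero]
    rcases (iterate_lap_aux hA (by linarith : a ≤ d) ha hd).2 with h | h
    · exact (h hx hy hxy).ne'
    · exact (h hx hy hxy).ne
  rw [habs] at h
  have p1 := hinj a ma d md (by linarith)
  have p2 := hinj b mb c mc hbc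
  have hD : 0 < D := lt_of_lt_of_le p1 hT
  have h1 : δ ^ 2 / D ^ 2 ≤ crossRatio a b c d := by
    refine le_trans ?_ h
    rw [sq, sq]
    gcongr
  unfold crossRatio at h1
  rw [div_le_div_iff₀ (by positivity) (mul_pos (by linarith) (by linarith))] at h1
  have h2 : δ ^ 2 * ((d - a) * (c - b)) ≤ (b - a) * (d - a) * D ^ 2 :=
    h1.trans (by gcongr; nlinarith)
  have h3 : 0 < d - a := by linarith
  nlinarith [h2]

end Shape
end IntervalDynamics

namespace IntervalDynamics
namespace Shape

variable {S : Shape} {A t : ℝ}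

/-! ### The invariant interval -/

/-- The orbit of the critical value `F e`. -/
noncomputable def orb (S : Shape) (A : ℝ) (j : ℕ) : ℝ := (S.F A)^[j] (S.F A S.e)

lemma orb_zero : S.orb A 0 = S.F A S.e := rfl

lemma orb_succ (j : ℕ) : S.orb A (j + 1) = S.F A (S.orb A j) :=
  Function.iterate_succ_apply' _ _ _

lemma iterate_orb (i j : ℕ) : (S.F A)^[i] (S.orb A j) = S.orb A (i + j) :=
  (Function.iterate_add_apply _ _ _ _).symm

/-- The parameter `A` realizes the kneading sequence, and `t` is the fixed point left of the
critical value. -/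
structure Core (S : Shape) (A t : ℝ) : Prop extends S.Kneads A where
  fixed : S.F A t = t
  lt_v : t < S.F A S.e

lemma Kneads.orb_mem (h : S.Kneads A) (j : ℕ) : S.orb A j ∈ S.op (K j) := h.orbit j

lemma Kneads.v_neg (h : S.Kneads A) : S.F A S.e < 0 := by
  simpa [K_zero] using h.orbit 0

lemma Kneads.mapsTo_v (h : S.Kneads A) : MapsTo (S.F A) (Icc (S.F A S.e) 1) (Icc (S.F A S.e) 1) :=
  fun _ hu => ⟨F_e_le h.pos (h.lt.le.trans hu.1), F_le_one h.pos hu.2⟩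

lemma Kneads.v_mem (h : S.Kneads A) : S.F A S.e ∈ Icc (S.F A S.e) 1 :=
  ⟨le_rfl, by linarith [h.v_neg]⟩

lemma Kneads.orb_mem_Icc (h : S.Kneads A) (j : ℕ) : S.orb A j ∈ Icc (S.F A S.e) 1 :=
  h.mapsTo_v.iterate j h.v_mem

lemma Core.mapsTo (h : S.Core A t) : MapsTo (S.F A) (Icc t 1) (Icc t 1) := by
  intro u hu
  refine ⟨?_, F_le_one h.pos hu.2⟩
  rcases le_total u 0 with h0 | h0
  · have := (strictMonoOn_F_left (S := S) h.pos).monotoneOn (hu.1.trans h0) h0 hu.1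
    rwa [h.fixed] at this
  · exact h.lt_v.le.trans (F_e_le h.pos (by linarith [S.e_lt]))

lemma Core.subset (h : S.Core A t) : Icc (S.F A S.e) 1 ⊆ Icc t 1 := Icc_subset_Icc_left h.lt_v.le

lemma Core.t_neg (h : S.Core A t) : t < 0 := h.lt_v.trans h.v_neg

/-! ### Expansion near the fixed points `1` and `t` -/

lemma F'_le_of_mem (hA : 0 < A) {u : ℝ} (h0 : S.e ≤ u) (h1 : u ≤ 1) : S.F' A u ≤ S.F' A 1 := by
  have := S.e_pos
  refine mul_le_mul_of_nonneg_left (pow_le_pow_left₀ (mul_nonneg (by linarith) (by linarith)) ?_ _) hA.le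
  nlinarith

lemma Kneads.one_lt_F' (h : S.Kneads A) : 1 < S.F' A 1 := by
  have he := S.e_pos; have he1 := S.e_lt
  obtain ⟨c, hc, hs⟩ := exists_hasDerivAt_eq_slope (S.F A) (S.F' A) he1
    (S.continuous_F A).continuousOn fun x _ => S.hasDerivAt_F A x
  have := F'_le_of_mem h.pos hc.1.le hc.2.le
  rw [hs, F_one, div_le_iff₀ (by linarith)] at this
  have := h.v_neg
  nlinarith

lemma F'_e_sub_one : S.F' A (S.e - 1) = S.F' A 1 := by
  unfold F'
  rw [show (S.e - 1) * (S.e - 1 - S.e) = 1 * (1 - S.e) by ring]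

/-- At `e - 1` the graph lies above the diagonal, and to the left its slope is at least `F' 1 > 1`.
The number `x` is the distance at which the line of that slope through `(e - 1, v)` reaches the
diagonal, so the graph has crossed it by then. -/
lemma Kneads.exists_core (h : S.Kneads A) : ∃ t, S.Core A t := by
  have he := S.e_pos; have he1 := S.e_lt
  have hl := h.one_lt_F'
  set l := S.F' A 1
  set x := (S.F A S.e - (S.e - 1)) / (l - 1) with hx
  have hx0 : 0 < x := div_pos (by linarith [h.lt]) (by linarith)
  have hxe : (l - 1) * x = S.F A S.e - (S.e - 1) := by
    have : l - 1 ≠ 0 := by linarith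
    rw [hx]; field_simp
  obtain ⟨c, hc, hs⟩ := exists_hasDerivAt_eq_slope (S.F A) (S.F' A)
    (by linarith : S.e - 1 - x < S.e - 1)
    (S.continuous_F A).continuousOn fun x _ => S.hasDerivAt_F A x
  have hc1 : l ≤ S.F' A c := by
    simp only [l]
    rw [← F'_e_sub_one]
    refine mul_le_mul_of_nonneg_left (pow_le_pow_left₀ ?_ ?_ _) h.pos.le
    · nlinarith
    · have := hc.2; nlinarith
  rw [hs, F_e_sub_one, le_div_iff₀ (by linarith)] at hc1
  have hle : S.F A (S.e - 1 - x) - (S.e - 1 - x) ≤ 0 := by nlinarith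
  have hge : 0 ≤ S.F A (S.e - 1) - (S.e - 1) := by rw [F_e_sub_one]; linarith [h.lt]
  obtain ⟨t, ht, hz⟩ := intermediate_value_Icc (by linarith : S.e - 1 - x ≤ S.e - 1)
    (((S.continuous_F A).sub continuous_id).continuousOn (s := Icc (S.e - 1 - x) (S.e - 1)))
    ⟨hle, hge⟩
  simp only [Pi.sub_apply, id] at hz
  exact ⟨t, h, by linarith, lt_of_le_of_lt ht.2 h.lt⟩

lemma convexOn_F (hA : 0 < A) : ConvexOn ℝ (Ici S.e) (S.F A) := by
  have he := S.e_pos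
  refine MonotoneOn.convexOn_of_deriv (convex_Ici _) (S.continuous_F A).continuousOn
    (fun x _ => (S.hasDerivAt_F A x).differentiableAt.differentiableWithinAt) ?_
  intro x hx y hy hxy
  rw [interior_Ici, mem_Ioi] at hx hy
  rw [(S.hasDerivAt_F A x).deriv, (S.hasDerivAt_F A y).deriv]
  refine mul_le_mul_of_nonneg_left (pow_le_pow_left₀ (mul_nonneg (by linarith) (by linarith)) ?_ _) hA.le
  nlinarith

lemma concaveOn_F (hA : 0 < A) : ConcaveOn ℝ (Iic 0) (S.F A) := by
  have he := S.e_pos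
  refine AntitoneOn.concaveOn_of_deriv (convex_Iic _) (S.continuous_F A).continuousOn
    (fun x _ => (S.hasDerivAt_F A x).differentiableAt.differentiableWithinAt) ?_
  intro x hx y hy hxy
  rw [interior_Iic, mem_Iio] at hx hy
  rw [(S.hasDerivAt_F A x).deriv, (S.hasDerivAt_F A y).deriv]
  refine mul_le_mul_of_nonneg_left (pow_le_pow_left₀
    (mul_nonneg_of_nonpos_of_nonpos (by linarith) (by linarith)) ?_ _) hA.le
  nlinarith

lemma Kneads.expand_right (h : S.Kneads A) {u : ℝ} (h0 : S.e ≤ u) (h1 : u ≤ 1) :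
    (1 - S.F A S.e) / (1 - S.e) * (1 - u) ≤ 1 - S.F A u := by
  have he1 := S.e_lt
  have h1e : 0 < 1 - S.e := by linarith
  have := (convexOn_F (S := S) h.pos).2 (mem_Ici.2 le_rfl) (mem_Ici.2 he1.le)
    (div_nonneg (by linarith) h1e.le : 0 ≤ (1 - u) / (1 - S.e))
    (div_nonneg (by linarith) h1e.le : 0 ≤ (u - S.e) / (1 - S.e)) (by field_simp; ring)
  simp only [smul_eq_mul, F_one] at this
  rw [show (1 - u) / (1 - S.e) * S.e + (u - S.e) / (1 - S.e) * 1 = u by field_simp; ring] at this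
  have e : (1 - S.F A S.e) / (1 - S.e) * (1 - u) = (1 - u) / (1 - S.e) + (u - S.e) / (1 - S.e)
      - (1 - u) / (1 - S.e) * S.F A S.e - (u - S.e) / (1 - S.e) := by ring
  have e2 : (1 - u) / (1 - S.e) + (u - S.e) / (1 - S.e) = 1 := by field_simp; ring
  linarith

lemma Core.expand_left (h : S.Core A t) {u : ℝ} (h0 : t ≤ u) (h1 : u ≤ 0) :
    (1 - t) / (-t) * (u - t) ≤ S.F A u - t := by
  have ht := h.t_neg
  have ht0 := ht.ne
  have := (concaveOn_F (S := S) h.pos).2 (mem_Iic.2 ht.le) (mem_Iic.2 le_rfl)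
    (div_nonneg (by linarith) (by linarith) : 0 ≤ (-u) / (-t))
    (div_nonneg (by linarith) (by linarith) : 0 ≤ (u - t) / (-t)) (by field_simp; ring)
  simp only [smul_eq_mul, F_zero, h.fixed] at this
  rw [show (-u) / (-t) * t + (u - t) / (-t) * 0 = u by field_simp; ring] at this
  have e : (1 - t) / (-t) * (u - t) = (-u) / (-t) * t + (u - t) / (-t) * 1 - t := by
    field_simp; ring
  linarith

/-- By convexity the distance to `1` grows at least by the chord slope `(1 - v) / (1 - e) > 1` as
long as the orbit is in the right lap. -/
lemma Kneads.eq_one_of_right (h : S.Kneads A) {x : ℝ} (hx1 : x ≤ 1)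
    (hx : ∀ n, (S.F A)^[n] x ∈ S.cl 2) : x = 1 := by
  by_contra hne
  have hlt : 0 < 1 - x := by have := lt_of_le_of_ne hx1 hne; linarith
  have he := S.e_pos; have he1 := S.e_lt
  set σ := (1 - S.F A S.e) / (1 - S.e)
  have hσ : 1 < σ := by
    rw [lt_div_iff₀ (by linarith)]; linarith [h.v_neg]
  have hle : ∀ n, (S.F A)^[n] x ≤ 1 := by
    intro n
    induction n with
    | zero => exact hx1
    | succ n ih => rw [Function.iterate_succ_apply']; exact F_le_one h.pos ih
  have hgrow : ∀ n, σ ^ n * (1 - x) ≤ 1 - (S.F A)^[n] x := by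
    intro n
    induction n with
    | zero => simp
    | succ n ih =>
      rw [Function.iterate_succ_apply', pow_succ]
      have := h.expand_right (hx n) (hle n)
      nlinarith
  obtain ⟨n, hn⟩ := pow_unbounded_of_one_lt ((1 - S.e) / (1 - x)) hσ
  rw [div_lt_iff₀ hlt] at hn
  have h1 := hgrow n
  have h2 : S.e ≤ (S.F A)^[n] x := hx n
  linarith

lemma Core.eq_of_left (h : S.Core A t) {x : ℝ} (hx1 : t ≤ x)
    (hx : ∀ n, (S.F A)^[n] x ∈ S.cl 0) : x = t := by
  by_contra hne
  have hlt : 0 < x - t := by have := lt_of_le_of_ne hx1 (Ne.symm hne); linarith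
  have ht := h.t_neg
  set σ := (1 - t) / (-t)
  have hσ : 1 < σ := by
    rw [lt_div_iff₀ (by linarith)]; linarith
  have hx0 : x ≤ 1 := by have := hx 0; simp at this; linarith
  have hle : ∀ n, t ≤ (S.F A)^[n] x := fun n => (h.mapsTo.iterate n ⟨hx1, hx0⟩).1
  have hgrow : ∀ n, σ ^ n * (x - t) ≤ (S.F A)^[n] x - t := by
    intro n
    induction n with
    | zero => simp
    | succ n ih =>
      rw [Function.iterate_succ_apply', pow_succ]
      have h1 : σ * ((S.F A)^[n] x - t) ≤ S.F A ((S.F A)^[n] x) - t := h.expand_left (hle n) (hx n)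
      have h2 : σ * (σ ^ n * (x - t)) ≤ σ * ((S.F A)^[n] x - t) := by gcongr
      linarith
  obtain ⟨n, hn⟩ := pow_unbounded_of_one_lt ((-t) / (x - t)) hσ
  rw [div_lt_iff₀ hlt] at hn
  have h1 := hgrow n
  have h2 : (S.F A)^[n] x ≤ 0 := hx n
  linarith

lemma exists_lipschitz (S : Shape) (A t : ℝ) :
    ∃ L : ℝ, 1 ≤ L ∧ ∀ u ∈ Icc t 1, ∀ w ∈ Icc t 1, |S.F A u - S.F A w| ≤ L * |u - w| := by
  have hc : ContinuousOn (S.F' A) (Icc t 1) := by unfold F'; fun_prop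
  obtain ⟨C, hC⟩ := isCompact_Icc.exists_bound_of_continuousOn hc
  refine ⟨max 1 C, le_max_left _ _, fun u hu w hw => ?_⟩
  have := Convex.norm_image_sub_le_of_norm_hasDerivWithin_le (f := S.F A) (f' := S.F' A)
    (C := max 1 C) (fun x _ => (S.hasDerivAt_F A x).hasDerivWithinAt)
    (fun x hx => (hC x hx).trans (le_max_right _ _)) (convex_Icc t 1) hw hu
  simpa [Real.norm_eq_abs] using this

/-! ### Comparison with the critical orbit -/

/-- Initially the critical value is the lower point, and each common symbol `1` reverses the order.
-/
lemma Kneads.order (h : S.Kneads A) {w : ℝ} (hw : S.F A S.e ≤ w) {r : ℕ}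
    (hK : ∀ j < r, (S.F A)^[j] w ∈ S.cl (K j)) :
    if od r then (S.F A)^[r] w ≤ S.orb A r else S.orb A r ≤ (S.F A)^[r] w := by
  induction r with
  | zero => simpa [od, orb_zero] using hw
  | succ r ih =>
    have ih := ih fun j hj => hK j (by omega)
    have m1 := hK r (by omega)
    have m2 := S.op_subset_cl _ (h.orb_mem r)
    rw [od_succ, orb_succ, Function.iterate_succ_apply']
    by_cases h1 : K r = 1
    · rw [h1] at m1 m2
      have := (strictAntiOn_F (S := S) h.pos).antitoneOn
      cases ho : od r <;> simp [ho, h1] at ih ⊢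
      · exact this m2 m1 ih
      · exact this m1 m2 ih
    · have := (strictMonoOn_F (S := S) h.pos h1).monotoneOn
      cases ho : od r <;> simp [ho, h1] at ih ⊢
      · exact this m2 m1 ih
      · exact this m1 m2 ih

/-- Points of different laps can be close only across a turning point. The parity fixes the side on
which `w` lies, and `Rules` then keeps the critical orbit away from the turning point on that side.
For instance `0` at even parity is followed by `1`, so the next point is below `e`, far from `1 = F
0`, and the present one is far from `0`. -/
lemma Core.exists_gap (h : S.Core A t) : ∃ c > 0, ∀ (i : ℕ) (s : Fin 3) (w : ℝ), w ∈ S.cl s →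
    s ≠ K i → (if od i then w ≤ S.orb A i else S.orb A i ≤ w) → c ≤ |w - S.orb A i| := by
  obtain ⟨L, hL1, hL⟩ := exists_lipschitz S A t
  have he := S.e_pos; have he1 := S.e_lt
  have hv := h.v_neg
  have hm : ∀ i, S.orb A i ∈ Icc t 1 := fun i => h.subset (h.orb_mem_Icc i)
  have h1 : S.orb A 1 < S.e := by
    have := h.orb_mem 1
    rw [K_one] at this
    exact this.2
  have h0m : (0 : ℝ) ∈ Icc t 1 := ⟨h.t_neg.le, zero_le_one⟩
  have hem : S.e ∈ Icc t 1 := ⟨by linarith [h.t_neg], he1.le⟩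
  have hvm : S.F A S.e ∈ Icc t 1 := ⟨h.lt_v.le, by linarith⟩
  set c := min (min ((1 - S.e) / L) (S.e / L)) (min (-S.F A S.e / L) ((S.e - S.orb A 1) / L / L))
    with hc
  have hLpos : 0 < L := by linarith
  have c1 : c * L ≤ 1 - S.e := by
    rw [← le_div_iff₀ hLpos]; exact (min_le_left _ _).trans (min_le_left _ _)
  have c2 : c * L ≤ S.e := by
    rw [← le_div_iff₀ hLpos]; exact (min_le_left _ _).trans (min_le_right _ _)
  have c3 : c * L ≤ -S.F A S.e := by
    rw [← le_div_iff₀ hLpos]; exact (min_le_right _ _).trans (min_le_left _ _)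
  have c4 : c * L * L ≤ S.e - S.orb A 1 := by
    rw [← le_div_iff₀ hLpos, ← le_div_iff₀ hLpos]; exact (min_le_right _ _).trans (min_le_right _ _)
  have cpos : 0 < c := by
    refine lt_min (lt_min ?_ ?_) (lt_min ?_ ?_)
    · exact div_pos (by linarith) hLpos
    · exact div_pos he hLpos
    · exact div_pos (by linarith) hLpos
    · exact div_pos (div_pos (by linarith) hLpos) hLpos
  have hab : ∀ a : ℝ, a ≤ |a| := le_abs_self
  refine ⟨c, cpos, fun i s w hw hs ho => ?_⟩
  have hi := h.orb_mem i
  have hi1 := h.orb_mem (i + 1)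
  have R := rules i
  generalize hk : K i = k at *
  cases hod : od i <;> simp only [hod, if_true, if_false, Bool.false_eq_true] at ho
  · rw [abs_of_nonneg (by linarith)]
    have hk2 := R.even_two hod
    rcases (by omega : k = 0 ∨ k = 1 ∨ k = 2) with rfl | rfl | rfl
    · have hw0 : 0 ≤ w := by
        rcases (by omega : s = 1 ∨ s = 2) with rfl | rfl
        · exact hw.1
        · exact he.le.trans hw
      rw [R.even_zero hod hk, orb_succ] at hi1
      have := hL 0 h0m _ (hm i)
      rw [F_zero, zero_sub, abs_neg, abs_of_neg (a := S.orb A i) hi] at this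
      have h2 := hab (1 - S.F A (S.orb A i))
      have h3 := hi1.2
      have : c * L ≤ (w - S.orb A i) * L := by nlinarith
      exact le_of_mul_le_mul_right this hLpos
    · rw [R.even_one hod hk, orb_succ] at hi1
      have hw0 : S.e ≤ w := by
        rcases (by omega : s = 0 ∨ s = 2) with rfl | rfl
        · have h2 := hi.1; simp at hw; linarith
        · exact hw
      have := hL _ (hm i) _ hem
      rw [abs_sub_comm (S.orb A i), abs_of_pos (sub_pos.2 hi.2)] at this
      have h2 := hab (S.F A (S.orb A i) - S.F A S.e)
      simp only [op_two, mem_Ioi] at hi1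
      have : c * L ≤ (w - S.orb A i) * L := by nlinarith
      exact le_of_mul_le_mul_right this hLpos
    · exact absurd hk hk2
  · rw [abs_of_nonpos (by linarith)]
    rcases (by omega : k = 0 ∨ k = 1 ∨ k = 2) with rfl | rfl | rfl
    · exfalso
      have hi' : S.orb A i < 0 := hi
      rcases (by omega : s = 1 ∨ s = 2) with rfl | rfl
      · linarith [hw.1]
      · simp at hw; linarith
    · rw [R.odd_one hod hk, orb_succ] at hi1
      have hw0 : w ≤ 0 := by
        rcases (by omega : s = 0 ∨ s = 2) with rfl | rfl
        · exact hw
        · have h2 := hi.2; simp at hw; linarith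
      have := hL 0 h0m _ (hm i)
      rw [F_zero, zero_sub, abs_neg, abs_of_pos (a := S.orb A i) hi.1] at this
      have h2 := hab (1 - S.F A (S.orb A i))
      simp only [op_zero, mem_Iio] at hi1
      have : c * L ≤ (-(w - S.orb A i)) * L := by nlinarith
      exact le_of_mul_le_mul_right this hLpos
    · have hw0 : w ≤ S.e := by
        rcases (by omega : s = 0 ∨ s = 1) with rfl | rfl
        · simp at hw; linarith
        · exact hw.2
      simp only [op_two, mem_Ioi] at hi
      have l1 := hL _ (hm i) _ hem
      rw [abs_of_pos (sub_pos.2 hi), ← orb_succ] at l1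
      have l2 := hab (S.orb A (i + 1) - S.F A S.e)
      suffices hs : c * L ≤ S.orb A (i + 1) - S.F A S.e by
        have : c * L ≤ (-(w - S.orb A i)) * L := by nlinarith
        exact le_of_mul_le_mul_right this hLpos
      -- To keep the point away from `e`, its image must be kept away from `v`. If the image is in
      -- the left lap, its own image is in the right lap, while `F v` is below `e`; otherwise the
      -- image is nonnegative.
      by_cases hk1 : K (i + 1) = 0
      · have ho' : od (i + 1) = true := by rw [od_succ, hod, hk]; rfl
        have hk2 := (rules (i + 1)).odd_zero ho' hk1
        have hi2 := h.orb_mem (i + 2)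
        rw [hk2] at hi2
        simp only [op_two, mem_Ioi] at hi2
        have l3 := hL _ (hm (i + 1)) _ hvm
        rw [← orb_succ, ← orb_zero, ← orb_succ, zero_add] at l3
        have l4 := hab (S.orb A (i + 1 + 1) - S.orb A 1)
        rw [orb_zero, abs_of_nonneg (a := S.orb A (i + 1) - S.F A S.e)
          (by linarith [(h.orb_mem_Icc (i + 1)).1])] at l3
        have hi2' : S.e < S.orb A (i + 1 + 1) := hi2
        have : (c * L) * L ≤ (S.orb A (i + 1) - S.F A S.e) * L := by linarith
        exact le_of_mul_le_mul_right this hLpos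
      · have : 0 ≤ S.orb A (i + 1) := by
          rcases (by omega : K (i + 1) = 1 ∨ K (i + 1) = 2) with h2 | h2 <;> rw [h2] at hi1
          · exact hi1.1.le
          · simp at hi1; linarith
        linarith

lemma iterate_lipschitz {L : ℝ} (h : S.Core A t) (hL1 : 1 ≤ L)
    (hL : ∀ u ∈ Icc t 1, ∀ w ∈ Icc t 1, |S.F A u - S.F A w| ≤ L * |u - w|) (m : ℕ) {u w : ℝ}
    (hu : u ∈ Icc t 1) (hw : w ∈ Icc t 1) :
    |(S.F A)^[m] u - (S.F A)^[m] w| ≤ L ^ m * |u - w| := by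
  induction m with
  | zero => simp
  | succ m ih =>
    rw [Function.iterate_succ_apply', Function.iterate_succ_apply', pow_succ]
    have := hL _ (h.mapsTo.iterate m hu) _ (h.mapsTo.iterate m hw)
    nlinarith

/-- The symbols separate at most two steps after time `n`, where `Core.exists_gap` applies; going
back costs at most `L ^ 2`. -/
lemma Core.exists_track_gap (h : S.Core A t) : ∃ δ > 0, ∀ (s : ℕ → Fin 3) (u : ℝ) (n i : ℕ),
    u ∈ Icc (S.F A S.e) 1 → (∀ j, (S.F A)^[j] u ∈ S.cl (s j)) → i ≤ n →
    (∀ j < i, s (n - i + j) = K j) → (∃ m < 3, s (n + m) ≠ K (i + m)) →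
    δ ≤ |(S.F A)^[n] u - S.orb A i| := by
  obtain ⟨L, hL1, hL⟩ := exists_lipschitz S A t
  obtain ⟨c, hc, hgap⟩ := h.exists_gap
  refine ⟨c / L ^ 2, by positivity, ?_⟩
  intro s u n i hu hs hin htr hex
  classical
  have hm := Nat.find_spec hex
  have hmin : ∀ j < Nat.find hex, s (n + j) = K (i + j) := fun j hj => by
    by_contra hne
    exact Nat.find_min hex hj ⟨by omega, hne⟩
  generalize Nat.find hex = m at hm hmin
  obtain ⟨hm3, hne⟩ := hm
  have hcl : ∀ j < i + m, (S.F A)^[j] ((S.F A)^[n - i] u) ∈ S.cl (K j) := by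
    intro j hj
    rw [← Function.iterate_add_apply]
    have := hs (j + (n - i))
    rcases Nat.lt_or_ge j i with h1 | h1
    · rwa [add_comm j, htr j h1, add_comm] at this
    · have e := hmin (j - i) (by omega)
      rw [show n + (j - i) = j + (n - i) by omega, show i + (j - i) = j by omega] at e
      rwa [e] at this
  have ho := h.order (h.mapsTo_v.iterate (n - i) hu).1 hcl
  rw [← Function.iterate_add_apply, show i + m + (n - i) = m + n by omega] at ho
  have g := hgap (i + m) (s (n + m)) _ (hs (n + m)) hne
    (by rwa [add_comm m n] at ho)
  have l := iterate_lipschitz h hL1 hL m (h.mapsTo.iterate n (h.subset hu))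
    (h.subset (h.orb_mem_Icc i))
  rw [iterate_orb, ← Function.iterate_add_apply, add_comm m n, add_comm m i] at l
  rw [div_le_iff₀ (by positivity)]
  have : L ^ m ≤ L ^ 2 := pow_le_pow_right₀ hL1 (by omega)
  have := abs_nonneg ((S.F A)^[n] u - S.orb A i)
  nlinarith

/-- If one of two consecutive points is at most `e`, the Lipschitz bound at the fixed point `1`
keeps the first of them away from `1`. -/
lemma Core.exists_one_gap (h : S.Core A t) : ∃ δ > 0, ∀ (s : ℕ → Fin 3) (u : ℝ) (n : ℕ),
    u ∈ Icc t 1 → (∀ j, (S.F A)^[j] u ∈ S.cl (s j)) → ¬ (s n = 2 ∧ s (n + 1) = 2) →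
    δ ≤ |(S.F A)^[n] u - 1| := by
  obtain ⟨L, hL1, hL⟩ := exists_lipschitz S A t
  have he := S.e_pos; have he1 := S.e_lt
  have low : ∀ (a : Fin 3) (w : ℝ), a ≠ 2 → w ∈ S.cl a → w ≤ S.e := by
    intro a w ha hw
    rcases (by omega : a = 0 ∨ a = 1) with rfl | rfl
    · simp at hw; linarith
    · exact hw.2
  refine ⟨(1 - S.e) / L, div_pos (by linarith) (by linarith), ?_⟩
  intro s u n hu hs hne
  rw [div_le_iff₀ (by linarith)]
  have hun := h.mapsTo.iterate n hu
  have hun1 := h.mapsTo.iterate (n + 1) hu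
  have l := hL _ hun 1 ⟨by linarith [h.t_neg], le_rfl⟩
  rw [F_one, ← Function.iterate_succ_apply' (f := S.F A), abs_of_nonpos (by linarith [hun1.2])] at l
  have a0 := abs_nonneg ((S.F A)^[n] u - 1)
  by_cases h2 : s n = 2
  · have := low _ _ (fun h3 => hne ⟨h2, h3⟩) (hs (n + 1))
    linarith
  · have := low _ _ h2 (hs n)
    rw [abs_of_nonpos (by linarith)] at a0 ⊢
    nlinarith

end Shape
end IntervalDynamics

namespace IntervalDynamics
namespace Shape

variable {S : Shape} {A t : ℝ}

/-! ### Points with the same itinerary coincide -/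

lemma exists_turning_between {s : Fin 3} {w w' : ℝ} (hw : w ∉ S.cl s) (hw' : w' ∈ S.cl s) :
    ∃ c ∈ S.cl s, (c = 0 ∨ c = S.e) ∧ c ∈ uIcc w w' := by
  have he := S.e_pos
  fin_cases s
  · simp at hw hw'
    exact ⟨0, by simp, Or.inl rfl, mem_uIcc.2 (Or.inr ⟨hw', hw.le⟩)⟩
  · rcases lt_or_ge w 0 with h | h
    · exact ⟨0, by simp [he.le], Or.inl rfl, mem_uIcc.2 (Or.inl ⟨h.le, hw'.1⟩)⟩
    · have : S.e < w := by by_contra h2; exact hw ⟨h, not_lt.1 h2⟩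
      exact ⟨S.e, by simp [he.le], Or.inr rfl, mem_uIcc.2 (Or.inr ⟨hw'.2, this.le⟩)⟩
  · simp at hw hw'
    exact ⟨S.e, by simp, Or.inr rfl, mem_uIcc.2 (Or.inl ⟨hw.le, hw'⟩)⟩

/-- The maximal extension towards `r` of a monotone branch of the `n`-th iterate ends at a point
of the orbit of a turning point, or of `r`. -/
lemma Kneads.exists_end (h : S.Kneads A) {s : ℕ → Fin 3} {x : ℝ} (r : ℝ)
    (hx : ∀ i, (S.F A)^[i] x ∈ S.cl (s i)) (n : ℕ) :
    ∃ a ∈ uIcc r x, (∀ i < n, (S.F A)^[i] a ∈ S.cl (s i)) ∧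
      ((S.F A)^[n] a = 1 ∨
        ((S.F A)^[n] a = (S.F A)^[n] r ∧ ∀ i < n, (S.F A)^[i] r ∈ S.cl (s i)) ∨
        ∃ i < n, (S.F A)^[n] a = S.orb A i ∧ ∀ j < i, s (n - i + j) = K j) := by
  induction n with
  | zero => exact ⟨r, left_mem_uIcc, by simp, Or.inr (Or.inl ⟨rfl, by simp⟩)⟩
  | succ n ih =>
    obtain ⟨a, ha, hcl, hend⟩ := ih
    by_cases hin : (S.F A)^[n] a ∈ S.cl (s n)
    · have hall : ∀ y, (∀ i < n, (S.F A)^[i] y ∈ S.cl (s i)) → (S.F A)^[n] y ∈ S.cl (s n) →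
          ∀ i < n + 1, (S.F A)^[i] y ∈ S.cl (s i) := fun y h1 h2 i hi => by
        rcases Nat.lt_succ_iff_lt_or_eq.1 hi with h | rfl
        · exact h1 i h
        · exact h2
      refine ⟨a, ha, hall a hcl hin, ?_⟩
      simp only [Function.iterate_succ_apply']
      rcases hend with h1 | ⟨h1, h2⟩ | ⟨i, hi, h1, h2⟩
      · exact Or.inl (by rw [h1, F_one])
      · exact Or.inr (Or.inl ⟨by rw [h1], hall r h2 (h1 ▸ hin)⟩)
      · refine Or.inr (Or.inr ⟨i + 1, by omega, by rw [h1, orb_succ], fun j hj => ?_⟩)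
        rcases Nat.lt_succ_iff_lt_or_eq.1 hj with hj | rfl
        · rw [show n + 1 - (i + 1) + j = n - i + j by omega]; exact h2 j hj
        · rw [show n + 1 - (j + 1) + j = n by omega]
          exact (S.eq_of_mem_op_of_mem_cl (h.orb_mem j) (h1 ▸ hin)).symm
    -- The branch now crosses a turning point and is cut at its preimage. The new end is sent to
    -- `1`, or to `v`, where the tracking of `K` starts afresh.
    · obtain ⟨c, hc, hc', hcb⟩ := exists_turning_between hin (hx n)
      obtain ⟨a', ha', hac⟩ := intermediate_value_uIcc
        (((S.continuous_F A).iterate n).continuousOn (s := uIcc a x)) hcb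
      have hsub : uIcc a x ⊆ uIcc r x := uIcc_subset_uIcc_right ha
      have h1 := iterate_lap (n := n) h.pos hcl (fun i _ => hx i)
      refine ⟨a', hsub ha', fun i hi => ?_, ?_⟩
      · rcases Nat.lt_succ_iff_lt_or_eq.1 hi with hi | rfl
        · exact h1 i hi a' ha'
        · rw [hac]; exact hc
      · simp only [Function.iterate_succ_apply', hac]
        rcases hc' with rfl | rfl
        · exact Or.inl (S.F_zero A)
        · exact Or.inr (Or.inr ⟨0, by omega, rfl, by simp⟩)

/-- There is no interval of points with the same itinerary whose branches have, at infinitely many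
times, extensions of definite size on both sides. -/
lemma false_of_extensions (hA : 0 < A) {r x y δ : ℝ} {s : ℕ → Fin 3}
    (hmaps : MapsTo (S.F A) (Icc r 1) (Icc r 1))
    (hx : x ∈ Icc r 1) (hy : y ∈ Icc r 1) (hxy : x < y)
    (hmin : ∀ u ∈ Icc r 1, (∀ i, (S.F A)^[i] u ∈ S.cl (s i)) → x ≤ u) (hδ : 0 < δ)
    (hext : ∀ N, ∃ n ≥ N, ∃ a ∈ Icc r x, ∃ b ∈ Icc y 1,
      (∀ i < n, (S.F A)^[i] a ∈ S.cl (s i)) ∧ (∀ i < n, (S.F A)^[i] b ∈ S.cl (s i)) ∧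
      δ ≤ |(S.F A)^[n] x - (S.F A)^[n] a| ∧ δ ≤ |(S.F A)^[n] y - (S.F A)^[n] b|) : False := by
  choose n hn a ha b hb has hbs hda hdb using hext
  have hr1 : r ≤ 1 := hx.1.trans hx.2
  have har : ∀ N, a N ∈ Icc r 1 := fun N => ⟨(ha N).1, (ha N).2.trans hx.2⟩
  have hbr : ∀ N, b N ∈ Icc r 1 := fun N => ⟨hy.1.trans (hb N).1, (hb N).2⟩
  have hdist : ∀ N, ∀ u ∈ Icc r 1, ∀ w ∈ Icc r 1, |(S.F A)^[N] u - (S.F A)^[N] w| ≤ 1 - r + 1 := by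
    intro N u hu w hw
    have h1 := hmaps.iterate N hu
    have h2 := hmaps.iterate N hw
    rw [abs_le]; constructor <;> linarith [h1.1, h1.2, h2.1, h2.2]
  have hbound : ∀ N, (y - x) * δ ^ 2 ≤ (x - a N) * (1 - r + 1) ^ 2 := fun N =>
    length_bound hA (has N) (hbs N) (ha N).2 hxy (hb N).1 hδ (hda N)
      (by rw [abs_sub_comm]; exact hdb N) (hdist _ _ (hbr N) _ (har N)) (hdist _ _ hy _ hx)
  -- The times tend to infinity, so a limit of the left ends has the full itinerary `s`, yet
  -- `hbound` keeps it strictly below the least such point.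
  obtain ⟨a0, ha0, φ, hφ, hlim⟩ := isCompact_Icc.tendsto_subseq har
  have hit : ∀ i, (S.F A)^[i] a0 ∈ S.cl (s i) := by
    intro i
    refine (S.isClosed_cl (s i)).mem_of_tendsto
      ((((S.continuous_F A).iterate i).tendsto a0).comp hlim) ?_
    filter_upwards [eventually_ge_atTop (i + 1)] with N hN
    refine has (φ N) i ?_
    have := hn (φ N); have := hφ.id_le N
    simp only [id] at *
    omega
  have hxa := hmin a0 ha0 hit
  have hlim2 : Tendsto (fun N => (x - a (φ N)) * (1 - r + 1) ^ 2) atTop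
      (𝓝 ((x - a0) * (1 - r + 1) ^ 2)) := (tendsto_const_nhds.sub hlim).mul_const _
  have := ge_of_tendsto' hlim2 fun N => hbound (φ N)
  have h1 : (x - a0) * (1 - r + 1) ^ 2 ≤ 0 :=
    mul_nonpos_of_nonpos_of_nonneg (by linarith) (by positivity)
  have h2 : 0 < (y - x) * δ ^ 2 := mul_pos (by linarith) (by positivity)
  linarith

lemma exists_min_itinerary {r y : ℝ} {s : ℕ → Fin 3} (hy : y ∈ Icc r 1)
    (hys : ∀ i, (S.F A)^[i] y ∈ S.cl (s i)) :
    ∃ x ∈ Icc r 1, (∀ i, (S.F A)^[i] x ∈ S.cl (s i)) ∧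
      ∀ u ∈ Icc r 1, (∀ i, (S.F A)^[i] u ∈ S.cl (s i)) → x ≤ u := by
  have hc : IsCompact (Icc r 1 ∩ ⋂ i, (S.F A)^[i] ⁻¹' S.cl (s i)) :=
    isCompact_Icc.inter_right
      (isClosed_iInter fun i => (S.isClosed_cl (s i)).preimage ((S.continuous_F A).iterate i))
  obtain ⟨x, hx, hmin⟩ := hc.exists_isLeast ⟨y, hy, mem_iInter.2 hys⟩
  exact ⟨x, hx.1, mem_iInter.1 hx.2, fun u hu hus => hmin ⟨hu, mem_iInter.2 hus⟩⟩

/-- The critical value is the only point with its itinerary. -/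
lemma Core.eq_of_itinerary_K (h : S.Core A t) {x y : ℝ} (hx : x ∈ Icc t 1) (hy : y ∈ Icc t 1)
    (hxs : ∀ i, (S.F A)^[i] x ∈ S.cl (K i)) (hys : ∀ i, (S.F A)^[i] y ∈ S.cl (K i)) : x = y := by
  obtain ⟨z, hz, hzs, hmin⟩ := exists_min_itinerary hx hxs
  suffices key : ∀ w ∈ Icc t 1, (∀ i, (S.F A)^[i] w ∈ S.cl (K i)) → z = w by
    rw [← key x hx hxs, ← key y hy hys]
  intro w hw hws
  by_contra hne
  have hzw : z < w := lt_of_le_of_ne (hmin w hw hws) hne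
  obtain ⟨L, hL1, hL⟩ := exists_lipschitz S A t
  have hLpos : 0 < L := by linarith
  have he := S.e_pos
  have hv1 : S.orb A 1 < S.e := by
    have := h.orb_mem 1
    rw [K_one] at this
    exact this.2
  have h1 := h.t_neg
  set δ := min 1 ((S.e - S.orb A 1) / L) with hδ
  have hδ0 : 0 < δ := lt_min one_pos (div_pos (by linarith) hLpos)
  -- The word before time `big k` has no proper border, so a branch cannot end at `S.orb A i` with
  -- `0 < i < big k`. The other ends map to `1`, `t` or `v`. At that time the point is in the left
  -- lap and its image in the right one, which keeps it away from all three.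
  have hgap : ∀ k, ∀ u ∈ Icc t 1, (∀ i, (S.F A)^[i] u ∈ S.cl (K i)) → ∀ a,
      ((S.F A)^[big k] a = 1 ∨
        ((S.F A)^[big k] a = t) ∨
        ∃ i < big k, (S.F A)^[big k] a = S.orb A i ∧ ∀ j < i, K (big k - i + j) = K j) →
      δ ≤ |(S.F A)^[big k] u - (S.F A)^[big k] a| := by
    intro k u hu hus a ha
    have hk0 := five_le_len k; have hk1 := big_eq k; have hk2 := run_bounds k
    have u0 := hus (big k)
    have u1 := hus (big k + 1)
    rw [K_big, cl_zero, mem_Iic] at u0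
    rw [K_run (k := k) (by omega) (by omega), cl_two, mem_Ici, Function.iterate_succ_apply'] at u1
    have um := h.mapsTo.iterate (big k) hu
    have hvu : S.F A S.e ≤ (S.F A)^[big k] u := by
      by_contra hlt
      have := strictMonoOn_F_left (S := S) h.pos u0 (mem_Iic.2 h.v_neg.le) (not_le.1 hlt)
      rw [← orb_zero, ← orb_succ] at this
      linarith
    have hvd : δ ≤ (S.F A)^[big k] u - S.F A S.e := by
      refine (min_le_right _ _).trans ?_
      rw [div_le_iff₀ hLpos]
      have := hL _ um _ ⟨h.lt_v.le, by linarith [h.v_neg]⟩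
      rw [← orb_zero, ← orb_succ, abs_of_nonneg (a := _ - S.orb A 0) (by rw [orb_zero]; linarith)] at this
      have := le_abs_self (S.F A ((S.F A)^[big k] u) - S.orb A (0 + 1))
      rw [orb_zero] at *
      simp only [zero_add] at *
      linarith
    rcases ha with ha | ha | ⟨i, hi, ha, htr⟩
    · rw [ha, abs_of_nonpos (by linarith)]
      exact (min_le_left _ _).trans (by linarith)
    · rw [ha, abs_of_nonneg (by linarith [um.1])]
      linarith [h.lt_v]
    · rcases Nat.eq_zero_or_pos i with rfl | hpos
      · rw [ha, orb_zero, abs_of_nonneg (by linarith)]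
        exact hvd
      · exfalso
        obtain ⟨c, hc, hD⟩ := big_unbordered (k := k) (d := big k - i) (by omega) (by omega)
        exact hD.ne (htr c (by omega))
  refine false_of_extensions h.pos h.mapsTo hz hw hzw hmin hδ0 fun N => ?_
  refine ⟨big N, by have := lt_len N; have := big_eq N; omega, ?_⟩
  obtain ⟨a, ha, has, hea⟩ := h.exists_end t hzs (big N)
  obtain ⟨b, hb, hbs, heb⟩ := h.exists_end 1 hws (big N)
  rw [uIcc_of_le hz.1] at ha
  rw [uIcc_of_ge hw.2] at hb
  refine ⟨a, ha, b, hb, has, hbs, hgap N z hz hzs a ?_, hgap N w hw hws b ?_⟩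
  · rcases hea with hea | ⟨hea, -⟩ | hea
    · exact Or.inl hea
    · exact Or.inr (Or.inl (by rw [hea]; exact Function.iterate_fixed h.fixed _))
    · exact Or.inr (Or.inr hea)
  · rcases heb with heb | ⟨heb, -⟩ | heb
    · exact Or.inl heb
    · exact Or.inl (by rw [heb]; exact Function.iterate_fixed (S.F_one A) _)
    · exact Or.inr (Or.inr heb)

/-- The itinerary `s` follows the kneading sequence for `r` steps from time `p` on. -/
def Follows (s : ℕ → Fin 3) (p r : ℕ) : Prop := ∀ j < r, s (p + j) = K j

lemma Follows.mono {s : ℕ → Fin 3} {p r r' : ℕ} (h : Follows s p r) (hr : r' ≤ r) :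
    Follows s p r' := fun j hj => h j (by omega)

lemma Kneads.order_follows (h : S.Kneads A) {s : ℕ → Fin 3} {u : ℝ}
    (hu : u ∈ Icc (S.F A S.e) 1) {p r n : ℕ} (hn : p + r ≤ n)
    (hus : ∀ j < n, (S.F A)^[j] u ∈ S.cl (s j)) (hf : Follows s p r) :
    if od r then (S.F A)^[p + r] u ≤ S.orb A r else S.orb A r ≤ (S.F A)^[p + r] u := by
  have := h.order (h.mapsTo_v.iterate p hu).1 (r := r) (fun j hj => by
    rw [← Function.iterate_add_apply, add_comm j p, ← hf j hj]; exact hus _ (by omega))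
  rwa [← Function.iterate_add_apply, add_comm r p] at this

/-- At infinitely many times no stretch of the itinerary that follows the kneading sequence goes on
for long, unless the itinerary follows the kneading sequence forever. -/
lemma Kneads.exists_good_time (h : S.Kneads A) {s : ℕ → Fin 3} {u : ℝ}
    (hu : u ∈ Icc (S.F A S.e) 1) (hus : ∀ j, (S.F A)^[j] u ∈ S.cl (s j))
    (hnf : ∀ p, ∃ r, ¬ Follows s p r) (hne : ∀ N, ∃ n ≥ N, s n ≠ 2) (N : ℕ) :
    ∃ n ≥ N, (∀ p ≤ n, ¬ Follows s p (n + 3 - p)) ∧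
      (¬ (s n = 2 ∧ s (n + 1) = 2) ∨ ∃ p ≤ n, Follows s p (n + 2 - p)) := by
  by_contra hbad
  push Not at hbad
  -- Infinite descent: two steps before a tracking that started at `p` breaks off, another one must
  -- be in progress that outlives it, and this one started earlier.
  have step : ∀ p, (∃ n ≥ N, p ≤ n ∧ Follows s p (n + 3 - p)) →
      ∃ p' < p, ∃ n ≥ N, p' ≤ n ∧ Follows s p' (n + 3 - p') := by
    rintro p ⟨n, hnN, hpn, hf⟩
    classical
    have hex : ∃ c, s (p + c) ≠ K c := by
      obtain ⟨r, hr⟩ := hnf p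
      unfold Follows at hr
      push Not at hr
      obtain ⟨j, -, hj⟩ := hr
      exact ⟨j, hj⟩
    have hc := Nat.find_spec hex
    have hfc : Follows s p (Nat.find hex) := fun j hj => not_not.1 (Nat.find_min hex hj)
    generalize Nat.find hex = c at hc hfc
    have hc3 : n + 3 - p ≤ c := by
      by_contra hlt
      exact hc (hf c (by omega))
    have hex2 : ∃ p' ≤ p + c - 2, Follows s p' (p + c - 2 + 3 - p') := by
      by_contra hno
      push Not at hno
      exact (hbad (p + c - 2) (by omega) hno).2 p (by omega) (hfc.mono (by omega))
    obtain ⟨p', hp', hf'⟩ := hex2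
    refine ⟨p', ?_, p + c - 2, by omega, hp', hf'⟩
    -- A tracking started after `p` would compare `K` with a shift of itself at the place where the
    -- first one breaks. By the third kind of difference the point would be below an orbit point in
    -- the left lap, yet have symbol `2`.
    by_contra hge
    rcases (not_lt.1 hge).eq_or_lt with rfl | hlt
    · exact hc (hf' c (by omega))
    · obtain ⟨d, rfl⟩ : ∃ d, p' = p + d := ⟨p' - p, by omega⟩
      have hD : Differs d (c - d) := by
        refine differs_of_first (by omega) (fun i hi => ?_) ?_
        · rw [← hf' i (by omega), ← hfc (d + i) (by omega), add_assoc]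
        · rw [show d + (c - d) = c by omega, ← hf' (c - d) (by omega),
            show p + d + (c - d) = p + c by omega]
          exact hc.symm
      rcases hD.2 with ⟨h1, -⟩ | ⟨h1, -⟩ | ⟨-, h3, h4, -, h6⟩
      · omega
      · omega
      · rw [show d + (c - d) = c by omega] at h3 h6
        have ho := h.order_follows hu le_rfl (fun j _ => hus j) hfc
        rw [h6, if_pos rfl] at ho
        have m1 := h.orb_mem c
        rw [h3] at m1
        have m2 := hus (p + c)
        have e := hf' (c - d) (by omega)
        rw [show p + d + (c - d) = p + c by omega, h4] at e
        rw [e] at m2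
        simp only [op_zero, mem_Iio, cl_two, mem_Ici] at m1 m2
        linarith [S.e_pos]
  have none : ∀ p, ¬ ∃ n ≥ N, p ≤ n ∧ Follows s p (n + 3 - p) := by
    intro p
    induction p using Nat.strong_induction_on with
    | _ p ih =>
      intro hp
      obtain ⟨p', hp', h'⟩ := step p hp
      exact ih p' hp' h'
  obtain ⟨n, hn, hn2⟩ := hne N
  exact hn2 (hbad n hn fun p hp hf => none p ⟨n, hn, hp, hf⟩).1.1

/-- Two points of the core with the same itinerary coincide. -/
lemma Core.eq_of_itinerary_core (h : S.Core A t) {s : ℕ → Fin 3} {x y : ℝ}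
    (hx : x ∈ Icc (S.F A S.e) 1) (hy : y ∈ Icc (S.F A S.e) 1)
    (hxs : ∀ i, (S.F A)^[i] x ∈ S.cl (s i)) (hys : ∀ i, (S.F A)^[i] y ∈ S.cl (s i)) : x = y := by
  by_cases hK : ∃ p, ∀ j, s (p + j) = K j
  · obtain ⟨p, hp⟩ := hK
    refine iterate_injective (n := p) h.pos (fun i _ => hxs i) (fun i _ => hys i) ?_
    refine h.eq_of_itinerary_K (h.mapsTo.iterate p (h.subset hx))
      (h.mapsTo.iterate p (h.subset hy)) (fun i => ?_) (fun i => ?_)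
    · rw [← Function.iterate_add_apply, ← hp i, add_comm]; exact hxs _
    · rw [← Function.iterate_add_apply, ← hp i, add_comm]; exact hys _
  by_cases h2 : ∃ N, ∀ n ≥ N, s n = 2
  · obtain ⟨N, hN⟩ := h2
    refine iterate_injective (n := N) h.pos (fun i _ => hxs i) (fun i _ => hys i) ?_
    rw [h.eq_one_of_right (h.mapsTo_v.iterate N hx).2 fun n => ?_,
      h.eq_one_of_right (h.mapsTo_v.iterate N hy).2 fun n => ?_]
    · rw [← Function.iterate_add_apply, ← hN (n + N) (by omega)]; exact hys _
    · rw [← Function.iterate_add_apply, ← hN (n + N) (by omega)]; exact hxs _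
  push Not at hK h2
  obtain ⟨z, hz, hzs, hmin⟩ := exists_min_itinerary hx hxs
  suffices key : ∀ w ∈ Icc (S.F A S.e) 1, (∀ i, (S.F A)^[i] w ∈ S.cl (s i)) → z = w by
    rw [← key x hx hxs, ← key y hy hys]
  intro w hw hws
  by_contra hne
  have hzw : z < w := lt_of_le_of_ne (hmin w hw hws) hne
  obtain ⟨δ₁, hδ₁, hg₁⟩ := h.exists_track_gap
  obtain ⟨δ₂, hδ₂, hg₂⟩ := h.exists_one_gap
  refine false_of_extensions h.pos h.mapsTo_v hz hw hzw hmin (lt_min hδ₁ hδ₂) fun N => ?_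
  obtain ⟨n, hnN, hn1, hn2⟩ := h.exists_good_time hz hzs (fun p => by
    obtain ⟨j, hj⟩ := hK p
    exact ⟨j + 1, fun hf => hj (hf j (by omega))⟩) h2 N
  obtain ⟨a, ha, has, hea⟩ := h.exists_end (S.F A S.e) hzs n
  obtain ⟨b, hb, hbs, heb⟩ := h.exists_end 1 hws n
  rw [uIcc_of_le hz.1] at ha
  rw [uIcc_of_ge hw.2] at hb
  have am : a ∈ Icc (S.F A S.e) 1 := ⟨ha.1, ha.2.trans hz.2⟩
  have bm : b ∈ Icc (S.F A S.e) 1 := ⟨hw.1.trans hb.1, hb.2⟩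
  -- At a good time every tracking stops within three symbols, so orbit points of `v` at the end of
  -- a branch are covered by `exists_track_gap`, and the end `1` by `exists_one_gap`, except in the
  -- case excluded below.
  have gap : ∀ c ∈ Icc (S.F A S.e) 1, (∀ i < n, (S.F A)^[i] c ∈ S.cl (s i)) →
      ((S.F A)^[n] c = 1 ∨
        ∃ i ≤ n, (S.F A)^[n] c = S.orb A i ∧ ∀ j < i, s (n - i + j) = K j) →
      ∀ u ∈ Icc (S.F A S.e) 1, (∀ i, (S.F A)^[i] u ∈ S.cl (s i)) →
      min δ₁ δ₂ ≤ |(S.F A)^[n] u - (S.F A)^[n] c| := by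
    intro c hc hcs hend u hu hus
    rcases hend with hend | ⟨i, hi, hend, htr⟩
    · rw [hend]
      refine (min_le_right _ _).trans (hg₂ s u n (h.subset hu) hus ?_)
      rcases hn2 with hn2 | ⟨p, hp, hf⟩
      · exact hn2
      -- A tracked symbol `2` has odd parity, which puts the end below the critical orbit; an end at
      -- `1` would force that orbit to reach `1`.
      · rintro ⟨s1, -⟩
        have ho := h.order_follows hc (by omega : p + (n - p) ≤ n) hcs (hf.mono (by omega))
        have hk : K (n - p) = 2 := by
          rw [← hf (n - p) (by omega), show p + (n - p) = n by omega, s1]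
        have hodd : od (n - p) = true := by
          by_contra hno
          exact (rules (n - p)).even_two (by simpa using hno) hk
        rw [hodd, if_pos rfl, show p + (n - p) = n by omega, hend] at ho
        have h1 : S.orb A (n - p) = 1 := le_antisymm (h.orb_mem_Icc _).2 ho
        obtain ⟨m, hm, hKm⟩ := exists_K_ne_two (n - p)
        have h3 := h.orb_mem m
        rw [show m = (m - (n - p)) + (n - p) by omega, ← iterate_orb, h1,
          Function.iterate_fixed (S.F_one A), show (m - (n - p)) + (n - p) = m by omega] at h3
        exact hKm (S.eq_of_mem_op_of_mem_cl h3 (by simpa using S.e_lt.le))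
    · rw [hend]
      refine (min_le_left _ _).trans (hg₁ s u n i hu hus hi htr ?_)
      by_contra hno
      push Not at hno
      refine hn1 (n - i) (by omega) fun j hj => ?_
      rcases Nat.lt_or_ge j i with hji | hji
      · exact htr j hji
      · have := hno (j - i) (by omega)
        rwa [show n + (j - i) = n - i + j by omega, show i + (j - i) = j by omega] at this
  refine ⟨n, hnN, a, ha, b, hb, has, hbs, gap a am has ?_ z hz hzs, gap b bm hbs ?_ w hw hws⟩
  · rcases hea with hea | ⟨hea, hr⟩ | ⟨i, hi, hea⟩
    · exact Or.inl hea
    · refine Or.inr ⟨n, le_rfl, hea, fun j hj => ?_⟩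
      rw [Nat.sub_self, zero_add]
      exact (S.eq_of_mem_op_of_mem_cl (h.orb_mem j) (hr j hj)).symm
    · exact Or.inr ⟨i, hi.le, hea⟩
  · rcases heb with heb | ⟨heb, -⟩ | ⟨i, hi, heb⟩
    · exact Or.inl heb
    · exact Or.inl (by rw [heb]; exact Function.iterate_fixed (S.F_one A) _)
    · exact Or.inr ⟨i, hi.le, heb⟩

/-- Two points with the same itinerary coincide. -/
theorem Core.eq_of_itinerary (h : S.Core A t) {s : ℕ → Fin 3} {x y : ℝ}
    (hx : x ∈ Icc t 1) (hy : y ∈ Icc t 1)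
    (hxs : ∀ i, (S.F A)^[i] x ∈ S.cl (s i)) (hys : ∀ i, (S.F A)^[i] y ∈ S.cl (s i)) : x = y := by
  by_cases h0 : ∀ n, s n = 0
  · rw [h.eq_of_left hx.1 fun n => h0 n ▸ hxs n, h.eq_of_left hy.1 fun n => h0 n ▸ hys n]
  · push Not at h0
    obtain ⟨n, hn⟩ := h0
    refine iterate_injective (n := n) h.pos (fun i _ => hxs i) (fun i _ => hys i) ?_
    -- Both orbits are compared from the first position known to carry a symbol other than `0`; from
    -- there on they lie in the forward invariant interval `[v, 1]`.
    have high : ∀ w, w ∈ Icc t 1 → w ∈ S.cl (s n) → w ∈ Icc (S.F A S.e) 1 := by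
      intro w hw hws
      have he := S.e_pos; have hv := h.v_neg
      refine ⟨?_, hw.2⟩
      rcases (by omega : s n = 1 ∨ s n = 2) with h1 | h1 <;> rw [h1] at hws
      · linarith [hws.1]
      · simp at hws; linarith
    refine h.eq_of_itinerary_core (s := fun i => s (i + n))
      (high _ (h.mapsTo.iterate n hx) (hxs n)) (high _ (h.mapsTo.iterate n hy) (hys n))
      (fun i => ?_) (fun i => ?_)
    · rw [← Function.iterate_add_apply]; exact hxs _
    · rw [← Function.iterate_add_apply]; exact hys _

end Shape
end IntervalDynamics

namespace IntervalDynamics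
namespace Shape

variable {S S' : Shape} {A A' t t' : ℝ}

/-! ### Maps with the same kneading sequence are conjugate -/

/-- `s` is an itinerary of `x`, where a turning point may be counted to either adjacent lap. -/
def Codes (S : Shape) (A x : ℝ) (s : ℕ → Fin 3) : Prop := ∀ i, (S.F A)^[i] x ∈ S.cl (s i)

lemma exists_codes (S : Shape) (A x : ℝ) : ∃ s, S.Codes A x s := by
  choose s hs using fun i => S.exists_mem_cl ((S.F A)^[i] x)
  exact ⟨s, hs⟩

lemma Codes.tail {x : ℝ} {s : ℕ → Fin 3} (h : S.Codes A x s) :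
    S.Codes A (S.F A x) (fun i => s (i + 1)) := fun i => by
  rw [← Function.iterate_succ_apply]; exact h (i + 1)

lemma Codes.cons {x : ℝ} {a : Fin 3} {s : ℕ → Fin 3} (hx : x ∈ S.cl a)
    (h : S.Codes A (S.F A x) s) : S.Codes A x (fun i => Nat.casesOn i a s)
  | 0 => hx
  | i + 1 => by rw [Function.iterate_succ_apply]; exact h i

/-- The order of two points is determined by itineraries of theirs that differ. -/
lemma le_of_itinerary (hA : 0 < A) (hA' : 0 < A') {a b : Fin 3} (hab : a ≠ b)
    (r : ℕ) : ∀ {s : ℕ → Fin 3} {x x' y y' : ℝ}, x < x' →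
      (∀ i < r, (S.F A)^[i] x ∈ S.cl (s i)) → (∀ i < r, (S.F A)^[i] x' ∈ S.cl (s i)) →
      (∀ i < r, (S'.F A')^[i] y ∈ S'.cl (s i)) → (∀ i < r, (S'.F A')^[i] y' ∈ S'.cl (s i)) →
      (S.F A)^[r] x ∈ S.cl a → (S.F A)^[r] x' ∈ S.cl b →
      (S'.F A')^[r] y ∈ S'.cl a → (S'.F A')^[r] y' ∈ S'.cl b → y ≤ y' := by
  induction r generalizing a b with
  | zero =>
    intro s x x' y y' hx _ _ _ _ h1 h2 h3 h4
    rcases hab.lt_or_gt with h | h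
    · exact S'.le_of_mem_cl_of_lt h3 h4 h
    · exact absurd (S.le_of_mem_cl_of_lt h2 h1 h) (not_le.2 hx)
  | succ r ih =>
    intro s x x' y y' hx c1 c2 c3 c4 h1 h2 h3 h4
    have m1 := c1 0 (by omega); have m2 := c2 0 (by omega)
    have m3 := c3 0 (by omega); have m4 := c4 0 (by omega)
    simp only [Function.iterate_zero, id] at m1 m2 m3 m4
    have sh : ∀ {T : Shape} {B z : ℝ}, (∀ i < r + 1, (T.F B)^[i] z ∈ T.cl (s i)) →
        ∀ i < r, (T.F B)^[i] (T.F B z) ∈ T.cl (s (i + 1)) := fun h i hi => by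
      rw [← Function.iterate_succ_apply]; exact h (i + 1) (by omega)
    simp only [Function.iterate_succ_apply] at h1 h2 h3 h4
    by_contra hlt
    push Not at hlt
    by_cases h0 : s 0 = 1
    · rw [h0] at m1 m2 m3 m4
      have e1 := strictAntiOn_F (S := S) hA m1 m2 hx
      have e2 := strictAntiOn_F (S := S') hA' m4 m3 hlt
      exact absurd (ih hab.symm (s := fun i => s (i + 1)) e1 (sh c2) (sh c1) (sh c4) (sh c3)
        h2 h1 h4 h3) (not_le.2 e2)
    · have e1 := strictMonoOn_F (S := S) hA h0 m1 m2 hx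
      have e2 := strictMonoOn_F (S := S') hA' h0 m4 m3 hlt
      exact absurd (ih hab (s := fun i => s (i + 1)) e1 (sh c1) (sh c2) (sh c3) (sh c4)
        h1 h2 h3 h4) (not_le.2 e2)

/-- The points `x` and `y` correspond to each other: every itinerary of `x` is one of `y`. -/
structure Corr (h : S.Core A t) (h' : S'.Core A' t') (x y : ℝ) : Prop where
  left : x ∈ Icc t 1
  right : y ∈ Icc t' 1
  codes : ∀ s, S.Codes A x s → S'.Codes A' y s

variable {h : S.Core A t} {h' : S'.Core A' t'} {x y x' y' : ℝ}

lemma Corr.unique (c : Corr h h' x y) (c' : Corr h h' x y') : y = y' := by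
  obtain ⟨s, hs⟩ := S.exists_codes A x
  exact h'.eq_of_itinerary c.right c'.right (c.codes s hs) (c'.codes s hs)

lemma Corr.le (c : Corr h h' x y) (c' : Corr h h' x' y') (hx : x ≤ x') : y ≤ y' := by
  rcases hx.eq_or_lt with rfl | hx
  · exact (c.unique c').le
  obtain ⟨s, hs⟩ := S.exists_codes A x
  obtain ⟨s', hs'⟩ := S.exists_codes A x'
  have cs := c.codes s hs
  have cs' := c'.codes s' hs'
  by_cases hss : ∃ r, s r ≠ s' r
  · classical
    have h1 := Nat.find_spec hss
    have h2 : ∀ i < Nat.find hss, s' i = s i := fun i hi =>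
      (not_not.1 (Nat.find_min hss hi)).symm
    exact le_of_itinerary h.pos h'.pos (s := s) h1 _ hx (fun i _ => hs i)
      (fun i hi => h2 i hi ▸ hs' i) (fun i _ => cs i) (fun i hi => h2 i hi ▸ cs' i)
      (hs _) (hs' _) (cs _) (cs' _)
  · push Not at hss
    obtain rfl : s = s' := funext hss
    exact (h'.eq_of_itinerary c.right c'.right cs cs').le

lemma Corr.map (c : Corr h h' x y) : Corr h h' (S.F A x) (S'.F A' y) where
  left := h.mapsTo c.left
  right := h'.mapsTo c.right
  codes s hs := by
    obtain ⟨a, ha⟩ := S.exists_mem_cl x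
    exact (c.codes _ (hs.cons ha)).tail

lemma Corr.mem_cl (c : Corr h h' x y) {a : Fin 3} (ha : x ∈ S.cl a) : y ∈ S'.cl a := by
  obtain ⟨s, hs⟩ := S.exists_codes A (S.F A x)
  exact c.codes _ (hs.cons ha) 0

lemma Corr.of_map (hx : x ∈ Icc t 1) (hy : y ∈ Icc t' 1) (hcl : ∀ a, x ∈ S.cl a → y ∈ S'.cl a)
    (c : Corr h h' (S.F A x) (S'.F A' y)) : Corr h h' x y where
  left := hx
  right := hy
  codes s hs
    | 0 => hcl _ (hs 0)
    | i + 1 => by rw [Function.iterate_succ_apply]; exact c.codes _ hs.tail i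

/-- An orbit that avoids the turning points has only one itinerary, so one common itinerary
suffices. -/
lemma Corr.of_op (hx : x ∈ Icc t 1) (hy : y ∈ Icc t' 1) {s : ℕ → Fin 3}
    (hxs : ∀ i, (S.F A)^[i] x ∈ S.op (s i)) (hys : S'.Codes A' y s) : Corr h h' x y where
  left := hx
  right := hy
  codes s' hs' i := by
    rw [← S.eq_of_mem_op_of_mem_cl (hxs i) (hs' i)]; exact hys i

lemma corr_v (h : S.Core A t) (h' : S'.Core A' t') :
    Corr h h' (S.F A S.e) (S'.F A' S'.e) :=
  Corr.of_op (h.subset (h.orb_mem_Icc 0)) (h'.subset (h'.orb_mem_Icc 0)) h.orb_mem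
    fun i => S'.op_subset_cl _ (h'.orb_mem i)

lemma corr_one (h : S.Core A t) (h' : S'.Core A' t') : Corr h h' 1 1 :=
  Corr.of_op (s := fun _ => 2) ⟨by linarith [h.t_neg], le_rfl⟩ ⟨by linarith [h'.t_neg], le_rfl⟩
    (fun i => by rw [Function.iterate_fixed (S.F_one A)]; exact S.e_lt)
    (fun i => by rw [Function.iterate_fixed (S'.F_one A')]; exact S'.e_lt.le)

lemma corr_zero (h : S.Core A t) (h' : S'.Core A' t') : Corr h h' 0 0 := by
  refine Corr.of_map ⟨h.t_neg.le, zero_le_one⟩ ⟨h'.t_neg.le, zero_le_one⟩ (fun a ha => ?_)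
    (by simpa using corr_one h h')
  have := S.e_pos; have := S'.e_pos
  fin_cases a <;> simp at ha ⊢ <;> linarith

lemma corr_e (h : S.Core A t) (h' : S'.Core A' t') : Corr h h' S.e S'.e := by
  have := S.e_pos; have := S'.e_pos
  refine Corr.of_map ⟨by linarith [h.t_neg], S.e_lt.le⟩ ⟨by linarith [h'.t_neg], S'.e_lt.le⟩
    (fun a ha => ?_) (corr_v h h')
  fin_cases a <;> simp at ha ⊢ <;> linarith

/-- Monotone maps that respect the first `n + 1` symbols of all itineraries. -/
lemma exists_approx (h : S.Core A t) (h' : S'.Core A' t') (n : ℕ) : ∃ φ : ℝ → ℝ,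
    MonotoneOn φ (Icc t 1) ∧ MapsTo φ (Icc t 1) (Icc t' 1) ∧
    (∀ x y, Corr h h' x y → φ x = y) ∧
    ∀ x ∈ Icc t 1, ∀ s, S.Codes A x s → ∀ i ≤ n, (S'.F A')^[i] (φ x) ∈ S'.cl (s i) := by
  induction n with
  | zero =>
    set D := {x | ∃ y, Corr h h' x y} with hD
    have hex : ∀ x, ∃ y, x ∈ D → Corr h h' x y := fun x => by
      by_cases hx : x ∈ D
      · obtain ⟨y, hy⟩ := hx; exact ⟨y, fun _ => hy⟩
      · exact ⟨0, fun h => absurd h hx⟩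
    choose f hf using hex
    have hfm : MonotoneOn f D := fun x hx x' hx' hxx => (hf x hx).le (hf x' hx') hxx
    obtain ⟨g, hg, hgf⟩ := hfm.exists_monotone_extension
      ⟨t', by rintro _ ⟨x, hx, rfl⟩; exact (hf x hx).right.1⟩
      ⟨1, by rintro _ ⟨x, hx, rfl⟩; exact (hf x hx).right.2⟩
    have hgc : ∀ x y, Corr h h' x y → g x = y := fun x y c => by
      rw [← hgf ⟨y, c⟩]; exact (hf x ⟨y, c⟩).unique c
    have g0 := hgc _ _ (corr_zero h h')
    have ge := hgc _ _ (corr_e h h')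
    have g1 := hgc _ _ (corr_one h h')
    -- The monotone extension may fall below `t'`, hence the maximum; above, it is bounded by its
    -- value `1` at `1`.
    refine ⟨fun x => max t' (g x), fun x _ y _ hxy => max_le_max le_rfl (hg hxy),
      fun x hx => ⟨le_max_left _ _, max_le (by linarith [h'.t_neg]) (g1 ▸ hg hx.2)⟩,
      fun x y c => by dsimp only; rw [hgc x y c]; exact max_eq_right c.right.1, fun x hx s hs i hi => ?_⟩
    obtain rfl : i = 0 := by omega
    have := hs 0
    have ht := h'.t_neg
    have he := S'.e_pos
    simp only [Function.iterate_zero, id] at this ⊢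
    generalize s 0 = a at this
    fin_cases a
    · exact max_le ht.le (g0 ▸ hg this)
    · exact ⟨le_max_of_le_right (g0 ▸ hg this.1), max_le (by linarith) (ge ▸ hg this.2)⟩
    · exact le_max_of_le_right (ge ▸ hg this)
  | succ n ih =>
    obtain ⟨φ, hm, hmaps, hc, hit⟩ := ih
    have ht' := h'.t_neg; have he' := S'.e_pos; have he1' := S'.e_lt
    have he := S.e_pos; have he1 := S.e_lt
    have hv := corr_v h h'
    -- The next approximation lifts `φ` through the two maps lap by lap. The values to be lifted are
    -- in the range of the corresponding lap because `φ` already sends `v` to the other critical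
    -- value (`hlow`).
    have hex : ∀ x, ∃ y, x ∈ Icc t 1 → y ∈ Icc t' 1 ∧ (∀ a, x ∈ S.cl a → y ∈ S'.cl a) ∧
        S'.F A' y = φ (S.F A x) := by
      intro x
      by_cases hx : x ∈ Icc t 1
      swap
      · exact ⟨0, fun h => absurd h hx⟩
      have hFx := h.mapsTo hx
      have hb := hmaps hFx
      have cont := fun a b => (S'.continuous_F A').continuousOn (s := Icc a b)
      have hlow : 0 ≤ x → S'.F A' S'.e ≤ φ (S.F A x) := fun h0 => by
        rw [← hc _ _ hv]
        exact hm hv.left hFx (F_e_le h.pos (by linarith))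
      rcases eq_or_ne x 0 with rfl | hx0
      · exact ⟨0, fun _ => ⟨⟨ht'.le, zero_le_one⟩, fun a => (corr_zero h h').mem_cl,
          by rw [F_zero, F_zero, hc _ _ (corr_one h h')]⟩⟩
      rcases eq_or_ne x S.e with rfl | hxe
      · exact ⟨S'.e, fun _ => ⟨(corr_e h h').right, fun a => (corr_e h h').mem_cl,
          (hc _ _ hv).symm⟩⟩
      obtain ⟨a, ha⟩ := S.exists_mem_cl x
      have hop := S.mem_op_of_mem_cl ha hx0 hxe
      suffices hs : ∃ y ∈ Icc t' 1, y ∈ S'.cl a ∧ S'.F A' y = φ (S.F A x) by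
        obtain ⟨y, h1, h2, h3⟩ := hs
        exact ⟨y, fun _ => ⟨h1, fun b hb => S.eq_of_mem_op_of_mem_cl hop hb ▸ h2, h3⟩⟩
      fin_cases a
      · obtain ⟨y, hy, hy'⟩ := intermediate_value_Icc ht'.le (cont t' 0)
          (by rw [h'.fixed, F_zero]; exact hb)
        exact ⟨y, ⟨hy.1, by linarith [hy.2]⟩, hy.2, hy'⟩
      · obtain ⟨y, hy, hy'⟩ := intermediate_value_Icc' he'.le (cont 0 S'.e)
          (by rw [F_zero]; exact ⟨hlow ha.1, hb.2⟩)
        exact ⟨y, ⟨by linarith [hy.1], by linarith [hy.2]⟩, hy, hy'⟩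
      · obtain ⟨y, hy, hy'⟩ := intermediate_value_Icc he1'.le (cont S'.e 1)
          (by rw [F_one]; exact ⟨hlow (he.le.trans ha), hb.2⟩)
        exact ⟨y, ⟨by linarith [hy.1], hy.2⟩, hy.1, hy'⟩
    choose ψ hψ using hex
    refine ⟨ψ, ?_, fun x hx => (hψ x hx).1, fun x y c => ?_, fun x hx s hs i hi => ?_⟩
    · intro x hx x' hx' hxx
      obtain ⟨-, a1, b1⟩ := hψ x hx
      obtain ⟨-, a2, b2⟩ := hψ x' hx'
      obtain ⟨s, hs⟩ := S.exists_mem_cl x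
      obtain ⟨s', hs'⟩ := S.exists_mem_cl x'
      rcases hxx.eq_or_lt with rfl | hlt
      · exact le_rfl
      rcases lt_trichotomy s s' with h1 | rfl | h1
      · exact S'.le_of_mem_cl_of_lt (a1 _ hs) (a2 _ hs') h1
      · by_contra hno
        push Not at hno
        by_cases hs1 : s = 1
        · subst hs1
          have e1 := strictAntiOn_F h.pos hs hs' hlt
          have e2 := strictAntiOn_F h'.pos (a2 _ hs') (a1 _ hs) hno
          rw [b1, b2] at e2
          exact absurd (hm (h.mapsTo hx') (h.mapsTo hx) e1.le) (not_le.2 e2)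
        · have e1 := strictMonoOn_F h.pos hs1 hs hs' hlt
          have e2 := strictMonoOn_F h'.pos hs1 (a2 _ hs') (a1 _ hs) hno
          rw [b1, b2] at e2
          exact absurd (hm (h.mapsTo hx) (h.mapsTo hx') e1.le) (not_le.2 e2)
      · exact absurd (S.le_of_mem_cl_of_lt hs' hs h1) (not_le.2 hlt)
    · obtain ⟨a, ha⟩ := S.exists_mem_cl x
      obtain ⟨-, h2, h3⟩ := hψ x c.left
      refine injOn_F h'.pos a (h2 a ha) (c.mem_cl ha) ?_
      rw [h3, hc _ _ c.map]
    · obtain ⟨-, h2, h3⟩ := hψ x hx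
      cases i with
      | zero => exact h2 _ (hs 0)
      | succ i =>
        rw [Function.iterate_succ_apply, h3]
        exact hit _ (h.mapsTo hx) _ hs.tail i (by omega)

/-- Points that match the first symbols of all itineraries of `x` form nested compact sets, nonempty
by `exists_approx`. -/
lemma exists_corr (h : S.Core A t) (h' : S'.Core A' t') {x : ℝ} (hx : x ∈ Icc t 1) :
    ∃ y, Corr h h' x y := by
  set W : ℕ → Set ℝ := fun n =>
    ⋂ s ∈ {s | S.Codes A x s}, ⋂ i ∈ Iic n, (S'.F A')^[i] ⁻¹' S'.cl (s i) with hW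
  have hcl : ∀ n, IsClosed (W n) := fun n =>
    isClosed_biInter fun s _ => isClosed_biInter fun i _ =>
      (S'.isClosed_cl (s i)).preimage ((S'.continuous_F A').iterate i)
  have hmem : ∀ n y, y ∈ W n ↔ ∀ s, S.Codes A x s → ∀ i ≤ n, (S'.F A')^[i] y ∈ S'.cl (s i) := by
    intro n y
    simp [hW]
  obtain ⟨y, hy⟩ := IsCompact.nonempty_iInter_of_sequence_nonempty_isCompact_isClosed
    (fun n => Icc t' 1 ∩ W n)
    (fun n y hy => ⟨hy.1, (hmem _ _).2 fun s hs i hi =>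
      (hmem _ _).1 hy.2 s hs i (hi.trans (by omega))⟩)
    (fun n => by
      obtain ⟨φ, -, h1, -, h2⟩ := exists_approx h h' n
      exact ⟨φ x, h1 hx, (hmem _ _).2 (h2 x hx)⟩)
    (isCompact_Icc.inter_right (hcl 0)) (fun n => isClosed_Icc.inter (hcl n))
  rw [mem_iInter] at hy
  exact ⟨y, hx, (hy 0).1, fun s hs i => (hmem _ _).1 (hy i).2 s hs i le_rfl⟩

/-- Two maps with the same kneading sequence are conjugate by an increasing bijection. -/
theorem exists_conjugacy (h : S.Core A t) (h' : S'.Core A' t') :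
    ∃ φ : Icc t 1 ≃o Icc t' 1, ∀ x y : Icc t 1, (y : ℝ) = S.F A x → (φ y : ℝ) = S'.F A' (φ x) := by
  choose f hf using fun x : Icc t 1 => exists_corr h h' x.2
  choose g hg using fun y : Icc t' 1 => exists_corr h' h y.2
  refine ⟨⟨⟨fun x => ⟨f x, (hf x).right⟩, fun y => ⟨g y, (hg y).right⟩, fun x => ?_, fun y => ?_⟩,
    fun {x x'} => ⟨fun hle => ?_, fun hle => (hf x).le (hf x') hle⟩⟩, fun x y hy => ?_⟩
  · obtain ⟨s, hs⟩ := S.exists_codes A x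
    exact Subtype.ext (h.eq_of_itinerary (hg _).right x.2 ((hg _).codes s ((hf x).codes s hs)) hs)
  · obtain ⟨s, hs⟩ := S'.exists_codes A' y
    exact Subtype.ext (h'.eq_of_itinerary (hf _).right y.2 ((hf _).codes s ((hg y).codes s hs)) hs)
  · have hgf : ∀ x : Icc t 1, g ⟨f x, (hf x).right⟩ = x := fun x => by
      obtain ⟨s, hs⟩ := S.exists_codes A x
      exact h.eq_of_itinerary (hg _).right x.2 ((hg _).codes s ((hf x).codes s hs)) hs
    have := (hg ⟨f x, (hf x).right⟩).le (hg ⟨f x', (hf x').right⟩) hle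
    rwa [hgf, hgf] at this
  · have c := (hf x).map
    rw [← hy] at c
    exact (hf y).unique c

end Shape
end IntervalDynamics

namespace IntervalDynamics
namespace Shape

/-! ### The cubic family -/

/-- The cubic shape. -/
noncomputable def cubic : Shape where
  H u := (u ^ 3 - u ^ 2) / 3
  e := 2 / 3
  k := 1
  k_odd := odd_one
  e_pos := by norm_num
  e_lt := by norm_num
  hasDeriv u := by
    have := (((hasDerivAt_id u).pow 3).sub ((hasDerivAt_id u).pow 2)).div_const 3
    refine this.congr_deriv ?_
    simp
    ring
  H_zero := by norm_num
  H_one := by norm_num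

variable {A : ℝ}

lemma cubic_F (A u : ℝ) : cubic.F A u = 1 - A / 3 * (u ^ 2 * (1 - u)) := by
  simp only [F, cubic]; ring

lemma cubic_F' (A u : ℝ) : cubic.F' A u = A * (u * (u - 2 / 3)) := by
  simp only [F', cubic, pow_one]

lemma cubic_v (A : ℝ) : cubic.F A cubic.e = 1 - 4 * A / 81 := by
  rw [cubic_F]; simp only [cubic]; ring

/-- The parameter is close to the Chebyshev value 27, where `v = -1/3`. The symbols `0 1 2 2` force
it: the point at time 3 exceeds `2/3`, so the one at time 2 is near `1`, so the one at time 1 is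
near `0`, which makes `(-v) * (1 - v)` large. -/
lemma cubic_bounds (h : cubic.Kneads A) :
    cubic.F A cubic.e ≤ -283 / 1000 ∧ -1 / 3 < cubic.F A cubic.e ∧ A < 27 := by
  have hlt : -1 / 3 < cubic.F A cubic.e := by have := h.lt; simp only [cubic] at *; linarith
  have hv := cubic_v A
  have hA : A < 27 := by linarith
  have h0 := h.v_neg
  refine ⟨?_, hlt, hA⟩
  have m1 := h.orb_mem 1
  have m2 := h.orb_mem 2
  have m3 := h.orb_mem 3
  rw [K_one] at m1
  rw [K_init (n := 2) (by norm_num) (by norm_num)] at m2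
  rw [K_init (n := 3) (by norm_num) (by norm_num)] at m3
  have e1 : cubic.orb A 1 = 1 - A / 3 * ((cubic.F A cubic.e) ^ 2 * (1 - cubic.F A cubic.e)) := by
    rw [← cubic_F]; rfl
  have e2 := cubic_F A (cubic.orb A 1)
  have e3 := cubic_F A (cubic.orb A 2)
  rw [← orb_succ] at e2 e3
  simp only [op_one, op_two, mem_Ioo, mem_Ioi, show cubic.e = 2 / 3 from rfl] at m1 m2 m3
  simp only [Nat.reduceAdd] at e2 e3
  generalize cubic.F A cubic.e = v at *
  generalize cubic.orb A 1 = x at *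
  generalize cubic.orb A 2 = y at *
  generalize cubic.orb A 3 = z at *
  have hA2 : 27 / 4 < A / 3 := by linarith
  have y1 : y < 1 := by
    have : 0 < x ^ 2 * (1 - x) := mul_pos (pow_pos m1.1 2) (by linarith)
    nlinarith
  have y2 : y ^ 2 * (1 - y) < 4 / 81 := by
    have : 0 ≤ y ^ 2 * (1 - y) := mul_nonneg (sq_nonneg _) (by linarith)
    nlinarith
  have y3 : 1 - y ≤ 1 / 9 := by nlinarith
  have y4 : 1 - y ≤ 63 / 1000 := by nlinarith
  have x2 : x ^ 2 * (1 - x) < 94 / 10000 := by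
    have : 0 ≤ x ^ 2 * (1 - x) := mul_nonneg (sq_nonneg _) (by linarith [m1.2])
    nlinarith
  have x3 : x ≤ 17 / 100 := by
    by_contra hc
    push Not at hc
    nlinarith [m1.2, mul_pos (sub_pos.2 hc) (sub_pos.2 m1.2)]
  have x4 : x ≤ 108 / 1000 := by
    by_contra hc
    push Not at hc
    nlinarith
  have ha : A / 3 = 27 / 4 * (1 - v) := by linarith
  rw [ha] at e1
  by_contra hc
  push Not at hc
  have w1 : (-v) * (1 - v) < 3631 / 10000 := by nlinarith
  have w2 : 0 ≤ (-v) * (1 - v) := by nlinarith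
  have w3 : ((-v) * (1 - v)) ^ 2 ≤ (3631 / 10000) ^ 2 := pow_le_pow_left₀ w2 w1.le 2
  nlinarith

/-- The derivative along the orbit telescopes, up to the factors `(F x - v) / (x + 1 / 3)`. -/
lemma cubic_identity (A x : ℝ) :
    cubic.F' A x ^ 2 * ((1 - x) * (x + 1 / 3)) =
      9 * ((1 - cubic.F A x) * (cubic.F A x - cubic.F A cubic.e)) := by
  rw [cubic_F', cubic_v, cubic_F]; ring

lemma cubic_lipschitz (h : cubic.Kneads A) {u w : ℝ} (hu : u ∈ Icc (cubic.F A cubic.e) 1)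
    (hw : w ∈ Icc (cubic.F A cubic.e) 1) : |cubic.F A u - cubic.F A w| ≤ 9 * |u - w| := by
  obtain ⟨-, h1, h2⟩ := cubic_bounds h
  have hA := h.pos
  have e : cubic.F A u - cubic.F A w = A / 3 * (u ^ 2 + u * w + w ^ 2 - u - w) * (u - w) := by
    rw [cubic_F, cubic_F]; ring
  rw [e, abs_mul]
  refine mul_le_mul_of_nonneg_right ?_ (abs_nonneg _)
  have hu1 := hu.1; have hu2 := hu.2; have hw1 := hw.1; have hw2 := hw.2
  have q1 : u ^ 2 + u * w + w ^ 2 - u - w ≤ 1 := by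
    nlinarith [mul_nonneg (sub_nonneg.2 hu2) (by linarith : 0 ≤ u + 1 / 3),
      mul_nonneg (sub_nonneg.2 hw2) (by linarith : 0 ≤ w + 1 / 3),
      mul_nonneg (sub_nonneg.2 hu2) (by linarith : 0 ≤ w + 1 / 3),
      mul_nonneg (sub_nonneg.2 hw2) (by linarith : 0 ≤ u + 1 / 3)]
  have q2 : -1 ≤ u ^ 2 + u * w + w ^ 2 - u - w := by
    nlinarith [sq_nonneg (u + w - 2 / 3), sq_nonneg (u - w)]
  rw [abs_le]
  constructor <;> nlinarith

lemma cubic_iterate_lipschitz (h : cubic.Kneads A) (m i j : ℕ) :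
    |cubic.orb A (i + m) - cubic.orb A (j + m)| ≤ 9 ^ m * |cubic.orb A i - cubic.orb A j| := by
  induction m with
  | zero => simp
  | succ m ih =>
    rw [← add_assoc, ← add_assoc, orb_succ, orb_succ, pow_succ]
    have := cubic_lipschitz h (h.orb_mem_Icc (i + m)) (h.orb_mem_Icc (j + m))
    nlinarith

/-- This bounds from below the factors lost in the telescoping identity. They are small only if the
orbit returns close to `v`; then it shadows the initial orbit for `c` steps until two points in the
outer laps are at least `2/3` apart, and the Lipschitz constant 9 bounds the return distance from
below. -/
lemma cubic_ratio (h : cubic.Kneads A) {i : ℕ} (hi : 1 ≤ i) :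
    2 / 3 * (cubic.orb A i + 1 / 3) ≤
      9 ^ costs i * (cubic.orb A i - cubic.F A cubic.e) := by
  obtain ⟨h1, h2, h3⟩ := cubic_bounds h
  have hv := cubic_v A
  have hm := h.orb_mem i
  have hr := (h.orb_mem_Icc i).1
  have p9 : (1 : ℝ) ≤ 9 ^ costs i := one_le_pow₀ (by norm_num)
  -- The threshold is the solution of `x - v ≥ 2/3 * (x + 1/3)`; with `v ≤ -283/1000` it is below
  -- `-182/1000`.
  have easy : 3 * cubic.F A cubic.e + 2 / 3 ≤ cubic.orb A i →
      2 / 3 * (cubic.orb A i + 1 / 3) ≤ 9 ^ costs i * (cubic.orb A i - cubic.F A cubic.e) := by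
    intro hx
    nlinarith
  obtain ⟨c, hD, hc⟩ := exists_differs_cost hi
  rcases hD.2 with ⟨-, hK⟩ | ⟨-, hK, hK1⟩ | ⟨hc2, hK, hK1, -, -⟩
  · apply easy
    have : 0 ≤ cubic.orb A i := by
      rcases (by omega : K i = 1 ∨ K i = 2) with h4 | h4 <;> rw [h4] at hm
      · exact hm.1.le
      · exact cubic.e_pos.le.trans hm.le
    linarith
  · apply easy
    have hm1 := h.orb_mem (i + 1)
    rw [hK1, orb_succ, cubic_F] at hm1
    rw [hK] at hm
    simp only [op_zero, op_two, mem_Iio, mem_Ioi, show cubic.e = 2 / 3 from rfl] at hm hm1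
    generalize cubic.F A cubic.e = v at *
    generalize cubic.orb A i = x at *
    by_contra hlt
    push Not at hlt
    have hx : x < -1823 / 10000 := by linarith
    have hx2 : (1823 / 10000) ^ 2 * (11823 / 10000) ≤ x ^ 2 * (1 - x) := by
      have : (1823 / 10000) ^ 2 ≤ x ^ 2 := by nlinarith
      nlinarith
    have ha : 866 / 100 ≤ A / 3 := by linarith
    nlinarith
  · have hK0 : K i = 0 := by have := hD.1 0 (by omega); simpa [K_zero] using this
    rw [hK0] at hm
    have hl := cubic_iterate_lipschitz h c i 0
    rw [zero_add] at hl
    have m1 := h.orb_mem (i + c)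
    have m2 := h.orb_mem c
    rw [hK] at m1
    rw [hK1] at m2
    simp only [op_zero, op_two, mem_Iio, mem_Ioi, show cubic.e = 2 / 3 from rfl] at hm m1 m2
    have l1 := neg_abs_le (cubic.orb A (i + c) - cubic.orb A c)
    rw [orb_zero, abs_of_nonneg (a := cubic.orb A i - _) (by linarith)] at hl
    have hp : (9 : ℝ) ^ c ≤ 9 ^ costs i := pow_le_pow_right₀ (by norm_num) (by omega)
    have : (9 : ℝ) ^ c * (cubic.orb A i - cubic.F A cubic.e) ≤
        9 ^ costs i * (cubic.orb A i - cubic.F A cubic.e) :=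
      mul_le_mul_of_nonneg_right hp (by linarith)
    linarith

lemma cubic_top (h : cubic.Kneads A) (n m : ℕ) :
    1 - cubic.orb A (n + m) ≤ 9 ^ m * (1 - cubic.orb A n) := by
  obtain ⟨-, h1, h2⟩ := cubic_bounds h
  induction m with
  | zero => simp
  | succ m ih =>
    have hr := h.orb_mem_Icc (n + m)
    have hA := h.pos
    rw [← add_assoc, orb_succ, cubic_F, pow_succ (9 : ℝ)]
    generalize cubic.orb A (n + m) = x at *
    have hx : x ^ 2 ≤ 1 := by nlinarith [hr.1, hr.2]
    have h3 : A / 3 * (x ^ 2 * (1 - x)) ≤ 9 * (1 * (1 - x)) := by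
      have := hr.2
      gcongr
      nlinarith
    nlinarith

/-! ### Growth of the derivative along the cubic critical orbit -/

/-- The product of the derivatives along the first `n` points of the critical orbit. -/
noncomputable def mult (S : Shape) (A : ℝ) (n : ℕ) : ℝ := ∏ i ∈ Finset.range n, S.F' A (S.orb A i)

/-- Product of `cubic_identity` along the orbit: each step after the first gives the factor 9,
reduced by at most `2/3 * 9 ^ (-costs i)` through `cubic_ratio`. -/
lemma cubic_mult_sq (h : cubic.Kneads A) (n : ℕ) :
    9 ^ (n + 1) * (2 / 3) ^ n * ((1 - cubic.orb A (n + 1)) *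
      (cubic.orb A (n + 1) - cubic.F A cubic.e)) ≤
    9 ^ (∑ i ∈ Finset.range (n + 1), costs i) *
      (cubic.mult A (n + 1) ^ 2 * ((1 - cubic.F A cubic.e) * (cubic.F A cubic.e + 1 / 3))) := by
  obtain ⟨-, hv, -⟩ := cubic_bounds h
  induction n with
  | zero =>
    have := cubic_identity A (cubic.F A cubic.e)
    simp only [mult, zero_add, Finset.range_one, Finset.sum_singleton, Finset.prod_singleton,
      costs_zero, orb_zero, pow_zero, one_mul, pow_one, mul_one]
    rw [this]; exact le_rfl
  | succ n ih =>
    have id := cubic_identity A (cubic.orb A (n + 1))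
    have hr := cubic_ratio h (show 1 ≤ n + 1 by omega)
    have hm := h.orb_mem_Icc (n + 1)
    have hm' := h.orb_mem_Icc (n + 2)
    have hlt : cubic.orb A (n + 1) < 1 := by
      refine lt_of_le_of_ne hm.2 fun h1 => ?_
      obtain ⟨m, hm, hKm⟩ := exists_K_ne_two (n + 1)
      have h3 := h.orb_mem m
      rw [show m = (m - (n + 1)) + (n + 1) by omega, ← iterate_orb, h1,
          Function.iterate_fixed (cubic.F_one A), show (m - (n + 1)) + (n + 1) = m by omega] at h3
      exact hKm (cubic.eq_of_mem_op_of_mem_cl h3 (by simpa using cubic.e_lt.le))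
    rw [← orb_succ] at id
    rw [Finset.sum_range_succ, mult, Finset.prod_range_succ, ← mult, mul_pow,
      pow_add (9 : ℝ) (∑ i ∈ Finset.range (n + 1), costs i)]
    set D := cubic.mult A (n + 1) ^ 2 with hD
    set v := cubic.F A cubic.e
    set x := cubic.orb A (n + 1)
    set y := cubic.orb A (n + 1 + 1)
    set f := cubic.F' A x ^ 2
    set P : ℝ := 9 ^ (∑ i ∈ Finset.range (n + 1), costs i)
    set c : ℝ := 9 ^ costs (n + 1)
    have hc : 0 < c := by positivity
    have hP : 0 < P := by positivity
    have hq : 0 < (1 - x) * (x + 1 / 3) := mul_pos (by linarith) (by linarith [hm.1])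
    refine le_of_mul_le_mul_right ?_ hq
    have hf : 0 ≤ f := sq_nonneg _
    have e0 : 0 ≤ (1 - y) * (y - v) := mul_nonneg (by linarith [hm'.2]) (by linarith [hm'.1])
    calc 9 ^ (n + 1 + 1) * (2 / 3) ^ (n + 1) * ((1 - y) * (y - v)) * ((1 - x) * (x + 1 / 3))
        = 9 ^ (n + 1) * (2 / 3) ^ n * (9 * ((1 - y) * (y - v))) * (1 - x) *
            (2 / 3 * (x + 1 / 3)) := by ring
      _ ≤ 9 ^ (n + 1) * (2 / 3) ^ n * (9 * ((1 - y) * (y - v))) * (1 - x) * (c * (x - v)) := by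
          refine mul_le_mul_of_nonneg_left hr (mul_nonneg (mul_nonneg (by positivity) ?_) ?_)
          · linarith
          · linarith
      _ = (9 ^ (n + 1) * (2 / 3) ^ n * ((1 - x) * (x - v))) * (c * (9 * ((1 - y) * (y - v)))) := by
          ring
      _ ≤ (P * (D * ((1 - v) * (v + 1 / 3)))) * (c * (9 * ((1 - y) * (y - v)))) :=
          mul_le_mul_of_nonneg_right ih (mul_nonneg hc.le (by linarith))
      _ = P * c * (D * f * ((1 - v) * (v + 1 / 3))) * ((1 - x) * (x + 1 / 3)) := by
          rw [← id]; ring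

/-- At time `n`, `1 - x` is at least `9 ^ (-m) / 3`, where `m` is the waiting time for a symbol
other than `2`, about `3 n / 4` at most. With the costs, at most `n / 20`, the exponent of 9 lost is
`4 n / 5`, against a gain of `6 ^ n`; the fifth power leaves `6 ^ 5 / 9 ^ 4 = 32 / 27`. -/
lemma cubic_mult_growth (h : cubic.Kneads A) :
    ∃ C lam : ℝ, 0 < C ∧ 1 < lam ∧ ∀ n, C * lam ^ n < |cubic.mult A n| := by
  obtain ⟨-, hv, -⟩ := cubic_bounds h
  have hv0 := h.v_neg
  set v := cubic.F A cubic.e with hvdef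
  have key : ∀ n, 1 ≤ n → (32 / 27 : ℝ) ^ n ≤ 9 ^ 26 * 6 ^ 5 * (cubic.mult A n) ^ 10 := by
    intro n hn
    obtain ⟨n, rfl⟩ : ∃ j, n = j + 1 := ⟨n - 1, by omega⟩
    have h1 := cubic_mult_sq h n
    have h2 := cubic_ratio h (show 1 ≤ n + 1 by omega)
    obtain ⟨m, hm, hK⟩ := exists_ne_two (n + 1)
    have h3 := cubic_top h (n + 1) m
    have hs := sum_costs_le (n + 2)
    rw [Finset.sum_range_succ] at hs
    have h4 : cubic.orb A (n + 1 + m) < 2 / 3 := by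
      have := h.orb_mem (n + 1 + m)
      rcases (by omega : K (n + 1 + m) = 0 ∨ K (n + 1 + m) = 1) with h5 | h5 <;> rw [h5] at this
      · simp at this; linarith
      · exact this.2
    have hx := h.orb_mem_Icc (n + 1)
    rw [← hvdef] at h1 h2 hx
    set D := cubic.mult A (n + 1)
    set x := cubic.orb A (n + 1)
    set s := ∑ i ∈ Finset.range (n + 1), costs i
    set c := costs (n + 1)
    have h5 : (9 : ℝ) ^ (n + 1) * (2 / 3) ^ (n + 1) ≤ 9 ^ (s + c + m) * (6 * D ^ 2) := by
      have hp : 0 < v + 1 / 3 := by linarith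
      refine le_of_mul_le_mul_right ?_ hp
      have t1 : 2 / 3 * (v + 1 / 3) ≤ 9 ^ c * (x - v) :=
        le_trans (by linarith [hx.1]) h2
      have t2 : 1 / 3 ≤ 9 ^ m * (1 - x) := by linarith
      have t3 : (1 - v) ≤ 2 := by linarith
      calc (9 : ℝ) ^ (n + 1) * (2 / 3) ^ (n + 1) * (v + 1 / 3)
          = 3 * (9 ^ (n + 1) * (2 / 3) ^ n) * (1 / 3 * (2 / 3 * (v + 1 / 3))) := by ring
        _ ≤ 3 * (9 ^ (n + 1) * (2 / 3) ^ n) * ((9 ^ m * (1 - x)) * (9 ^ c * (x - v))) := by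
            refine mul_le_mul_of_nonneg_left (mul_le_mul t2 t1 (by positivity) ?_) (by positivity)
            exact le_trans (by norm_num) t2
        _ = 3 * 9 ^ m * 9 ^ c * (9 ^ (n + 1) * (2 / 3) ^ n * ((1 - x) * (x - v))) := by ring
        _ ≤ 3 * 9 ^ m * 9 ^ c * (9 ^ s * (D ^ 2 * ((1 - v) * (v + 1 / 3)))) :=
            mul_le_mul_of_nonneg_left h1 (by positivity)
        _ ≤ 3 * 9 ^ m * 9 ^ c * (9 ^ s * (D ^ 2 * (2 * (v + 1 / 3)))) := by gcongr
        _ = _ := by rw [pow_add, pow_add]; ring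
    have h6 := pow_le_pow_left₀ (by positivity) h5 5
    -- Here `s + c ≤ (n + 2) / 20` and `m ≤ (3 * (n + 1) + 20) / 4`; five times their sum is at most
    -- `4 * (n + 1) + 26`.
    have h8 : ((9 : ℝ) ^ (s + c + m)) ^ 5 ≤ 9 ^ (4 * (n + 1) + 26) := by
      rw [← pow_mul]
      exact pow_le_pow_right₀ (by norm_num) (by omega)
    have hp : (0 : ℝ) < 9 ^ (4 * (n + 1)) := by positivity
    refine le_of_mul_le_mul_left ?_ hp
    calc (9 : ℝ) ^ (4 * (n + 1)) * (32 / 27) ^ (n + 1)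
        = (9 ^ (n + 1) * (2 / 3) ^ (n + 1)) ^ 5 := by
          rw [pow_mul, ← mul_pow, ← mul_pow, ← pow_mul, mul_comm (n + 1) 5, pow_mul]
          norm_num
      _ ≤ _ := h6
      _ = (9 ^ (s + c + m)) ^ 5 * (6 ^ 5 * D ^ 10) := by ring
      _ ≤ 9 ^ (4 * (n + 1) + 26) * (6 ^ 5 * D ^ 10) := by gcongr
      _ = _ := by rw [pow_add]; ring
  obtain ⟨C0, hC0, hC1, hC2⟩ : ∃ C0 : ℝ, 0 < C0 ∧ C0 ≤ 1 / 2 ∧ 2 * C0 * (9 ^ 26 * 6 ^ 5) = 1 :=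
    ⟨1 / (2 * 9 ^ 26 * 6 ^ 5), by positivity, by norm_num, by norm_num⟩
  refine ⟨C0, 101 / 100, hC0, by norm_num, fun n => ?_⟩
  rcases Nat.eq_zero_or_pos n with rfl | hn
  · simp [mult]; linarith
  refine lt_of_pow_lt_pow_left₀ 10 (abs_nonneg _) ?_
  rw [(by decide : Even 10).pow_abs]
  have h1 := key n hn
  have h2 : ((101 / 100 : ℝ) ^ n) ^ 10 ≤ (32 / 27) ^ n := by
    rw [← pow_mul, mul_comm, pow_mul]
    exact pow_le_pow_left₀ (by positivity) (by norm_num) n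
  have h3 : C0 ^ 10 ≤ C0 := pow_le_of_le_one hC0.le (by linarith) (by norm_num)
  have h4 : (0 : ℝ) < (32 / 27) ^ n := by positivity
  calc (C0 * (101 / 100) ^ n) ^ 10 = C0 ^ 10 * ((101 / 100) ^ n) ^ 10 := mul_pow _ _ _
    _ ≤ C0 * (32 / 27) ^ n := by gcongr
    _ < 2 * C0 * (32 / 27) ^ n := by nlinarith
    _ ≤ 2 * C0 * (9 ^ 26 * 6 ^ 5 * (cubic.mult A n) ^ 10) := by gcongr
    _ = _ := by rw [← mul_assoc, hC2, one_mul]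

end Shape
end IntervalDynamics

namespace IntervalDynamics
namespace Shape

/-! ### The family of degree seven -/

/-- The equation is `H 1 = 0` multiplied by `-140`. -/
lemma exists_septic_turning :
    ∃ e ∈ Ioo (7449 / 10000 : ℝ) (745 / 1000), 35 * e ^ 3 - 84 * e ^ 2 + 70 * e - 20 = 0 := by
  refine intermediate_value_Ioo (f := fun e : ℝ => 35 * e ^ 3 - 84 * e ^ 2 + 70 * e - 20)
    (by norm_num) (by fun_prop) ?_
  constructor <;> norm_num

/-- The right turning point of the septic family. -/
noncomputable def septicE : ℝ := exists_septic_turning.choose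

lemma septicE_mem : septicE ∈ Ioo (7449 / 10000 : ℝ) (745 / 1000) :=
  exists_septic_turning.choose_spec.1

lemma septicE_root : 35 * septicE ^ 3 - 84 * septicE ^ 2 + 70 * septicE - 20 = 0 :=
  exists_septic_turning.choose_spec.2

/-- The shape of degree seven. -/
noncomputable def septic : Shape where
  H u := u ^ 7 / 7 - septicE * u ^ 6 / 2 + 3 * septicE ^ 2 * u ^ 5 / 5 - septicE ^ 3 * u ^ 4 / 4
  e := septicE
  k := 3
  k_odd := by decide
  e_pos := by linarith [septicE_mem.1]
  e_lt := by linarith [septicE_mem.2]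
  hasDeriv u := by
    have := (((((hasDerivAt_id u).pow 7).div_const 7).sub
      ((((hasDerivAt_id u).pow 6).const_mul septicE).div_const 2)).add
      ((((hasDerivAt_id u).pow 5).const_mul (3 * septicE ^ 2)).div_const 5)).sub
      ((((hasDerivAt_id u).pow 4).const_mul (septicE ^ 3)).div_const 4)
    refine this.congr_deriv ?_
    simp
    ring
  H_zero := by norm_num
  H_one := by linarith [septicE_root]

/-- The quadratic factor of the septic shape. -/
noncomputable def septicQ (u : ℝ) : ℝ := u ^ 2 + (1 - 7 / 2 * septicE) * u + 7 / 4 * septicE ^ 3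

lemma septic_one_sub (A u : ℝ) :
    1 - septic.F A u = A / 7 * (u ^ 4 * (1 - u) * septicQ u) := by
  simp only [F, septic, septicQ]
  linear_combination (A / 7 * u ^ 5 / 20) * septicE_root

lemma septic_sub_v (A u : ℝ) : septic.F A u - septic.F A septic.e =
    A / 7 * ((u - septic.e) ^ 4 * (u + 1 - septic.e) * septicQ (septic.e - u)) := by
  have h := septic_one_sub A (septic.e - u)
  have h2 := septic.H_sub u
  have e1 : septic.F A u - septic.F A septic.e = 1 - septic.F A (septic.e - u) := by
    simp only [F]; rw [h2]; ring
  rw [e1, h]; ring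

variable {A : ℝ}

lemma septicE_pow : 4133 / 10000 ≤ septicE ^ 3 ∧ septicE ^ 3 ≤ 4135 / 10000 := by
  have h1 := septicE_mem.1; have h2 := septicE_mem.2
  constructor
  · calc (4133 / 10000 : ℝ) ≤ (7449 / 10000) ^ 3 := by norm_num
      _ ≤ septicE ^ 3 := by gcongr
  · calc septicE ^ 3 ≤ (745 / 1000 : ℝ) ^ 3 := by gcongr
      _ ≤ 4135 / 10000 := by norm_num

/-- With `z = x - e / 2` the two factors are `z ^ 2 ± β z + w`, where `β = 1 - 5/2 * e`, so their
product is quadratic in `z ^ 2` and completing the square gives its lower bound. -/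
lemma septicQ_mul_ge (x : ℝ) : 573 / 10000 ≤ septicQ x * septicQ (septicE - x) := by
  obtain ⟨p1, p2⟩ := septicE_pow
  have h1 := septicE_mem.1; have h2 := septicE_mem.2
  set e := septicE with he
  have hw : 2632 / 10000 ≤ e / 2 - 3 / 2 * e ^ 2 + 7 / 4 * e ^ 3 := by nlinarith
  have hb : 7434 / 10000 ≤ (1 - 5 / 2 * e) ^ 2 := by nlinarith
  have hb' : (1 - 5 / 2 * e) ^ 2 ≤ 744 / 1000 := by nlinarith
  have id : septicQ x * septicQ (e - x) =
      (1 - 5 / 2 * e) ^ 2 * (e / 2 - 3 / 2 * e ^ 2 + 7 / 4 * e ^ 3 - (1 - 5 / 2 * e) ^ 2 / 4) +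
      (e / 2 - 3 / 2 * e ^ 2 + 7 / 4 * e ^ 3 + (x - e / 2) ^ 2 - (1 - 5 / 2 * e) ^ 2 / 2) ^ 2 := by
    simp only [septicQ, ← he]; ring
  rw [id]
  have hs := sq_nonneg
    (e / 2 - 3 / 2 * e ^ 2 + 7 / 4 * e ^ 3 + (x - e / 2) ^ 2 - (1 - 5 / 2 * e) ^ 2 / 2)
  generalize e / 2 - 3 / 2 * e ^ 2 + 7 / 4 * e ^ 3 = w at *
  generalize (1 - 5 / 2 * e) ^ 2 = b at *
  have : 7434 / 10000 * (772 / 10000) ≤ b * (w - b / 4) :=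
    mul_le_mul hb (by linarith) (by norm_num) (by linarith)
  linarith

/-- The second symbol `1` puts `F v` below `e`, which fails if `v` is too close to `0`. So `v ≤
-1/10`, and `1 - v` is `A / 7` times a number known from `e`. -/
lemma septic_bounds (h : septic.Kneads A) : 171 ≤ A / 7 := by
  obtain ⟨p1, p2⟩ := septicE_pow
  have h1 := septicE_mem.1; have h2 := septicE_mem.2
  have hA := h.pos
  have hv := septic_one_sub A septic.e
  have hv0 := h.v_neg
  have m1 := h.orb_mem 1
  rw [K_one] at m1
  have e1 : 1 - septic.orb A 1 = _ := septic_one_sub A (septic.F A septic.e)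
  have m2 := m1.2
  rw [show septic.e = septicE from rfl] at *
  generalize septic.F A septicE = v at *
  generalize septic.orb A 1 = y at *
  have hq1 : septicQ septicE ≤ 815 / 10000 := by simp only [septicQ]; nlinarith
  have hq2 : 806 / 10000 ≤ septicQ septicE := by simp only [septicQ]; nlinarith
  have e41 : septicE ^ 4 ≤ 3081 / 10000 := by
    calc septicE ^ 4 ≤ (745 / 1000 : ℝ) ^ 4 := by gcongr
      _ ≤ _ := by norm_num
  have e42 : 3078 / 10000 ≤ septicE ^ 4 := by
    calc (3078 / 10000 : ℝ) ≤ (7449 / 10000) ^ 4 := by norm_num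
      _ ≤ _ := by gcongr
  have n1 : septicE ^ 4 * (1 - septicE) * septicQ septicE ≤
      3081 / 10000 * (2551 / 10000) * (815 / 10000) := by
    have : 0 ≤ 1 - septicE := by linarith
    gcongr
    linarith
  have n2 : 3078 / 10000 * (255 / 1000) * (806 / 10000) ≤
      septicE ^ 4 * (1 - septicE) * septicQ septicE := by
    have : 0 ≤ 1 - septicE := by linarith
    gcongr
    linarith
  have hvle : v ≤ -1 / 10 := by
    by_contra hc
    push Not at hc
    have hk : A / 7 ≤ 174 := by
      by_contra hk
      push Not at hk
      nlinarith
    have hx2 : v ^ 2 ≤ 1 / 100 := by nlinarith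
    have hx4 : v ^ 4 ≤ 1 / 10000 := by
      have : v ^ 4 = v ^ 2 * v ^ 2 := by ring
      rw [this]; nlinarith [sq_nonneg v]
    have hqv : septicQ v ≤ 9 / 10 := by simp only [septicQ]; nlinarith
    have hqv0 : 0 ≤ septicQ v := by simp only [septicQ]; nlinarith
    have : A / 7 * (v ^ 4 * (1 - v) * septicQ v) ≤ 174 * (1 / 10000 * (11 / 10) * (9 / 10)) := by
      have : 0 ≤ 1 - v := by linarith
      gcongr
      linarith
    linarith
  by_contra hc
  push Not at hc
  nlinarith

/-- The derivative along the orbit telescopes, up to a factor less than `500`. -/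
lemma septic_step (h : septic.Kneads A) {x : ℝ} (hx : x ∈ Icc (septic.F A septic.e) 1) :
    septic.F' A x ^ 4 * ((1 - x) * (x + 1 - septic.e)) ^ 3 ≤
      500 * ((1 - septic.F A x) * (septic.F A x + 1 - septic.e)) ^ 3 := by
  have hk := septic_bounds h
  have hlt := h.lt
  have hFx := h.mapsTo_v hx
  have i1 := septic_one_sub A x
  have i2 := septic_sub_v A x
  have hq := septicQ_mul_ge x
  rw [show septicE = septic.e from rfl] at hq
  have X0 : 0 ≤ septic.F' A x ^ 4 * ((1 - x) * (x + 1 - septic.e)) ^ 3 :=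
    mul_nonneg (by positivity)
      (pow_nonneg (mul_nonneg (by linarith [hx.2]) (by linarith [hx.1])) 3)
  have id : septic.F' A x ^ 4 * ((1 - x) * (x + 1 - septic.e)) ^ 3 *
      ((A / 7) ^ 2 * (septicQ x * septicQ (septic.e - x)) ^ 3) =
      7 ^ 4 * ((1 - septic.F A x) * (septic.F A x - septic.F A septic.e)) ^ 3 := by
    rw [i1, i2, F']
    simp only [show septic.k = 3 from rfl]
    ring
  -- The numerator is the `7 ^ 4` of the identity above, so the remaining factor per step is at most
  -- 500.
  have hB : 2401 / 500 ≤ (A / 7) ^ 2 * (septicQ x * septicQ (septic.e - x)) ^ 3 := by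
    calc (2401 / 500 : ℝ) ≤ 171 ^ 2 * (573 / 10000) ^ 3 := by norm_num
      _ ≤ _ := by gcongr
  have hle : ((1 - septic.F A x) * (septic.F A x - septic.F A septic.e)) ^ 3 ≤
      ((1 - septic.F A x) * (septic.F A x + 1 - septic.e)) ^ 3 := by
    have a1 : 0 ≤ 1 - septic.F A x := by linarith [hFx.2]
    have a2 : 0 ≤ septic.F A x - septic.F A septic.e := by linarith [hFx.1]
    gcongr ((1 - septic.F A x) * ?_) ^ 3
    linarith
  have := mul_le_mul_of_nonneg_left hB X0
  rw [id] at this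
  linarith

/-- A point of the right lap whose image is again there must be at least `98/100`, and on that range
`(1 - F x) / (1 - x)` is at least 16. -/
lemma septic_top (h : septic.Kneads A) {x : ℝ} (hx : septic.e ≤ x) (hx1 : x ≤ 1)
    (hFx : septic.e ≤ septic.F A x) : 16 * (1 - x) ≤ 1 - septic.F A x := by
  obtain ⟨p1, p2⟩ := septicE_pow
  have h1 := septicE_mem.1; have h2 := septicE_mem.2
  have hk := septic_bounds h
  have hee : septic.e = septicE := rfl
  have hQ : ∀ u : ℝ, 98 / 100 ≤ u → 1083 / 10000 ≤ septicQ u := by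
    intro u hu
    simp only [septicQ]
    nlinarith
  have hx98 : 98 / 100 ≤ x := by
    by_contra hc
    push Not at hc
    have hm := strictMonoOn_F_right (S := septic) h.pos hx
      (mem_Ici.2 (hx.trans hc.le)) hc
    have i1 := septic_one_sub A (98 / 100)
    have : 171 * ((98 / 100) ^ 4 * (1 - 98 / 100) * (1083 / 10000)) ≤
        A / 7 * ((98 / 100) ^ 4 * (1 - 98 / 100) * septicQ (98 / 100)) := by
      have := hQ _ le_rfl
      gcongr
    norm_num at this i1
    linarith
  rw [septic_one_sub]
  have hq := hQ x hx98
  have h4 : (98 / 100 : ℝ) ^ 4 ≤ x ^ 4 := by gcongr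
  have : 16 ≤ A / 7 * (x ^ 4 * septicQ x) := by
    calc (16 : ℝ) ≤ 171 * ((98 / 100) ^ 4 * (1083 / 10000)) := by norm_num
      _ ≤ _ := by gcongr
  nlinarith

lemma septic_mult_le (h : septic.Kneads A) (n : ℕ) :
    septic.mult A n ^ 4 * ((1 - septic.F A septic.e) *
      (septic.F A septic.e + 1 - septic.e)) ^ 3 ≤
      500 ^ n * ((1 - septic.orb A n) * (septic.orb A n + 1 - septic.e)) ^ 3 := by
  induction n with
  | zero => simp [mult, orb_zero]
  | succ n ih =>
    have hs := septic_step h (h.orb_mem_Icc n)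
    rw [← orb_succ] at hs
    rw [mult, Finset.prod_range_succ, ← mult, pow_succ (500 : ℝ), mul_pow _ _ 4]
    have hf : 0 ≤ septic.F' A (septic.orb A n) ^ 4 := by positivity
    nlinarith [mul_le_mul_of_nonneg_left ih hf,
      mul_le_mul_of_nonneg_left hs (by positivity : (0 : ℝ) ≤ 500 ^ n)]

lemma septic_run (h : septic.Kneads A) (k j : ℕ) (hj : j + 1 ≤ run k) :
    16 ^ j * (1 - septic.orb A (big k + 1)) ≤ 1 - septic.orb A (big k + 1 + j) := by
  induction j with
  | zero => simp
  | succ j ih =>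
    have m1 := h.orb_mem (big k + 1 + j)
    have m2 := h.orb_mem (big k + 1 + (j + 1))
    rw [K_run (k := k) (by omega) (by omega)] at m1 m2
    rw [← add_assoc, orb_succ (big k + 1 + j)] at m2 ⊢
    have := septic_top h (le_of_lt m1) (h.orb_mem_Icc _).2 (le_of_lt m2)
    have := ih (by omega)
    rw [pow_succ]
    linarith

/-- At the first point of a long stay `1 - x` is at most a constant times `16 ^ (-run k)`, since it
grows by 16 at each step of the stay. Inserted into `septic_mult_le` it offsets the growth `500 ^
n`, because `500 ^ 4 ≤ 16 ^ 9` and `4 * run k ≥ 3 * big k`. -/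
lemma septic_mult_bounded (h : septic.Kneads A) :
    ∃ M : ℝ, ∀ k, |septic.mult A (big k + 1)| ≤ M := by
  have hlt := h.lt
  have hv := h.v_neg
  have he := septic.e_pos
  set c := ((1 - septic.F A septic.e) * (septic.F A septic.e + 1 - septic.e)) ^ 3 with hc
  have hc0 : 0 < c := pow_pos (mul_pos (by linarith) (by linarith)) 3
  obtain ⟨E, hE, hE0⟩ : ∃ E : ℝ, E = 64 * 16 ^ 3 ∧ 0 < E := ⟨_, rfl, by norm_num⟩
  obtain ⟨B, hB, hB0⟩ : ∃ B : ℝ, B = 500 ∧ 0 < B := ⟨_, rfl, by norm_num⟩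
  obtain ⟨R, hR, hR1⟩ : ∃ R : ℝ, R = 16 ∧ 1 < R := ⟨_, rfl, by norm_num⟩
  have hBR : B ^ 4 ≤ R ^ 9 := by rw [hB, hR]; norm_num
  have hER : (R * 2 * 2) ^ 3 = E := by rw [hE, hR]; norm_num
  refine ⟨max 1 (B ^ 4 * E ^ 4 / c ^ 4), fun k => ?_⟩
  have hr := run_bounds k
  have hk := five_le_len k; have hb := big_eq k
  set n := big k + 1 with hn
  set D := septic.mult A n with hD
  have h1 := septic_mult_le h n
  have h2 := septic_run h k (run k - 1) (by omega)
  rw [← hn, ← hR] at h2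
  rw [← hB] at h1
  have hm := h.orb_mem_Icc n
  have hm2 := h.orb_mem_Icc (n + (run k - 1))
  set x := septic.orb A n
  have a1 : 0 ≤ 1 - x := by linarith [hm.2]
  have a2 : 0 ≤ x + 1 - septic.e := by linarith [hm.1]
  have h3 : R ^ run k * (1 - x) ≤ R * 2 := by
    rw [show run k = (run k - 1) + 1 by omega, pow_succ]
    have := hm2.1
    nlinarith
  have h4 : D ^ 4 * c * (R ^ run k) ^ 3 ≤ B ^ n * E := by
    calc D ^ 4 * c * (R ^ run k) ^ 3
        ≤ B ^ n * ((1 - x) * (x + 1 - septic.e)) ^ 3 * (R ^ run k) ^ 3 := by gcongr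
      _ = B ^ n * ((R ^ run k * (1 - x)) * (x + 1 - septic.e)) ^ 3 := by ring
      _ ≤ B ^ n * (R * 2 * 2) ^ 3 := by
          have : x + 1 - septic.e ≤ 2 := by linarith [hm.2]
          gcongr
      _ = _ := by rw [hER]
  have h5 : D ^ 16 * c ^ 4 ≤ B ^ 4 * E ^ 4 := by
    have p : (0 : ℝ) < B ^ (4 * big k) := by positivity
    refine le_of_mul_le_mul_right ?_ p
    have h6 := pow_le_pow_left₀ (by positivity) h4 4
    have h7 : B ^ (4 * big k) ≤ ((R ^ run k) ^ 3) ^ 4 := by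
      calc B ^ (4 * big k) = (B ^ 4) ^ big k := pow_mul _ _ _
        _ ≤ (R ^ 9) ^ big k := by gcongr
        _ = R ^ (9 * big k) := (pow_mul _ _ _).symm
        _ ≤ R ^ (12 * run k) := pow_le_pow_right₀ hR1.le (by omega)
        _ = _ := by rw [← pow_mul, ← pow_mul]; congr 1; ring
    calc D ^ 16 * c ^ 4 * B ^ (4 * big k)
        ≤ D ^ 16 * c ^ 4 * ((R ^ run k) ^ 3) ^ 4 := by gcongr
      _ = (D ^ 4 * c * (R ^ run k) ^ 3) ^ 4 := by ring
      _ ≤ _ := h6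
      _ = _ := by rw [hn, mul_pow, ← pow_mul, show (big k + 1) * 4 = 4 * big k + 4 by ring, pow_add]; ring
  rcases le_total |D| 1 with h6 | h6
  · exact h6.trans (le_max_left _ _)
  · refine le_trans ?_ (le_max_right _ _)
    rw [le_div_iff₀ (by positivity)]
    have h7 : |D| ≤ |D| ^ 16 := le_self_pow₀ h6 (by norm_num)
    rw [(by decide : Even 16).pow_abs] at h7
    have : |D| * c ^ 4 ≤ D ^ 16 * c ^ 4 := by gcongr
    linarith

end Shape
end IntervalDynamics

namespace IntervalDynamics

/-! ### General facts on interval maps -/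

lemma hasDerivAt_iterate {f g : ℝ → ℝ} (hf : ∀ x, HasDerivAt f (g x) x) (n : ℕ) (x : ℝ) :
    HasDerivAt f^[n] (∏ i ∈ Finset.range n, g (f^[i] x)) x := by
  induction n with
  | zero => simpa using hasDerivAt_id x
  | succ n ih =>
    rw [Function.iterate_succ', Finset.prod_range_succ, mul_comm]
    exact (hf _).comp x ih

/-- The Schwarzian derivative in terms of the logarithmic derivative `L` of `f'` is `L' - L ^ 2 / 2`. -/
lemma schwarzian_neg_of_log_deriv {f g L : ℝ → ℝ} {l x : ℝ} (hf : ∀ y, HasDerivAt f (g y) y)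
    (hg : ∀ᶠ y in 𝓝 x, HasDerivAt g (g y * L y) y) (hL : HasDerivAt L l x) (hl : l < 0)
    (h0 : g x ≠ 0) : schwarzian f x < 0 := by
  have d1 : deriv f = g := funext fun y => (hf y).deriv
  have d2 : iteratedDeriv 2 f = deriv g := by
    rw [iteratedDeriv_succ, iteratedDeriv_one, d1]
  have e2 : deriv g =ᶠ[𝓝 x] fun y => g y * L y := hg.mono fun y hy => hy.deriv
  have d3 : iteratedDeriv 3 f x = g x * L x * L x + g x * l := by
    rw [iteratedDeriv_succ, d2, e2.deriv_eq]
    exact (hg.self_of_nhds.mul hL).deriv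
  rw [schwarzian, d3, d2, e2.self_of_nhds, d1]
  have : (g x * L x * L x + g x * l) / g x - 3 / 2 * (g x * L x / g x) ^ 2 = l - L x ^ 2 / 2 := by
    field_simp; ring
  rw [this]
  nlinarith [sq_nonneg (L x)]

lemma lap_eq_of_mem {l : ℕ} {c : Fin l → ℝ} {y : ℝ} {a b : Fin (l + 1)} (ha : y ∈ lap c a)
    (hb : y ∈ lap c b) : a = b := by
  by_contra hne
  wlog hlt : a < b generalizing a b
  · exact this hb ha (Ne.symm hne) (lt_of_le_of_ne (not_lt.1 hlt) (Ne.symm hne))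
  have hal : (a : ℕ) < l := by have := b.2; have : (a : ℕ) < b := hlt; omega
  have h1 := (ha.2 ⟨a, hal⟩).2 (le_of_eq (Fin.ext rfl))
  have h2 := (hb.2 ⟨a, hal⟩).1 hlt
  linarith

lemma symbol_eq_of_mem_lap {l : ℕ} {c : Fin l → ℝ} {y : ℝ} {a : Fin (l + 1)} (ha : y ∈ lap c a) :
    symbol c y = some (Sum.inl a) := by
  have hex : ∃ b, HasSymbol c y b := ⟨Sum.inl a, ha⟩
  rw [symbol, dif_pos hex]
  have hs := hex.choose_spec
  generalize hex.choose = b at hs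
  rcases b with b | i
  · rw [lap_eq_of_mem ha hs]
  · exfalso
    change y = c i at hs
    have := ha.2 i
    rcases lt_or_ge i.castSucc a with h | h
    · exact absurd (this.1 h) (by rw [hs]; exact lt_irrefl _)
    · exact absurd (this.2 h) (by rw [hs]; exact lt_irrefl _)

lemma notMem_range_of_mem_lap {l : ℕ} {c : Fin l → ℝ} {y : ℝ} {a : Fin (l + 1)}
    (ha : y ∈ lap c a) : y ∉ range c := by
  rintro ⟨i, hi⟩
  rcases lt_or_ge i.castSucc a with h | h
  · exact absurd ((ha.2 i).1 h) (by rw [hi]; exact lt_irrefl _)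
  · exact absurd ((ha.2 i).2 h) (by rw [hi]; exact lt_irrefl _)

lemma itinerary_eq_of_mem_lap {l : ℕ} {f : ℝ → ℝ} {c : Fin l → ℝ} {x : ℝ} {s : ℕ → Fin (l + 1)}
    (h : ∀ n, f^[n] x ∈ lap c (s n)) (n : ℕ) : itinerary f c x n = some (Sum.inl (s n)) := by
  rw [itinerary, if_pos fun m _ => notMem_range_of_mem_lap (h m), symbol_eq_of_mem_lap (h n)]

namespace Shape

variable {S S' : Shape} {A A' t t' : ℝ}

/-! ### Rescaling to the unit interval -/

/-- The map `S.F A` on `[t, 1]`, rescaled to the unit interval. -/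
noncomputable def model (S : Shape) (A t x : ℝ) : ℝ := (S.F A (t + (1 - t) * x) - t) / (1 - t)

/-- The turning points of the rescaled map. -/
noncomputable def turn (S : Shape) (t : ℝ) : Fin 2 → ℝ := ![-t / (1 - t), (S.e - t) / (1 - t)]

lemma Core.one_sub_pos (h : S.Core A t) : 0 < 1 - t := by linarith [h.t_neg]

lemma Core.affine_model (h : S.Core A t) (x : ℝ) :
    t + (1 - t) * S.model A t x = S.F A (t + (1 - t) * x) := by
  have := h.one_sub_pos.ne'
  rw [model]; field_simp; ring

lemma Core.affine_iterate (h : S.Core A t) (n : ℕ) (x : ℝ) :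
    t + (1 - t) * (S.model A t)^[n] x = (S.F A)^[n] (t + (1 - t) * x) := by
  induction n with
  | zero => rfl
  | succ n ih => rw [Function.iterate_succ_apply', Function.iterate_succ_apply', h.affine_model, ih]

lemma Core.affine_turn_zero (h : S.Core A t) : t + (1 - t) * S.turn t 0 = 0 := by
  have := h.one_sub_pos.ne'
  simp only [turn, Matrix.cons_val_zero]; field_simp; ring

lemma Core.affine_turn_one (h : S.Core A t) : t + (1 - t) * S.turn t 1 = S.e := by
  have := h.one_sub_pos.ne'
  simp only [turn, Matrix.cons_val_one, Matrix.cons_val_fin_one]; field_simp; ring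

lemma Core.affine_mem (h : S.Core A t) {x : ℝ} : t + (1 - t) * x ∈ Icc t 1 ↔ x ∈ I := by
  have := h.one_sub_pos
  simp only [mem_Icc]
  constructor
  · rintro ⟨h1, h2⟩
    constructor <;> nlinarith
  · rintro ⟨h1, h2⟩
    constructor <;> nlinarith

lemma Core.affine_lt (h : S.Core A t) {x y : ℝ} :
    t + (1 - t) * x < t + (1 - t) * y ↔ x < y := by
  rw [add_lt_add_iff_left, mul_lt_mul_iff_right₀ h.one_sub_pos]

lemma Core.affine_inj (h : S.Core A t) {x y : ℝ} :
    t + (1 - t) * x = t + (1 - t) * y ↔ x = y := by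
  rw [add_right_inj, mul_right_inj' h.one_sub_pos.ne']

lemma Core.turn_lt (h : S.Core A t) : S.turn t 0 < S.turn t 1 := by
  rw [← h.affine_lt, h.affine_turn_zero, h.affine_turn_one]; exact S.e_pos

lemma Core.mem_lap (h : S.Core A t) {x : ℝ} {a : Fin 3} :
    x ∈ lap (S.turn t) a ↔ x ∈ I ∧ t + (1 - t) * x ∈ S.op a := by
  have h1 := h.turn_lt
  have e0 : x < S.turn t 0 ↔ t + (1 - t) * x < 0 := by rw [← h.affine_turn_zero, h.affine_lt]
  have e0' : S.turn t 0 < x ↔ 0 < t + (1 - t) * x := by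
    rw [← h.affine_lt (x := S.turn t 0), h.affine_turn_zero]
  have e1 : x < S.turn t 1 ↔ t + (1 - t) * x < S.e := by rw [← h.affine_turn_one, h.affine_lt]
  have e1' : S.turn t 1 < x ↔ S.e < t + (1 - t) * x := by
    rw [← h.affine_lt (x := S.turn t 1), h.affine_turn_one]
  simp only [lap, mem_ofPred_eq, Fin.forall_fin_two]
  refine and_congr_right fun _ => ?_
  have c0 : (0 : Fin 2).castSucc = 0 := rfl
  have c1 : (1 : Fin 2).castSucc = 1 := rfl
  rw [c0, c1]
  fin_cases a
  · simp [← e0]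
    intro h2; linarith
  · simp [← e0', ← e1]
  · simp [← e1']
    intro h2; linarith

lemma Core.hasDerivAt_model (h : S.Core A t) (x : ℝ) :
    HasDerivAt (S.model A t) (S.F' A (t + (1 - t) * x)) x := by
  have h1 : HasDerivAt (fun x => t + (1 - t) * x) (1 - t) x := by
    simpa using ((hasDerivAt_id x).const_mul (1 - t)).const_add t
  have h2 := (((S.hasDerivAt_F A _).comp x h1).sub_const t).div_const (1 - t)
  refine h2.congr_deriv ?_
  have := h.one_sub_pos.ne'
  field_simp

lemma F'_eq_zero_iff (hA : 0 < A) {u : ℝ} : S.F' A u = 0 ↔ u = 0 ∨ u = S.e := by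
  have hk : S.k ≠ 0 := by intro h; have := S.k_odd; rw [h] at this; exact absurd this (by decide)
  simp [F', hA.ne', hk, sub_eq_zero]

lemma Core.mem_range_turn (h : S.Core A t) {x : ℝ} :
    x ∈ range (S.turn t) ↔ t + (1 - t) * x = 0 ∨ t + (1 - t) * x = S.e := by
  constructor
  · rintro ⟨i, rfl⟩
    fin_cases i
    · exact Or.inl h.affine_turn_zero
    · exact Or.inr h.affine_turn_one
  · rintro (hx | hx)
    · exact ⟨0, by rw [← h.affine_inj, h.affine_turn_zero, hx]⟩
    · exact ⟨1, by rw [← h.affine_inj, h.affine_turn_one, hx]⟩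

lemma Core.mapsTo_model (h : S.Core A t) : MapsTo (S.model A t) I I := fun x hx => by
  rw [← h.affine_mem, h.affine_model]
  exact h.mapsTo (h.affine_mem.2 hx)

lemma Core.model_zero (h : S.Core A t) : S.model A t 0 = 0 := by
  simp [model, h.fixed]

lemma Core.model_one (h : S.Core A t) : S.model A t 1 = 1 := by
  have := h.one_sub_pos.ne'
  simp [model, this]

lemma Core.model_le (h : S.Core A t) {x y : ℝ} :
    S.model A t x ≤ S.model A t y ↔ S.F A (t + (1 - t) * x) ≤ S.F A (t + (1 - t) * y) := by
  rw [← h.affine_model, ← h.affine_model, ← not_lt, ← not_lt, h.affine_lt]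

lemma Core.model_lt (h : S.Core A t) {x y : ℝ} :
    S.model A t x < S.model A t y ↔ S.F A (t + (1 - t) * x) < S.F A (t + (1 - t) * y) := by
  rw [← h.affine_model, ← h.affine_model, h.affine_lt]

lemma Core.crit_model (h : S.Core A t) : range (S.turn t) = Crit (S.model A t) := by
  have ht := h.t_neg
  have he := S.e_pos; have he1 := S.e_lt
  have hcont : Continuous fun x : ℝ => t + (1 - t) * x := by fun_prop
  ext x
  rw [h.mem_range_turn]
  have hIoo : x ∈ Ioo (0 : ℝ) 1 ↔ t + (1 - t) * x ∈ Ioo t 1 := by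
    have := h.one_sub_pos
    simp only [mem_Ioo]
    constructor
    · rintro ⟨h1, h2⟩
      constructor <;> nlinarith
    · rintro ⟨h1, h2⟩
      constructor <;> nlinarith
  constructor
  · rintro (hx | hx)
    · refine ⟨hIoo.2 (by rw [hx]; exact ⟨ht, one_pos⟩), Or.inr ?_⟩
      have hev : ∀ᶠ y in 𝓝 x, t + (1 - t) * y < 1 :=
        hcont.continuousAt.eventually_lt continuousAt_const (by rw [hx]; exact one_pos)
      filter_upwards [hev] with y hy
      rw [h.model_le, hx, F_zero]
      exact F_le_one h.pos hy.le
    · refine ⟨hIoo.2 (by rw [hx]; exact ⟨by linarith, he1⟩), Or.inl ?_⟩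
      have hev : ∀ᶠ y in 𝓝 x, S.e - 1 < t + (1 - t) * y :=
        continuousAt_const.eventually_lt hcont.continuousAt (by rw [hx]; linarith)
      filter_upwards [hev] with y hy
      rw [h.model_le, hx]
      exact F_e_le h.pos hy.le
  · rintro ⟨-, hx⟩
    have := hx.hasDerivAt_eq_zero (h.hasDerivAt_model x)
    rwa [F'_eq_zero_iff h.pos] at this

lemma Core.isModal (h : S.Core A t) : IsModal (S.model A t) (S.turn t) where
  continuousOn := fun x _ => (h.hasDerivAt_model x).continuousAt.continuousWithinAt
  mapsTo := h.mapsTo_model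
  mapsTo_boundary := by
    rintro x (rfl | rfl)
    · rw [h.model_zero]; simp
    · rw [h.model_one]; simp
  strictMono := by
    intro i j hij
    fin_cases i <;> fin_cases j <;> simp at hij
    exact h.turn_lt
  range_eq := h.crit_model
  monotone_lap a := by
    by_cases ha : a = 1
    · subst ha
      refine Or.inr fun x hx y hy hxy => ?_
      rw [h.model_lt]
      exact strictAntiOn_F h.pos (S.op_subset_cl 1 (h.mem_lap.1 hx).2)
        (S.op_subset_cl 1 (h.mem_lap.1 hy).2) (h.affine_lt.2 hxy)
    · refine Or.inl fun x hx y hy hxy => ?_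
      rw [h.model_lt]
      exact strictMonoOn_F h.pos ha (S.op_subset_cl a (h.mem_lap.1 hx).2)
        (S.op_subset_cl a (h.mem_lap.1 hy).2) (h.affine_lt.2 hxy)

/-- With `u = t + (1 - t) * x`, the logarithmic derivative of the derivative is `k (1 - t) (1/u +
1/(u - e))`, and its own derivative is minus a positive multiple of `1/u ^ 2 + 1/(u - e) ^ 2`. -/
lemma Core.schwarzian_model_neg (h : S.Core A t) {x : ℝ} (hx : x ∉ range (S.turn t)) :
    schwarzian (S.model A t) x < 0 := by
  rw [h.mem_range_turn, not_or] at hx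
  have hT := h.one_sub_pos
  have haff : ∀ y : ℝ, HasDerivAt (fun y => t + (1 - t) * y) (1 - t) y := fun y => by
    simpa using ((hasDerivAt_id y).const_mul (1 - t)).const_add t
  have hw : ∀ y : ℝ, HasDerivAt (fun y => (t + (1 - t) * y) * (t + (1 - t) * y - S.e))
      ((1 - t) * (2 * (t + (1 - t) * y) - S.e)) y := fun y => by
    refine ((haff y).mul ((haff y).sub_const S.e)).congr_deriv ?_
    ring
  have hkne : S.k ≠ 0 := by intro h; have := S.k_odd; rw [h] at this; exact absurd this (by decide)
  have hk : (0 : ℝ) < S.k := by exact_mod_cast Nat.pos_of_ne_zero hkne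
  have hw0 : (t + (1 - t) * x) * (t + (1 - t) * x - S.e) ≠ 0 :=
    mul_ne_zero hx.1 (sub_ne_zero.2 hx.2)
  refine schwarzian_neg_of_log_deriv (g := fun y => S.F' A (t + (1 - t) * y))
    (L := fun y => S.k * ((1 - t) * (2 * (t + (1 - t) * y) - S.e) /
      ((t + (1 - t) * y) * (t + (1 - t) * y - S.e))))
    (l := S.k * (((1 - t) * (2 * (1 - t)) * ((t + (1 - t) * x) * (t + (1 - t) * x - S.e)) -
      (1 - t) * (2 * (t + (1 - t) * x) - S.e) * ((1 - t) * (2 * (t + (1 - t) * x) - S.e))) /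
      ((t + (1 - t) * x) * (t + (1 - t) * x - S.e)) ^ 2))
    h.hasDerivAt_model ?_ ?_ ?_ ?_
  · have hev : ∀ᶠ y in 𝓝 x, (t + (1 - t) * y) * (t + (1 - t) * y - S.e) ≠ 0 :=
      (hw x).continuousAt.eventually_ne hw0
    filter_upwards [hev] with y hy
    refine (((hw y).pow S.k).const_mul A).congr_deriv ?_
    obtain ⟨k, hk⟩ := Nat.exists_eq_succ_of_ne_zero hkne
    simp only [F', hk, Nat.succ_eq_add_one, Nat.add_sub_cancel]
    generalize (t + (1 - t) * y) * (t + (1 - t) * y - S.e) = w at hy ⊢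
    field_simp
    ring
  · have h2 : HasDerivAt (fun y : ℝ => (1 - t) * (2 * (t + (1 - t) * y) - S.e))
        ((1 - t) * (2 * (1 - t))) x :=
      (((haff x).const_mul 2).sub_const S.e).const_mul (1 - t)
    exact (h2.div (hw x) hw0).const_mul _
  · refine mul_neg_of_pos_of_neg hk (div_neg_of_neg_of_pos ?_ (by positivity))
    generalize t + (1 - t) * x = u at *
    have hu : 0 < u ^ 2 := by have := hx.1; positivity
    have : 0 < (1 - t) ^ 2 * (u ^ 2 + (u - S.e) ^ 2) := by positivity
    nlinarith
  · rw [Ne, F'_eq_zero_iff h.pos, not_or]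
    exact hx

lemma Core.isAnalyticSModal (h : S.Core A t) (ha : AnalyticOnNhd ℝ (S.model A t) I) :
    IsAnalyticSModal (S.model A t) (S.turn t) where
  toIsModal := h.isModal
  analytic := ha
  deriv_ne_zero x _ hx := by
    rw [(h.hasDerivAt_model x).deriv, Ne, F'_eq_zero_iff h.pos]
    rwa [h.mem_range_turn] at hx
  schwarzian_neg x _ hx := h.schwarzian_model_neg hx

/-! ### Kneading invariant, conjugacy, recurrence and derivatives -/

lemma Core.affine_model_turn_zero (h : S.Core A t) :
    t + (1 - t) * S.model A t (S.turn t 0) = 1 := by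
  rw [h.affine_model, h.affine_turn_zero, F_zero]

lemma Core.affine_model_turn_one (h : S.Core A t) :
    t + (1 - t) * S.model A t (S.turn t 1) = S.orb A 0 := by
  rw [h.affine_model, h.affine_turn_one, orb_zero]

lemma Core.iterate_mem_lap (h : S.Core A t) {x u : ℝ} (hx : t + (1 - t) * x = u)
    (hu : u ∈ Icc t 1) {s : ℕ → Fin 3} (hs : ∀ n, (S.F A)^[n] u ∈ S.op (s n)) (n : ℕ) :
    (S.model A t)^[n] x ∈ lap (S.turn t) (s n) := by
  subst hx
  rw [h.mem_lap, h.affine_iterate]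
  exact ⟨h.mapsTo_model.iterate n (h.affine_mem.1 hu), hs n⟩

lemma Core.kneadingInvariant_model (h : S.Core A t) :
    kneadingInvariant (S.model A t) (S.turn t) =
      ![fun _ => some (Sum.inl 2), fun n => some (Sum.inl (K n))] := by
  ext1 i
  ext1 n
  fin_cases i
  · exact itinerary_eq_of_mem_lap (s := fun _ => 2) (h.iterate_mem_lap h.affine_model_turn_zero
      ⟨by linarith [h.t_neg], le_rfl⟩
      fun n => by rw [Function.iterate_fixed (S.F_one A)]; exact S.e_lt) n
  · exact itinerary_eq_of_mem_lap (s := K) (h.iterate_mem_lap h.affine_model_turn_one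
      (h.subset (h.orb_mem_Icc 0)) fun n => h.orb_mem n) n

/-- The increasing affine bijection of the unit interval onto `[t, 1]`. -/
noncomputable def Core.affineIso (h : S.Core A t) : I ≃o Icc t 1 where
  toFun x := ⟨t + (1 - t) * x, h.affine_mem.2 x.2⟩
  invFun u := ⟨(u - t) / (1 - t), by
    have := h.one_sub_pos
    exact ⟨div_nonneg (by linarith [u.2.1]) this.le,
      (div_le_one this).2 (by linarith [u.2.2])⟩⟩
  left_inv x := Subtype.ext (by
    have := h.one_sub_pos.ne'
    change (t + (1 - t) * (x : ℝ) - t) / (1 - t) = x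
    field_simp; ring)
  right_inv u := Subtype.ext (by
    have := h.one_sub_pos.ne'
    change t + (1 - t) * ((u - t) / (1 - t)) = (u : ℝ)
    field_simp; ring)
  map_rel_iff' {x y} := by
    change t + (1 - t) * (x : ℝ) ≤ t + (1 - t) * (y : ℝ) ↔ (x : ℝ) ≤ y
    rw [← not_lt, ← not_lt, h.affine_lt]

lemma topConjugate_model (h : S.Core A t) (h' : S'.Core A' t') :
    TopConjugate (S.model A t) (S'.model A' t') := by
  obtain ⟨φ, hφ⟩ := exists_conjugacy h h'
  refine ⟨h.mapsTo_model, h'.mapsTo_model,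
    ((h.affineIso.trans φ).trans h'.affineIso.symm).toHomeomorph, fun x => ?_⟩
  refine h'.affineIso.injective (Subtype.ext ?_)
  simp only [OrderIso.coe_toHomeomorph, OrderIso.trans_apply, OrderIso.apply_symm_apply]
  rw [hφ (h.affineIso x) _ (h.affine_model x)]
  refine Eq.trans ?_ (h'.affine_model _).symm
  change _ = S'.F A' ↑(h'.affineIso (h'.affineIso.symm (φ (h.affineIso x))))
  rw [OrderIso.apply_symm_apply]

/-- The image of a cluster point has itinerary `K`, because after `ret k` the orbit follows `K` for
`len k` symbols. It therefore equals `v`, and in the middle lap only `e` maps to `v`. -/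
lemma Core.tendsto_return (h : S.Core A t) :
    Tendsto (fun k => S.orb A (ret k - 1)) atTop (𝓝 S.e) := by
  have hret : ∀ k, 0 < ret k := fun k => by have := ret_eq k; omega
  refine isCompact_Icc.tendsto_nhds_of_unique_mapClusterPt (s := Icc 0 S.e) (Eventually.of_forall
    fun k => ?_) fun y hy hc => ?_
  · have := h.orb_mem (ret k - 1)
    rw [K_pred_ret] at this
    exact S.op_subset_cl 1 this
  · have ht := h.t_neg; have he := S.e_pos; have he1 := S.e_lt
    refine (strictAntiOn_F h.pos).injOn hy (right_mem_Icc.2 he.le) ?_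
    refine h.eq_of_itinerary_K (h.mapsTo ⟨by linarith [hy.1], by linarith [hy.2]⟩)
      (h.subset (h.orb_mem_Icc 0)) (fun i => ?_) fun i => S.op_subset_cl _ (h.orb_mem i)
    have hcl : MapClusterPt ((S.F A)^[i] (S.F A y)) atTop
        ((fun u => (S.F A)^[i] (S.F A u)) ∘ fun k => S.orb A (ret k - 1)) :=
      hc.continuousAt_comp (f := fun u => (S.F A)^[i] (S.F A u)) (((S.continuous_F A).iterate i).comp (S.continuous_F A)).continuousAt
    refine (S.isClosed_cl (K i)).mem_of_mapClusterPt hcl ?_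
    filter_upwards [eventually_ge_atTop i] with k hk
    have hlen := lt_len k
    have := h.orb_mem (ret k + i)
    rw [K_ret (by omega)] at this
    simp only [Function.comp_apply]
    rw [← orb_succ, Nat.sub_add_cancel (hret k), iterate_orb, add_comm]
    exact S.op_subset_cl _ this

lemma Core.isRecurrent_turn (h : S.Core A t) : IsRecurrent (S.model A t) (S.turn t 1) := by
  have hT := h.one_sub_pos
  have hret : ∀ k, ret k = (ret k - 1) + 1 := fun k => by have := ret_eq k; omega
  have hval : ∀ k, (S.model A t)^[ret k] (S.turn t 1) = (S.orb A (ret k - 1) - t) / (1 - t) := by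
    intro k
    have := h.affine_iterate (ret k) (S.turn t 1)
    rw [h.affine_turn_one] at this
    have h2 : (S.F A)^[ret k] S.e = S.orb A (ret k - 1) := by
      conv_lhs => rw [hret k]
      rw [Function.iterate_succ_apply]; rfl
    rw [h2] at this
    rw [eq_div_iff hT.ne']; linarith
  rw [IsRecurrent, mem_omegaLimit_singleton_iff_mapClusterPt]
  refine MapClusterPt.of_comp (φ := ret) (p := atTop) ?_ (Tendsto.mapClusterPt ?_)
  · refine tendsto_atTop_mono (fun k => ?_) tendsto_id
    have := ret_eq k; have := big_eq k; have := lt_len k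
    simp only [id]; omega
  · have : (fun n => (S.model A t)^[n] (S.turn t 1)) ∘ ret =
        fun k => (S.orb A (ret k - 1) - t) / (1 - t) := funext hval
    rw [this]
    have e : S.turn t 1 = (S.e - t) / (1 - t) := rfl
    rw [e]
    exact (h.tendsto_return.sub_const t).div_const _

lemma Core.deriv_iterate_turn_one (h : S.Core A t) (n : ℕ) :
    deriv (S.model A t)^[n] (S.model A t (S.turn t 1)) = S.mult A n := by
  rw [(hasDerivAt_iterate h.hasDerivAt_model n _).deriv, mult]
  refine Finset.prod_congr rfl fun i _ => ?_
  rw [h.affine_iterate, h.affine_model_turn_one]; rfl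

/-- The critical value of this turning point is the repelling fixed point. -/
lemma Core.isCEAt_turn_zero (h : S.Core A t) : IsCEAt (S.model A t) (S.turn t 0) := by
  have h1 := h.one_lt_F'
  refine ⟨1 / 2, S.F' A 1, by norm_num, h1, fun n => ?_⟩
  rw [(hasDerivAt_iterate h.hasDerivAt_model n _).deriv]
  have : ∀ i, S.F' A (t + (1 - t) * (S.model A t)^[i] (S.model A t (S.turn t 0))) = S.F' A 1 := by
    intro i
    rw [h.affine_iterate, h.affine_model_turn_zero, Function.iterate_fixed (S.F_one A)]
  simp only [this, Finset.prod_const, Finset.card_range]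
  have hp : 0 < S.F' A 1 ^ n := pow_pos (by linarith) n
  rw [abs_of_pos hp]
  linarith

lemma isCE_cubic (h : cubic.Core A t) : IsCE (cubic.model A t) := by
  intro c hc
  rw [← h.crit_model] at hc
  obtain ⟨i, rfl⟩ := hc
  fin_cases i
  · exact h.isCEAt_turn_zero
  · obtain ⟨C, lam, hC, hlam, hgrow⟩ := cubic_mult_growth h.toKneads
    exact ⟨C, lam, hC, hlam, fun n => (hgrow n).trans_eq
      (congrArg abs (h.deriv_iterate_turn_one n).symm)⟩

lemma not_isCEAt_septic (h : septic.Core A t) :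
    ¬ IsCEAt (septic.model A t) (septic.turn t 1) := by
  rintro ⟨C, lam, hC, hlam, hgrow⟩
  obtain ⟨M, hM⟩ := septic_mult_bounded h.toKneads
  obtain ⟨n, hn⟩ := pow_unbounded_of_one_lt (M / C) hlam
  have h1 := hgrow (big n + 1)
  rw [h.deriv_iterate_turn_one] at h1
  have h2 := hM n
  have h3 : lam ^ n ≤ lam ^ (big n + 1) := pow_le_pow_right₀ hlam.le (by
    have := big_eq n; have := lt_len n; omega)
  rw [div_lt_iff₀ hC] at hn
  nlinarith

/-! ### Polynomials -/

lemma exists_polynomial (A t : ℝ) {p : ℝ[X]} (hp : ∀ u, p.eval u = S.H u) :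
    ∃ P : ℝ[X], ∀ x, P.eval x = S.model A t x :=
  ⟨C (1 / (1 - t)) * ((C 1 + C A * p).comp (C t + C (1 - t) * X) - C t), fun x => by
    simp [model, F, hp]; ring⟩

lemma Core.derivative_eq (h : S.Core A t) {P : ℝ[X]} (hP : ∀ x, P.eval x = S.model A t x) :
    P.derivative = C (A * (1 - t) ^ (2 * S.k)) * (X - C (S.turn t 0)) ^ S.k *
      (X - C (S.turn t 1)) ^ S.k := by
  refine Polynomial.funext fun x => ?_
  have h1 : (fun x => P.eval x) = S.model A t := funext hP
  rw [← Polynomial.deriv, h1, (h.hasDerivAt_model x).deriv]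
  have e0 : t + (1 - t) * x = (1 - t) * (x - S.turn t 0) := by linarith [h.affine_turn_zero]
  have e1 : t + (1 - t) * x - S.e = (1 - t) * (x - S.turn t 1) := by linarith [h.affine_turn_one]
  rw [F', e1, e0]
  simp only [eval_mul, eval_C, eval_pow, eval_sub, eval_X]
  simp only [mul_pow]
  ring

lemma Core.natDegree_eq (h : S.Core A t) {P : ℝ[X]} (hP : ∀ x, P.eval x = S.model A t x) :
    P.natDegree = 2 * S.k + 1 := by
  have hb : A * (1 - t) ^ (2 * S.k) ≠ 0 := mul_ne_zero h.pos.ne' (pow_ne_zero _ h.one_sub_pos.ne')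
  have h1 := Polynomial.natDegree_derivative P
  rw [h.derivative_eq hP, natDegree_mul, natDegree_C_mul hb, natDegree_pow, natDegree_pow,
    natDegree_X_sub_C, natDegree_X_sub_C] at h1
  · have := S.k_odd.pos
    omega
  · exact mul_ne_zero (C_ne_zero.2 hb) (pow_ne_zero _ (X_sub_C_ne_zero _))
  · exact pow_ne_zero _ (X_sub_C_ne_zero _)

/-- Differentiation lowers the multiplicity of a root by one, and the derivative is explicitly
factored. -/
lemma Core.localDegree_eq (h : S.Core A t) {P : ℝ[X]} (hP : ∀ x, P.eval x = S.model A t x)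
    (i : Fin 2) : localDegree P (S.turn t i) = S.k + 1 := by
  have hb : A * (1 - t) ^ (2 * S.k) ≠ 0 := mul_ne_zero h.pos.ne' (pow_ne_zero _ h.one_sub_pos.ne')
  have hroot : (P - C (P.eval (S.turn t i))).IsRoot (S.turn t i) := by simp
  have h1 := derivative_rootMultiplicity_of_root hroot
  have hk := S.k_odd.pos
  have hne := h.turn_lt.ne
  have h01 : ∀ {a b : ℝ}, a ≠ b → ((X - C a) ^ S.k).rootMultiplicity b = 0 := fun hab => by
    rw [rootMultiplicity_eq_zero_iff]
    intro hr
    simp [sub_eq_zero] at hr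
    exact absurd hr.1.symm hab
  have hp : ∀ a : ℝ, (X - C a) ^ S.k ≠ 0 := fun a => pow_ne_zero _ (X_sub_C_ne_zero _)
  rw [derivative_sub, derivative_C, sub_zero, h.derivative_eq hP, rootMultiplicity_mul
    (mul_ne_zero (mul_ne_zero (C_ne_zero.2 hb) (hp _)) (hp _)), rootMultiplicity_mul
    (mul_ne_zero (C_ne_zero.2 hb) (hp _)), rootMultiplicity_C, zero_add] at h1
  rw [localDegree]
  fin_cases i
  · simp only [Fin.zero_eta, rootMultiplicity_X_sub_C_pow, h01 hne.symm] at h1 ⊢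
    omega
  · simp only [Fin.mk_one, rootMultiplicity_X_sub_C_pow, h01 hne] at h1 ⊢
    omega

lemma Core.analytic_of_polynomial {P : ℝ[X]} (hP : ∀ x, P.eval x = S.model A t x) :
    AnalyticOnNhd ℝ (S.model A t) I := by
  rw [← funext hP]
  exact fun x _ => AnalyticAt.aeval_polynomial analyticAt_id P

lemma exists_polynomial_cubic : ∃ p : ℝ[X], ∀ u, p.eval u = cubic.H u :=
  ⟨C (1 / 3) * (X ^ 3 - X ^ 2), fun u => by simp [cubic]; ring⟩

lemma exists_polynomial_septic : ∃ p : ℝ[X], ∀ u, p.eval u = septic.H u :=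
  ⟨C (1 / 7) * X ^ 7 - C (septicE / 2) * X ^ 6 + C (3 * septicE ^ 2 / 5) * X ^ 5 -
    C (septicE ^ 3 / 4) * X ^ 4, fun u => by simp [septic]; ring⟩

end Shape

open Shape in
theorem exists_polynomial_pair : ∃ (P Q : ℝ[X]) (c d : Fin 2 → ℝ),
    P.natDegree = 3 ∧ Q.natDegree = 7 ∧ P.eval 0 = 0 ∧ Q.eval 0 = 0 ∧
    IsAnalyticSModal (fun x => P.eval x) c ∧ IsAnalyticSModal (fun x => Q.eval x) d ∧
    (∀ i, localDegree P (c i) = 2) ∧ (∀ i, localDegree Q (d i) = 4) ∧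
    kneadingInvariant (fun x => P.eval x) c = kneadingInvariant (fun x => Q.eval x) d ∧
    TopConjugate (fun x => P.eval x) (fun x => Q.eval x) ∧
    IsCE (fun x => P.eval x) ∧ IsRCE (fun x => P.eval x) ∧
    IsRecurrent (fun x => Q.eval x) (d 1) ∧ ¬ IsCEAt (fun x => Q.eval x) (d 1) ∧
    ¬ IsRCE (fun x => Q.eval x) := by
  obtain ⟨A, hA⟩ := exists_kneads cubic
  obtain ⟨t, h⟩ := hA.exists_core
  obtain ⟨B, hB⟩ := exists_kneads septic
  obtain ⟨t', h'⟩ := hB.exists_core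
  obtain ⟨p, hp⟩ := exists_polynomial_cubic
  obtain ⟨q, hq⟩ := exists_polynomial_septic
  obtain ⟨P, hP⟩ := exists_polynomial A t hp
  obtain ⟨Q, hQ⟩ := exists_polynomial B t' hq
  have eP : (fun x => P.eval x) = cubic.model A t := funext hP
  have eQ : (fun x => Q.eval x) = septic.model B t' := funext hQ
  have hce := isCE_cubic h
  have hnce := not_isCEAt_septic h'
  have hrec := h'.isRecurrent_turn
  refine ⟨P, Q, cubic.turn t, septic.turn t', h.natDegree_eq hP, h'.natDegree_eq hQ,
    by rw [hP, h.model_zero], by rw [hQ, h'.model_zero], ?_⟩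
  rw [eP, eQ]
  refine ⟨h.isAnalyticSModal (Core.analytic_of_polynomial hP),
    h'.isAnalyticSModal (Core.analytic_of_polynomial hQ), h.localDegree_eq hP,
    h'.localDegree_eq hQ, by rw [h.kneadingInvariant_model, h'.kneadingInvariant_model],
    topConjugate_model h h', hce, fun c hc _ => hce c hc, hrec, hnce, fun hr => hnce (hr _ ?_ hrec)⟩
  rw [← h'.crit_model]
  exact ⟨1, rfl⟩

end IntervalDynamics

theorem theoremB :
    (¬ ∀ f g : ℝ → ℝ,
        IntervalDynamics.IsAnalyticSMultimodal f → IntervalDynamics.IsAnalyticSMultimodal g →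
        IntervalDynamics.TopConjugate f g →
        (IntervalDynamics.IsRCE f ↔ IntervalDynamics.IsRCE g)) ∧
    (∃ (P Q : Polynomial ℝ) (c d : Fin 2 → ℝ),
        P.natDegree = 3 ∧ Q.natDegree = 7 ∧
        P.eval 0 = 0 ∧ Q.eval 0 = 0 ∧
        IntervalDynamics.IsAnalyticSModal (fun x => P.eval x) c ∧
        IntervalDynamics.IsAnalyticSModal (fun x => Q.eval x) d ∧
        (∀ i, IntervalDynamics.localDegree P (c i) = 2) ∧
        (∀ i, IntervalDynamics.localDegree Q (d i) = 4) ∧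
        IntervalDynamics.kneadingInvariant (fun x => P.eval x) c =
          IntervalDynamics.kneadingInvariant (fun x => Q.eval x) d ∧
        IntervalDynamics.TopConjugate (fun x => P.eval x) (fun x => Q.eval x) ∧
        IntervalDynamics.IsCE (fun x => P.eval x) ∧
        IntervalDynamics.IsRCE (fun x => P.eval x) ∧
        IntervalDynamics.IsRecurrent (fun x => Q.eval x) (d 1) ∧
        ¬ IntervalDynamics.IsCEAt (fun x => Q.eval x) (d 1) ∧
        ¬ IntervalDynamics.IsRCE (fun x => Q.eval x)) := by
  have hpair := IntervalDynamics.exists_polynomial_pair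
  refine ⟨fun hinv => ?_, hpair⟩
  obtain ⟨P, Q, c, d, -, -, -, -, hP, hQ, -, -, -, hconj, -, hrce, -, -, hnrce⟩ := hpair
  exact hnrce ((hinv _ _ ⟨2, c, by norm_num, hP⟩ ⟨2, d, by norm_num, hQ⟩ hconj).1 hrce)
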